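/- Let $\mathcal T$ be a finite multiset of 3-element sets. Call $\mathcal T$ a simplicial 2-cycle if every 2-element set is contained in an even number of members of $\mathcal T$ (counted with multiplicity), and a simplicial 2-circuit if it is a non-empty simplicial 2-cycle and no proper non-empty sub-multiset of $\mathcal T$ is a simplicial 2-cycle. Let $G(\mathcal T)$ be the simple graph with vertex set $V(\mathcal T)=\bigcup_{S\in\mathcal T}S$ and edge set $E(\mathcal T)=\{\{u,v\} : u\neq v,\ \{u,v\}\subseteq S \text{ for some } S\in\mathcal T\}$. **Theorem.** If $\mathcal T$ is a simplicial 2-circuit with $|E(\mathcal T)|=3|V(\mathcal T)|-6$, then $G(\mathcal T)$ is a plane triangulation, that is, it has an embedding in the plane in which every face (including the unbounded one) is bounded by a triangle of $G(\mathcal T)$. Moreover, $\mathcal T$ is the family of faces of a plane embedding of $G(\mathcal T)$: there is a plane embedding of $G(\mathcal T)$ and a bijection from the members of $\mathcal T$ (with multiplicity) to its faces such that the boundary of the face corresponding to $S\in\mathcal T$ is the union of the three arcs representing the edges $\{u,v\}\subseteq S$. -/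

import Mathlib

/-! ### Simplicial multicomplexes, cycles and circuits -/

namespace SimplicialMulticomplex

variable {α : Type*}

/-- A finite multiset of finite sets is a simplicial `k`-multicomplex if all its members, the
`k`-simplices, have exactly `k + 1` elements. -/
def IsMulticomplex (k : ℕ) (T : Multiset (Finset α)) : Prop :=
  ∀ S ∈ T, S.card = k + 1

/-- The boundary: the `k`-element sets that are contained in an odd number of members of `T`,
counted with multiplicity. -/
def boundary [DecidableEq α] (k : ℕ) (T : Multiset (Finset α)) : Set (Finset α) :=
  {F | F.card = k ∧ Odd (T.filter (fun S => F ⊆ S)).card}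

/-- A simplicial `k`-cycle is a simplicial `k`-multicomplex with empty boundary. -/
def IsCycle [DecidableEq α] (k : ℕ) (T : Multiset (Finset α)) : Prop :=
  IsMulticomplex k T ∧ boundary k T = ∅

/-- A simplicial `k`-circuit is a non-empty simplicial `k`-cycle, no proper non-empty subfamily of
which is a simplicial `k`-cycle. -/
def IsCircuit [DecidableEq α] (k : ℕ) (T : Multiset (Finset α)) : Prop :=
  T ≠ 0 ∧ IsCycle k T ∧ ∀ U : Multiset (Finset α), U < T → U ≠ 0 → ¬ IsCycle k U

/-- The vertex set: the union of all simplices. -/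
def vertices (T : Multiset (Finset α)) : Set α :=
  {v | ∃ S ∈ T, v ∈ S}

/-- The graph of `T`: its vertices are the vertices of `T`, and two distinct vertices are adjacent
if some simplex contains both. -/
def graph (T : Multiset (Finset α)) : SimpleGraph (vertices T) where
  Adj u v := u ≠ v ∧ ∃ S ∈ T, (u : α) ∈ S ∧ (v : α) ∈ S
  symm := ⟨fun _ _ h => ⟨h.1.symm, h.2.imp fun _ hS => ⟨hS.1, hS.2.2, hS.2.1⟩⟩⟩
  loopless := ⟨fun _ h => h.1 rfl⟩

end SimplicialMulticomplex

/-! ### Plane embeddings of graphs -/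

/-- The Euclidean plane. -/
abbrev EuclideanPlane : Type := EuclideanSpace ℝ (Fin 2)

/-- `A` is a simple arc in the plane with end points `p` and `q`. -/
def IsSimpleArc (p q : EuclideanPlane) (A : Set EuclideanPlane) : Prop :=
  ∃ γ : Path p q, Function.Injective γ ∧ Set.range γ = A

/-- A plane embedding (crossing-free drawing) of a simple graph: vertices are distinct points, edges
are simple arcs joining their end points, an arc contains no other vertex, and two distinct arcs
meet only in common end points of the two edges. -/
structure PlaneEmbedding {V : Type*} (G : SimpleGraph V) where
  point : V → EuclideanPlane
  arc : G.edgeSet → Set EuclideanPlane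
  point_injective : Function.Injective point
  isSimpleArc : ∀ (u v : V) (h : s(u, v) ∈ G.edgeSet),
    IsSimpleArc (point u) (point v) (arc ⟨s(u, v), h⟩)
  mem_of_point_mem_arc : ∀ (e : G.edgeSet) (v : V), point v ∈ arc e → v ∈ (e : Sym2 V)
  inter_arc : ∀ e f : G.edgeSet, e ≠ f → ∀ x ∈ arc e ∩ arc f,
    ∃ v : V, v ∈ (e : Sym2 V) ∧ v ∈ (f : Sym2 V) ∧ x = point v

namespace PlaneEmbedding

variable {V : Type*} {G : SimpleGraph V}

/-- The point set of the drawing. -/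
def drawing (D : PlaneEmbedding G) : Set EuclideanPlane :=
  Set.range D.point ∪ ⋃ e : G.edgeSet, D.arc e

/-- The faces: the connected components of the complement of the drawing in the plane. -/
def faces (D : PlaneEmbedding G) : Set (Set EuclideanPlane) :=
  {F | ∃ x ∈ D.drawingᶜ, F = connectedComponentIn D.drawingᶜ x}

/-- The union of the arcs of all edges with both ends in `W`. -/
def arcsWithin (D : PlaneEmbedding G) (W : Set V) : Set EuclideanPlane :=
  ⋃ e : {e : G.edgeSet // ∀ v ∈ (e : Sym2 V), v ∈ W}, D.arc e.1

end PlaneEmbedding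

/-- `G` is a plane triangulation: a finite graph with a plane embedding in which every face (the
unbounded one included) is bounded by a triangle of `G`. -/
def IsPlaneTriangulation {V : Type*} (G : SimpleGraph V) : Prop :=
  Finite V ∧ ∃ D : PlaneEmbedding G, ∀ F ∈ D.faces, ∃ a b c : V,
    G.Adj a b ∧ G.Adj b c ∧ G.Adj a c ∧ frontier F = D.arcsWithin {a, b, c}

/-- The multiset `T` is the family of faces of the plane embedding `D` of its graph: the members of
`T`, with multiplicity, correspond bijectively to the faces of `D`, in such a way that the
topological boundary of the face corresponding to `S` is the union of the arcs of the edges between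
vertices of `S`. -/
def IsFaceFamily {α : Type*} [DecidableEq α] (T : Multiset (Finset α))
    (D : PlaneEmbedding (SimplicialMulticomplex.graph T)) : Prop :=
  ∃ φ : T.ToType ≃ D.faces, ∀ S : T.ToType,
    frontier (φ S : Set EuclideanPlane) = D.arcsWithin {v | (v : α) ∈ S.1}

/-! If some triple `S` occurs twice, then `{S, S}` is already a cycle, so it is all of `T` by
minimality, and the interior and exterior of a single triangle are the two faces. Otherwise `T` is a
set of triples. Let `V`, `E`, `F` be its numbers of vertices, edges and triples.

The edge count forces a homology sphere. Over `ℤ/2` consider the coboundary maps d₀ from functions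
on vertices to functions on edges and d₁ from functions on edges to functions on triples. Minimality
makes `T` strongly connected, so ker d₀ contains only constants, and it makes the kernel of the
transpose of d₁ at most one-dimensional. Since d₁ d₀ = 0, this gives (V - 1) + (F - 1) ≤ E. Every
edge lies in at least two triples, so 2E ≤ 3F. For E = 3V - 6 both inequalities must be equalities:
every edge lies in exactly two triples and ker d₁ = im d₀, that is, the first cohomology vanishes
(`IsEvenCircuit.card_eq_and_ker_le`, `IsEvenCircuit.isSphere`).

Such a sphere has a straight-line drawing with any prescribed outer triangle `o`. The drawing is
controlled by a local condition, `Realizes`: triangles with a common side lie on opposite sides of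
it, where `o` stands for its exterior. The local condition has a global consequence. Count signed
crossings of the sides with a vertical ray from a generic point `q`: the contributions of the two
triangles at an edge cancel, while the three sides of one triangle together detect whether `q` is
inside. Hence `q` lies in as many inner triangles as outer ones, that is, in none or in exactly one
(`Realizes.sum_openFace`). So the regions are disjoint and their closures cover the plane, which
identifies them with the faces (`Realizes.isFaceFamily`).

Existence of the drawing (`IsSphere.exists_realizes`) goes by induction on the number of triples.
Take a vertex `u` of `o` and a vertex `v` outside `o` such that `u v` lies in a triangle that shares
a side with `o`. If `u` and `v` have a common neighbour `z` such that `u v z` is not a member, then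
`u v z` separates the sphere, because its first cohomology vanishes. Each side, closed off by `u v
z`, is a smaller sphere, and the two drawings are glued by an affine map (`IsSeparation.isSphere`,
`IsSeparation.exists_realizes`). If there is no such `z`, then either the sphere is the boundary of
a tetrahedron, or contracting `u v` gives a smaller sphere, and its drawing is expanded by moving
`v` slightly away from `u` (`IsContractible.isSphere_contract`, `IsContractible.exists_realizes`).
-/

/-! ### Triangles in the plane -/

namespace EuclideanPlane

/-- Twice the signed area of the triangle `a b c`. -/
def orient (a b c : EuclideanPlane) : ℝ :=
  (b 0 - a 0) * (c 1 - a 1) - (b 1 - a 1) * (c 0 - a 0)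

theorem orient_swap (a b c : EuclideanPlane) : orient b a c = -orient a b c := by
  unfold orient; ring

theorem orient_rotate (a b c : EuclideanPlane) : orient b c a = orient a b c := by
  unfold orient; ring

theorem orient_self_left (a b : EuclideanPlane) : orient a b a = 0 := by
  unfold orient; ring

theorem orient_self_right (a b : EuclideanPlane) : orient a b b = 0 := by
  unfold orient; ring

theorem orient_add_smul (a b q v : EuclideanPlane) (t : ℝ) :
    orient a b (q + t • v) = orient a b q + t * (orient a b (q + v) - orient a b q) := by
  simp only [orient, PiLp.add_apply, PiLp.smul_apply, smul_eq_mul]; ring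

theorem orient_add_orient (a b c q : EuclideanPlane) :
    orient a b q + orient b c q + orient c a q = orient a b c := by
  unfold orient; ring

/-- These are the barycentric coordinates of `q`, cleared of the denominator `orient a b c`. -/
theorem orient_smul_eq (a b c q : EuclideanPlane) :
    orient a b c • q = orient b c q • a + orient c a q • b + orient a b q • c := by
  ext i
  fin_cases i <;> simp [orient] <;> ring

theorem continuous_orient {X : Type*} [TopologicalSpace X] {f g h : X → EuclideanPlane}
    (hf : Continuous f) (hg : Continuous g) (hh : Continuous h) :
    Continuous fun x => orient (f x) (g x) (h x) := by
  unfold orient; fun_prop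

/-- The open triangle `a b c`, provided that it is non-degenerate. -/
def openTri (a b c : EuclideanPlane) : Set EuclideanPlane :=
  {q | 0 < orient a b c * orient a b q ∧ 0 < orient a b c * orient b c q ∧
    0 < orient a b c * orient c a q}

/-- The closed triangle `a b c`, provided that it is non-degenerate. -/
def closedTri (a b c : EuclideanPlane) : Set EuclideanPlane :=
  {q | 0 ≤ orient a b c * orient a b q ∧ 0 ≤ orient a b c * orient b c q ∧
    0 ≤ orient a b c * orient c a q}

/-- The union of the sides of the triangle `a b c`. -/
def sides (a b c : EuclideanPlane) : Set EuclideanPlane :=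
  segment ℝ a b ∪ segment ℝ b c ∪ segment ℝ c a

theorem openTri_rotate (a b c : EuclideanPlane) : openTri b c a = openTri a b c := by
  ext q; simp only [openTri, Set.mem_ofPred_eq, orient_rotate a b c]; tauto

theorem openTri_swap (a b c : EuclideanPlane) : openTri b a c = openTri a b c := by
  ext q
  simp only [openTri, Set.mem_ofPred_eq, orient_swap a b, orient_swap c a, orient_swap b c,
    neg_mul_neg]
  tauto

theorem closedTri_rotate (a b c : EuclideanPlane) : closedTri b c a = closedTri a b c := by
  ext q; simp only [closedTri, Set.mem_ofPred_eq, orient_rotate a b c]; tauto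

theorem closedTri_swap (a b c : EuclideanPlane) : closedTri b a c = closedTri a b c := by
  ext q
  simp only [closedTri, Set.mem_ofPred_eq, orient_swap a b, orient_swap c a, orient_swap b c,
    neg_mul_neg]
  tauto

theorem isOpen_openTri (a b c : EuclideanPlane) : IsOpen (openTri a b c) := by
  have h : ∀ x y : EuclideanPlane, Continuous fun q => orient a b c * orient x y q := fun x y =>
    continuous_const.mul (continuous_orient continuous_const continuous_const continuous_id)
  exact (isOpen_lt continuous_const (h a b)).inter
    ((isOpen_lt continuous_const (h b c)).inter (isOpen_lt continuous_const (h c a)))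

theorem isClosed_closedTri (a b c : EuclideanPlane) : IsClosed (closedTri a b c) := by
  have h : ∀ x y : EuclideanPlane, Continuous fun q => orient a b c * orient x y q := fun x y =>
    continuous_const.mul (continuous_orient continuous_const continuous_const continuous_id)
  exact (isClosed_le continuous_const (h a b)).inter
    ((isClosed_le continuous_const (h b c)).inter (isClosed_le continuous_const (h c a)))

theorem openTri_subset_closedTri (a b c : EuclideanPlane) : openTri a b c ⊆ closedTri a b c :=
  fun _ h => ⟨h.1.le, h.2.1.le, h.2.2.le⟩

/-- The centroid of the triangle `a b c`. -/
noncomputable def centroid (a b c : EuclideanPlane) : EuclideanPlane :=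
  (3⁻¹ : ℝ) • (a + b + c)

theorem orient_centroid (a b c : EuclideanPlane) :
    orient a b (centroid a b c) = orient a b c / 3 ∧
    orient b c (centroid a b c) = orient a b c / 3 ∧
    orient c a (centroid a b c) = orient a b c / 3 := by
  simp only [orient, centroid, PiLp.add_apply, PiLp.smul_apply, smul_eq_mul]
  refine ⟨by ring, by ring, by ring⟩

/-- The three side functions are affine and equal a third of the doubled area at the centroid, so a
step from the closed triangle towards the centroid makes all of them strictly of the right sign. -/
theorem add_smul_mem_openTri {a b c q : EuclideanPlane} (h : orient a b c ≠ 0)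
    (hq : q ∈ closedTri a b c) {t : ℝ} (ht : 0 < t) (ht1 : t ≤ 1) :
    q + t • (centroid a b c - q) ∈ openTri a b c := by
  obtain ⟨h1, h2, h3⟩ := orient_centroid a b c
  obtain ⟨k1, k2, k3⟩ := hq
  have hp : 0 < orient a b c * orient a b c := mul_self_pos.2 h
  simp only [openTri, Set.mem_ofPred_eq, orient_add_smul, add_sub_cancel, h1, h2, h3]
  refine ⟨?_, ?_, ?_⟩ <;> nlinarith

theorem closure_openTri {a b c : EuclideanPlane} (h : orient a b c ≠ 0) :
    closure (openTri a b c) = closedTri a b c := by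
  refine (closure_minimal (openTri_subset_closedTri a b c) (isClosed_closedTri a b c)).antisymm
    fun q hq => ?_
  have hc : Filter.Tendsto (fun t : ℝ => q + t • (centroid a b c - q)) (nhdsWithin 0 (Set.Ioi 0))
      (nhds q) := by
    have : Continuous fun t : ℝ => q + t • (centroid a b c - q) := by fun_prop
    simpa using (this.tendsto 0).mono_left nhdsWithin_le_nhds
  refine mem_closure_of_tendsto hc ?_
  filter_upwards [Ioc_mem_nhdsGT (zero_lt_one (α := ℝ))] with t ht
  exact add_smul_mem_openTri h hq ht.1 ht.2

/-- Moving `q` away from the centroid must leave the closed triangle: otherwise `q`, strictly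
between the centroid and a point of the closed triangle, would be in the open one. -/
theorem closure_compl_closedTri {a b c : EuclideanPlane} (h : orient a b c ≠ 0) :
    closure (closedTri a b c)ᶜ = (openTri a b c)ᶜ := by
  refine (closure_minimal (Set.compl_subset_compl.2 (openTri_subset_closedTri a b c))
    (isOpen_openTri a b c).isClosed_compl).antisymm fun q hq => ?_
  have hc : Filter.Tendsto (fun t : ℝ => q + t • (q - centroid a b c)) (nhdsWithin 0 (Set.Ioi 0))
      (nhds q) := by
    have : Continuous fun t : ℝ => q + t • (q - centroid a b c) := by fun_prop
    simpa using (this.tendsto 0).mono_left nhdsWithin_le_nhds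
  refine mem_closure_of_tendsto hc ?_
  filter_upwards [self_mem_nhdsWithin] with t ht hmem
  have ht : (0 : ℝ) < t := ht
  refine hq ?_
  -- The displaced point is `1 + t` times as far from the centroid as `q`, so the way back to `q` is
  -- the fraction `t / (1 + t)` of the way to the centroid.
  have := add_smul_mem_openTri h hmem (t := t / (1 + t)) (by positivity)
    (by rw [div_le_one (by positivity)]; linarith)
  convert this using 1
  have h1 : 1 + t ≠ 0 := by positivity
  ext i
  simp only [PiLp.add_apply, PiLp.smul_apply, PiLp.sub_apply, smul_eq_mul]
  field_simp
  ring

theorem orient_of_mem_segment {a b q : EuclideanPlane} (hq : q ∈ segment ℝ a b) :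
    ∃ t : ℝ, 0 ≤ t ∧ t ≤ 1 ∧ orient a b q = 0 ∧
      ∀ c, orient b c q = (1 - t) * orient a b c ∧ orient c a q = t * orient a b c := by
  obtain ⟨s, t, hs, ht, hst, rfl⟩ := hq
  obtain rfl : s = 1 - t := by linarith
  refine ⟨t, ht, by linarith, ?_, fun c => ⟨?_, ?_⟩⟩ <;>
    simp only [orient, PiLp.add_apply, PiLp.smul_apply, smul_eq_mul] <;> ring

theorem orient_of_mem_openSegment {a b q : EuclideanPlane} (hq : q ∈ openSegment ℝ a b) :
    ∃ t : ℝ, 0 < t ∧ t < 1 ∧ orient a b q = 0 ∧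
      ∀ c, orient b c q = (1 - t) * orient a b c ∧ orient c a q = t * orient a b c := by
  obtain ⟨s, t, hs, ht, hst, rfl⟩ := hq
  obtain rfl : s = 1 - t := by linarith
  refine ⟨t, ht, by linarith, ?_, fun c => ⟨?_, ?_⟩⟩ <;>
    simp only [orient, PiLp.add_apply, PiLp.smul_apply, smul_eq_mul] <;> ring

theorem segment_subset_closedTri (a b c : EuclideanPlane) :
    segment ℝ a b ⊆ closedTri a b c := by
  intro q hq
  obtain ⟨t, h0, h1, h2, h3⟩ := orient_of_mem_segment hq
  have := mul_self_nonneg (orient a b c)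
  refine ⟨by simp [h2], ?_, ?_⟩
  · rw [(h3 c).1]; nlinarith
  · rw [(h3 c).2]; nlinarith

theorem mem_segment_of_orient {a b c q : EuclideanPlane} (h : orient a b c ≠ 0)
    (hq : q ∈ closedTri a b c) (h0 : orient a b q = 0) : q ∈ segment ℝ a b := by
  have h1 := orient_add_orient a b c q
  have h2 := orient_smul_eq a b c q
  refine ⟨orient b c q / orient a b c, orient c a q / orient a b c, ?_, ?_, ?_, ?_⟩
  · rw [← mul_div_mul_left _ _ h]
    exact div_nonneg hq.2.1 (mul_self_nonneg _)
  · rw [← mul_div_mul_left _ _ h]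
    exact div_nonneg hq.2.2 (mul_self_nonneg _)
  · rw [← add_div, div_eq_one_iff_eq h]; linarith
  · rw [h0, zero_smul, add_zero] at h2
    rw [div_eq_inv_mul, div_eq_inv_mul, mul_smul, mul_smul, ← smul_add, ← h2, smul_smul,
      inv_mul_cancel₀ h, one_smul]

theorem closedTri_diff_openTri {a b c : EuclideanPlane} (h : orient a b c ≠ 0) :
    closedTri a b c \ openTri a b c = sides a b c := by
  have hb : orient b c a ≠ 0 := by rwa [orient_rotate]
  have hc : orient c a b ≠ 0 := by rwa [orient_rotate]
  ext q
  constructor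
  · rintro ⟨hq, hn⟩
    by_cases h1 : orient a b q = 0
    · exact Or.inl (Or.inl (mem_segment_of_orient h hq h1))
    by_cases h2 : orient b c q = 0
    · exact Or.inl (Or.inr (mem_segment_of_orient hb (by rwa [closedTri_rotate]) h2))
    by_cases h3 : orient c a q = 0
    · exact Or.inr (mem_segment_of_orient hc (by rwa [closedTri_rotate, closedTri_rotate]) h3)
    refine absurd ⟨?_, ?_, ?_⟩ hn
    · exact lt_of_le_of_ne hq.1 (mul_ne_zero h h1).symm
    · exact lt_of_le_of_ne hq.2.1 (mul_ne_zero h h2).symm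
    · exact lt_of_le_of_ne hq.2.2 (mul_ne_zero h h3).symm
  · rintro ((hq | hq) | hq)
    · refine ⟨segment_subset_closedTri a b c hq, fun hn => ?_⟩
      obtain ⟨t, -, -, h2, -⟩ := orient_of_mem_segment hq
      simpa [h2] using hn.1
    · refine ⟨?_, fun hn => ?_⟩
      · rw [← closedTri_rotate]; exact segment_subset_closedTri b c a hq
      · obtain ⟨t, -, -, h2, -⟩ := orient_of_mem_segment hq
        simpa [h2] using hn.2.1
    · refine ⟨?_, fun hn => ?_⟩
      · rw [← closedTri_rotate, ← closedTri_rotate]; exact segment_subset_closedTri c a b hq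
      · obtain ⟨t, -, -, h2, -⟩ := orient_of_mem_segment hq
        simpa [h2] using hn.2.2

theorem frontier_openTri {a b c : EuclideanPlane} (h : orient a b c ≠ 0) :
    frontier (openTri a b c) = sides a b c := by
  rw [frontier, closure_openTri h, (isOpen_openTri a b c).interior_eq, closedTri_diff_openTri h]

theorem frontier_compl_closedTri {a b c : EuclideanPlane} (h : orient a b c ≠ 0) :
    frontier (closedTri a b c)ᶜ = sides a b c := by
  rw [frontier, closure_compl_closedTri h, (isClosed_closedTri a b c).isOpen_compl.interior_eq,
    ← closedTri_diff_openTri h, Set.sdiff_eq, Set.sdiff_eq, compl_compl, Set.inter_comm]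

theorem convex_halfPlane (k : ℝ) (a b : EuclideanPlane) :
    Convex ℝ {q | 0 < k * orient a b q} := by
  rintro x hx y hy s t hs ht hst
  have : orient a b (s • x + t • y) = s * orient a b x + t * orient a b y := by
    obtain rfl : s = 1 - t := by linarith
    simp only [orient, PiLp.add_apply, PiLp.smul_apply, smul_eq_mul]; ring
  simp only [Set.mem_ofPred_eq] at *
  rw [this]
  rcases hs.eq_or_lt with rfl | hs
  · obtain rfl : t = 1 := by linarith
    simpa using hy
  · nlinarith [mul_pos hs hx, mul_nonneg ht hy.le]

theorem isPreconnected_openTri (a b c : EuclideanPlane) : IsPreconnected (openTri a b c) :=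
  ((convex_halfPlane _ a b).inter
    ((convex_halfPlane _ b c).inter (convex_halfPlane _ c a))).isPreconnected

theorem openTri_nonempty {a b c : EuclideanPlane} (h : orient a b c ≠ 0) :
    (openTri a b c).Nonempty := by
  obtain ⟨h1, h2, h3⟩ := orient_centroid a b c
  have hp : 0 < orient a b c * orient a b c := mul_self_pos.2 h
  refine ⟨centroid a b c, ?_, ?_, ?_⟩ <;> simp only [h1, h2, h3] <;> linarith

/-- The witness is the reflection of the centroid in `b`. It shows that the outer half-planes of two
consecutive sides overlap, whence the exterior of a triangle is connected. -/
theorem exists_beyond_vertex {a b c : EuclideanPlane} (h : orient a b c ≠ 0) :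
    ∃ q, 0 < -orient a b c * orient a b q ∧ 0 < -orient a b c * orient b c q := by
  refine ⟨b + (1 : ℝ) • (b - centroid a b c), ?_⟩
  have hp : 0 < orient a b c * orient a b c := mul_self_pos.2 h
  constructor
  · have : orient a b (b + (1 : ℝ) • (b - centroid a b c)) = - orient a b c / 3 := by
      simp only [orient, centroid, PiLp.add_apply, PiLp.smul_apply, PiLp.sub_apply, smul_eq_mul]
      ring
    rw [this]; linarith
  · have : orient b c (b + (1 : ℝ) • (b - centroid a b c)) = - orient a b c / 3 := by
      simp only [orient, centroid, PiLp.add_apply, PiLp.smul_apply, PiLp.sub_apply, smul_eq_mul]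
      ring
    rw [this]; linarith

theorem compl_closedTri_eq (a b c : EuclideanPlane) : (closedTri a b c)ᶜ =
    {q | 0 < -orient a b c * orient a b q} ∪ {q | 0 < -orient a b c * orient b c q} ∪
      {q | 0 < -orient a b c * orient c a q} := by
  ext q
  simp only [closedTri, Set.mem_compl_iff, Set.mem_ofPred_eq, Set.mem_union, neg_mul, neg_pos,
    not_and_or, not_le, or_assoc]

theorem isPreconnected_compl_closedTri {a b c : EuclideanPlane} (h : orient a b c ≠ 0) :
    IsPreconnected (closedTri a b c)ᶜ := by
  rw [compl_closedTri_eq]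
  obtain ⟨q, h1, h2⟩ := exists_beyond_vertex h
  obtain ⟨r, h3, h4⟩ := exists_beyond_vertex (a := b) (b := c) (c := a) (by rwa [orient_rotate])
  rw [orient_rotate] at h3 h4
  exact ((convex_halfPlane _ a b).isPreconnected.union q h1 h2
    (convex_halfPlane _ b c).isPreconnected).union r (Or.inr h3) h4
    (convex_halfPlane _ c a).isPreconnected

theorem compl_closedTri_nonempty {a b c : EuclideanPlane} (h : orient a b c ≠ 0) :
    ((closedTri a b c)ᶜ).Nonempty := by
  rw [compl_closedTri_eq]
  obtain ⟨q, h1, h2⟩ := exists_beyond_vertex h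
  exact ⟨q, Or.inl (Or.inl h1)⟩

theorem isOpen_orient_ne_zero (a b : EuclideanPlane) : IsOpen {q | orient a b q ≠ 0} :=
  isOpen_ne_fun (continuous_orient continuous_const continuous_const continuous_id)
    continuous_const

theorem dense_orient_ne_zero {a b : EuclideanPlane} (h : a ≠ b) :
    Dense {q | orient a b q ≠ 0} := by
  obtain ⟨v, hv⟩ : ∃ v, ∀ q, orient a b (q + v) - orient a b q ≠ 0 := by
    -- This vector is normal to `a b`; adding it changes `orient a b` by the squared length of `b -
    -- a`.
    refine ⟨!₂[a 1 - b 1, b 0 - a 0], fun q h0 => h ?_⟩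
    have h1 : (b 0 - a 0) ^ 2 + (b 1 - a 1) ^ 2 = 0 := by
      rw [← h0]
      simp [orient]
      ring
    have h2 : b 0 - a 0 = 0 := by nlinarith [sq_nonneg (b 0 - a 0), sq_nonneg (b 1 - a 1)]
    have h3 : b 1 - a 1 = 0 := by nlinarith [sq_nonneg (b 0 - a 0), sq_nonneg (b 1 - a 1)]
    ext i
    fin_cases i <;> simp <;> linarith
  intro q
  by_cases hq : orient a b q = 0
  · have hc : Filter.Tendsto (fun t : ℝ => q + t • v) (nhdsWithin 0 (Set.Ioi 0)) (nhds q) := by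
      have : Continuous fun t : ℝ => q + t • v := by fun_prop
      simpa using (this.tendsto 0).mono_left nhdsWithin_le_nhds
    refine mem_closure_of_tendsto hc ?_
    filter_upwards [self_mem_nhdsWithin] with t ht
    have ht : (0 : ℝ) < t := ht
    simp only [orient_add_smul, hq, zero_add]
    have := hv q
    rw [hq] at this
    exact mul_ne_zero ht.ne' this
  · exact subset_closure hq

/-! ### Crossing numbers with a vertical ray. -/

/-- The signed number of crossings of the segment `a b` with the vertical ray upwards from `q`. -/
noncomputable def crossing (q a b : EuclideanPlane) : ℤ := by
  classical
  exact ((if a 0 < q 0 then 1 else 0) - (if b 0 < q 0 then 1 else 0)) *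
    (if orient a b q * (b 0 - a 0) < 0 then 1 else 0)

theorem crossing_swap (q a b : EuclideanPlane) : crossing q b a = -crossing q a b := by
  have : orient b a q * (a 0 - b 0) = orient a b q * (b 0 - a 0) := by
    rw [orient_swap]; ring
  unfold crossing
  rw [this]
  ring

/-- Barycentric coordinates annihilate the horizontal offsets from `q`. This linear relation ties
the signs of the three orientations to the sides of the vertical line on which the vertices lie. -/
theorem orient_combination (a b c q : EuclideanPlane) :
    orient b c q * (q 0 - a 0) + orient c a q * (q 0 - b 0) + orient a b q * (q 0 - c 0) = 0 := by
  unfold orient; ring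

open Classical in
/-- Crossings of the sides of a counterclockwise triangle, if `a` is on one side of the vertical
line through `q` and `b`, `c` are on the other. -/
theorem crossing_add_of_split {a b c q : EuclideanPlane} (h : 0 < orient a b c)
    (hab : orient a b q ≠ 0) (hca : orient c a q ≠ 0)
    (hs : (a 0 < q 0 ∧ q 0 < b 0 ∧ q 0 < c 0) ∨ (q 0 < a 0 ∧ b 0 < q 0 ∧ c 0 < q 0)) :
    crossing q a b + crossing q b c + crossing q c a = -(if q ∈ openTri a b c then 1 else 0) := by
  have hsum := orient_add_orient a b c q
  have hcomb := orient_combination a b c q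
  have hmem : q ∈ openTri a b c ↔ 0 < orient a b q ∧ 0 < orient b c q ∧ 0 < orient c a q := by
    simp only [openTri, Set.mem_ofPred_eq, mul_pos_iff_of_pos_left h]
  rw [if_congr hmem rfl rfl]
  -- Only `a b` and `c a` cross the vertical line. The point `q` cannot be beyond both of them, and
  -- if it is inside both, it is also inside `b c`.
  have key1 : orient a b q < 0 → orient c a q < 0 → False := by
    intro h1 h2
    rcases hs with ⟨ha, hb, hc⟩ | ⟨ha, hb, hc⟩ <;>
    nlinarith [mul_pos_of_neg_of_neg h1 (sub_neg.2 hc), mul_pos_of_neg_of_neg h2 (sub_neg.2 hb),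
      mul_neg_of_neg_of_pos h1 (sub_pos.2 hc), mul_neg_of_neg_of_pos h2 (sub_pos.2 hb)]
  have key2 : 0 < orient a b q → 0 < orient c a q → 0 < orient b c q := by
    intro h1 h2
    rcases hs with ⟨ha, hb, hc⟩ | ⟨ha, hb, hc⟩ <;>
    by_contra h3 <;>
    nlinarith
  rcases hs with ⟨ha, hb, hc⟩ | ⟨ha, hb, hc⟩
  · have h1 : orient a b q * (b 0 - a 0) < 0 ↔ orient a b q < 0 :=
      ⟨fun h => by nlinarith, fun h => mul_neg_of_neg_of_pos h (by linarith)⟩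
    have h2 : orient c a q * (a 0 - c 0) < 0 ↔ 0 < orient c a q :=
      ⟨fun h => by nlinarith, fun h => mul_neg_of_pos_of_neg h (by linarith)⟩
    simp only [crossing, ha, hb.not_gt, hc.not_gt, h1, h2, if_true, if_false]
    rcases hab.lt_or_gt with k | k <;> rcases hca.lt_or_gt with l | l
    · exact (key1 k l).elim
    · simp [k, l, k.not_gt]
    · simp [k, k.not_gt, l.not_gt]
    · simp [k, l, k.not_gt, key2 k l]
  · have h1 : orient a b q * (b 0 - a 0) < 0 ↔ 0 < orient a b q :=
      ⟨fun h => by nlinarith, fun h => mul_neg_of_pos_of_neg h (by linarith)⟩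
    have h2 : orient c a q * (a 0 - c 0) < 0 ↔ orient c a q < 0 :=
      ⟨fun h => by nlinarith, fun h => mul_neg_of_neg_of_pos h (by linarith)⟩
    simp only [crossing, ha.not_gt, hb, hc, h1, h2, if_true, if_false]
    rcases hab.lt_or_gt with k | k <;> rcases hca.lt_or_gt with l | l
    · exact (key1 k l).elim
    · simp [l, k.not_gt, l.not_gt]
    · simp [k, l, l.not_gt]
    · simp [k, l, l.not_gt, key2 k l]

open Classical in
-- Either all vertices are on one side of the vertical line, when nothing is crossed and `q` is
-- outside, or a rotation puts the vertex that is alone on its side first.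
theorem crossing_add_of_pos {a b c q : EuclideanPlane} (h : 0 < orient a b c)
    (hab : orient a b q ≠ 0) (hbc : orient b c q ≠ 0) (hca : orient c a q ≠ 0)
    (ha : a 0 ≠ q 0) (hb : b 0 ≠ q 0) (hc : c 0 ≠ q 0) :
    crossing q a b + crossing q b c + crossing q c a = -(if q ∈ openTri a b c then 1 else 0) := by
  have hb' : 0 < orient b c a := by rwa [orient_rotate]
  have hc' : 0 < orient c a b := by rwa [orient_rotate]
  have key : (0 < a 0 - q 0 ∧ 0 < b 0 - q 0 ∧ 0 < c 0 - q 0) ∨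
      (0 < q 0 - a 0 ∧ 0 < q 0 - b 0 ∧ 0 < q 0 - c 0) →
    crossing q a b + crossing q b c + crossing q c a =
      -(if q ∈ openTri a b c then 1 else 0) := by
    intro hs
    have hcomb := orient_combination a b c q
    have hmem : q ∉ openTri a b c := by
      rintro ⟨h1, h2, h3⟩
      rw [mul_pos_iff_of_pos_left h] at h1 h2 h3
      rcases hs with ⟨ka, kb, kc⟩ | ⟨ka, kb, kc⟩ <;>
      nlinarith [mul_pos h1 kc, mul_pos h2 ka, mul_pos h3 kb]
    rw [if_neg hmem]
    simp only [sub_pos] at hs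
    rcases hs with ⟨ka, kb, kc⟩ | ⟨ka, kb, kc⟩
    · simp [crossing, ka.not_gt, kb.not_gt, kc.not_gt]
    · simp [crossing, ka, kb, kc]
  have key2 := crossing_add_of_split (q := q) hb' hbc hab
  have key3 := crossing_add_of_split (q := q) hc' hca hbc
  rw [openTri_rotate] at key2
  rw [openTri_rotate b c a, openTri_rotate a b c] at key3
  rcases ha.lt_or_gt with ka | ka <;> rcases hb.lt_or_gt with kb | kb <;>
    rcases hc.lt_or_gt with kc | kc
  · exact key (Or.inr ⟨sub_pos.2 ka, sub_pos.2 kb, sub_pos.2 kc⟩)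
  · rw [← key3 (Or.inr ⟨kc, ka, kb⟩)]; ring
  · rw [← key2 (Or.inr ⟨kb, kc, ka⟩)]; ring
  · exact crossing_add_of_split h hab hca (Or.inl ⟨ka, kb, kc⟩)
  · exact crossing_add_of_split h hab hca (Or.inr ⟨ka, kb, kc⟩)
  · rw [← key2 (Or.inl ⟨kb, kc, ka⟩)]; ring
  · rw [← key3 (Or.inl ⟨kc, ka, kb⟩)]; ring
  · exact key (Or.inl ⟨sub_pos.2 ka, sub_pos.2 kb, sub_pos.2 kc⟩)

open Classical in
theorem crossing_add {a b c q : EuclideanPlane} (h : orient a b c ≠ 0)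
    (hab : orient a b q ≠ 0) (hbc : orient b c q ≠ 0) (hca : orient c a q ≠ 0)
    (ha : a 0 ≠ q 0) (hb : b 0 ≠ q 0) (hc : c 0 ≠ q 0) :
    (SignType.sign (orient a b c) : ℤ) * (crossing q a b + crossing q b c + crossing q c a) =
      -(if q ∈ openTri a b c then 1 else 0) := by
  rcases h.lt_or_gt with h | h
  · have h' : 0 < orient b a c := by rw [orient_swap]; linarith
    have := crossing_add_of_pos (q := q) h' (by rw [orient_swap]; simpa) (by rw [orient_swap]; simpa)
      (by rw [orient_swap]; simpa) hb ha hc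
    rw [openTri_swap, crossing_swap q a b, crossing_swap q c a, crossing_swap q b c] at this
    rw [← this, sign_neg h]
    simp only [SignType.coe_neg, SignType.coe_one]
    ring
  · rw [sign_pos h, ← crossing_add_of_pos h hab hbc hca ha hb hc]
    simp

end EuclideanPlane

/-! ### Homology spheres of dimension two and their straight-line realizations -/

namespace SimplicialMulticomplex

open EuclideanPlane

variable {α : Type*} [DecidableEq α]

/-- `a`, `b`, `c` span a member of `T`. -/
abbrev Face (T : Finset (Finset α)) (a b c : α) : Prop := ({a, b, c} : Finset α) ∈ T

/-- A strongly connected family of triples, in which every pair that lies in some triple lies in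
exactly two of them, and whose first cohomology group over `ℤ/2` vanishes. -/
structure IsSphere (T : Finset (Finset α)) : Prop where
  card_eq : ∀ S ∈ T, S.card = 3
  exists_ne : ∀ a b c, Face T a b c → ∃ d, d ≠ c ∧ Face T a b d
  eq_of_ne : ∀ a b c d e, Face T a b c → Face T a b d → Face T a b e → c ≠ d → c ≠ e → d = e
  eq_of_closed : ∀ U ⊆ T, U.Nonempty →
    (∀ a b c d, Face U a b c → Face T a b d → Face U a b d) → U = T
  exists_potential : ∀ φ : α → α → ZMod 2, (∀ a b, φ a b = φ b a) →
    (∀ a b c, Face T a b c → φ a b + φ b c + φ c a = 0) →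
    ∃ ψ : α → ZMod 2, ∀ a b c, Face T a b c → φ a b = ψ a + ψ b

theorem triple_rotate (a b c : α) : ({b, c, a} : Finset α) = {a, b, c} := by
  ext; simp; tauto

theorem triple_swap (a b c : α) : ({b, a, c} : Finset α) = {a, b, c} := by
  ext; simp; tauto

theorem Face.rotate {T : Finset (Finset α)} {a b c : α} (h : Face T a b c) : Face T b c a := by
  rwa [Face, triple_rotate]

theorem Face.swap {T : Finset (Finset α)} {a b c : α} (h : Face T a b c) : Face T b a c := by
  rwa [Face, triple_swap]

theorem triple_ne {a b c : α} (h : ({a, b, c} : Finset α).card = 3) :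
    a ≠ b ∧ b ≠ c ∧ a ≠ c := by
  refine ⟨?_, ?_, ?_⟩
  · rintro rfl
    have := Finset.card_le_two (a := a) (b := c)
    simp at h; omega
  · rintro rfl
    have := Finset.card_le_two (a := a) (b := b)
    simp at h; omega
  · rintro rfl
    have := Finset.card_le_two (a := b) (b := a)
    rw [← triple_rotate] at h
    simp at h; omega

theorem triple_perm {a b c x y z : α} (h : ({a, b, c} : Finset α) = {x, y, z})
    (h3 : ({a, b, c} : Finset α).card = 3) :
    (a = x ∧ b = y ∧ c = z) ∨ (a = x ∧ b = z ∧ c = y) ∨ (a = y ∧ b = x ∧ c = z) ∨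
    (a = y ∧ b = z ∧ c = x) ∨ (a = z ∧ b = x ∧ c = y) ∨ (a = z ∧ b = y ∧ c = x) := by
  obtain ⟨h1, h2, h4⟩ := triple_ne h3
  have ha : a ∈ ({x, y, z} : Finset α) := by rw [← h]; simp
  have hb : b ∈ ({x, y, z} : Finset α) := by rw [← h]; simp
  have hc : c ∈ ({x, y, z} : Finset α) := by rw [← h]; simp
  simp only [Finset.mem_insert, Finset.mem_singleton] at ha hb hc
  grind

/-- A rotation and a transposition generate all permutations of three letters. -/
theorem apply_eq_of_triple_eq {β : Type*} (f : α → α → α → β)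
    (hr : ∀ a b c, f b c a = f a b c) (hs : ∀ a b c, f b a c = f a b c) {a b c x y z : α}
    (h : ({a, b, c} : Finset α) = {x, y, z}) (h3 : ({a, b, c} : Finset α).card = 3) :
    f a b c = f x y z := by
  rcases triple_perm h h3 with ⟨rfl, rfl, rfl⟩ | ⟨rfl, rfl, rfl⟩ | ⟨rfl, rfl, rfl⟩ |
    ⟨rfl, rfl, rfl⟩ | ⟨rfl, rfl, rfl⟩ | ⟨rfl, rfl, rfl⟩
  · rfl
  · rw [hr b a c, hs]
  · rw [hs]
  · exact hr c a b
  · exact (hr a b c).symm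
  · rw [← hr a b c, hs]

theorem IsSphere.ne {T : Finset (Finset α)} (hT : IsSphere T) {a b c : α} (h : Face T a b c) :
    a ≠ b ∧ b ≠ c ∧ a ≠ c :=
  triple_ne (hT.card_eq _ h)

theorem exists_triple {S : Finset α} (h : S.card = 3) : ∃ a b c, S = {a, b, c} := by
  obtain ⟨a, b, c, -, -, -, rfl⟩ := Finset.card_eq_three.1 h
  exact ⟨a, b, c, rfl⟩

theorem triple_of_mem {S : Finset α} (h : S.card = 3) {a b : α} (ha : a ∈ S) (hb : b ∈ S)
    (hab : a ≠ b) : ∃ c, S = {a, b, c} := by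
  have h1 : (S.erase a).card = 2 := by rw [Finset.card_erase_of_mem ha, h]
  have h2 : ((S.erase a).erase b).card = 1 := by
    rw [Finset.card_erase_of_mem (Finset.mem_erase.2 ⟨hab.symm, hb⟩), h1]
  obtain ⟨c, hc⟩ := Finset.card_eq_one.1 h2
  refine ⟨c, ?_⟩
  rw [← Finset.insert_erase ha, ← Finset.insert_erase (Finset.mem_erase.2 ⟨hab.symm, hb⟩), hc]

theorem triple_of_mem_one {S : Finset α} (h : S.card = 3) {a : α} (ha : a ∈ S) :
    ∃ b c, S = {a, b, c} := by
  obtain ⟨b, hb, hba⟩ := Finset.exists_mem_ne (by rw [h]; omega : 1 < S.card) a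
  obtain ⟨c, hc⟩ := triple_of_mem h ha hb hba.symm
  exact ⟨b, c, hc⟩

/-- The signed area of a triangle, with the sign reversed for the outer triangle `o`. -/
noncomputable def signedArea (p : α → EuclideanPlane) (o : Finset α) (a b c : α) : ℝ :=
  (if ({a, b, c} : Finset α) = o then -1 else 1) * orient (p a) (p b) (p c)

/-- The vertex positions `p` realize `T` with the outer triangle `o`: any two triangles with a
common side are on opposite sides of it, where the outer triangle is taken to be its exterior. -/
structure Realizes (T : Finset (Finset α)) (o : Finset α) (p : α → EuclideanPlane) : Prop where
  neg : ∀ a b c d, Face T a b c → Face T a b d → c ≠ d →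
    signedArea p o a b c * signedArea p o a b d < 0
  inj : ∀ S ∈ T, ∀ S' ∈ T, ∀ a ∈ S, ∀ b ∈ S', p a = p b → a = b

theorem signedArea_rotate (p : α → EuclideanPlane) (o : Finset α) (a b c : α) :
    signedArea p o b c a = signedArea p o a b c := by
  rw [signedArea, signedArea, triple_rotate, orient_rotate]

theorem signedArea_swap (p : α → EuclideanPlane) (o : Finset α) (a b c : α) :
    signedArea p o b a c = -signedArea p o a b c := by
  rw [signedArea, signedArea, triple_swap, orient_swap, mul_neg]

/-- The open triangle that realizes `S`. -/
def openFace (p : α → EuclideanPlane) (S : Finset α) : Set EuclideanPlane :=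
  {q | ∃ a b c, S = {a, b, c} ∧ q ∈ openTri (p a) (p b) (p c)}

/-- The closed triangle that realizes `S`. -/
def closedFace (p : α → EuclideanPlane) (S : Finset α) : Set EuclideanPlane :=
  {q | ∃ a b c, S = {a, b, c} ∧ q ∈ closedTri (p a) (p b) (p c)}

/-- The face that corresponds to `S`, if `o` is the outer triangle. -/
def region (p : α → EuclideanPlane) (o S : Finset α) : Set EuclideanPlane :=
  if S = o then (closedFace p S)ᶜ else openFace p S

theorem openFace_triple (p : α → EuclideanPlane) {a b c : α}
    (h : ({a, b, c} : Finset α).card = 3) :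
    openFace p {a, b, c} = openTri (p a) (p b) (p c) := by
  ext q
  constructor
  · rintro ⟨x, y, z, h1, h2⟩
    rwa [apply_eq_of_triple_eq (fun a b c => openTri (p a) (p b) (p c))
      (fun a b c => openTri_rotate _ _ _) (fun a b c => openTri_swap _ _ _) h1 h]
  · exact fun hq => ⟨a, b, c, rfl, hq⟩

theorem closedFace_triple (p : α → EuclideanPlane) {a b c : α}
    (h : ({a, b, c} : Finset α).card = 3) :
    closedFace p {a, b, c} = closedTri (p a) (p b) (p c) := by
  ext q
  constructor
  · rintro ⟨x, y, z, h1, h2⟩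
    rwa [apply_eq_of_triple_eq (fun a b c => closedTri (p a) (p b) (p c))
      (fun a b c => closedTri_rotate _ _ _) (fun a b c => closedTri_swap _ _ _) h1 h]
  · exact fun hq => ⟨a, b, c, rfl, hq⟩

/-- The ordered triples that span a member of `T`. -/
def orderedFaces (T : Finset (Finset α)) : Finset (α × α × α) :=
  ((T.biUnion id) ×ˢ (T.biUnion id) ×ˢ (T.biUnion id)).filter fun x => Face T x.1 x.2.1 x.2.2

theorem mem_orderedFaces {T : Finset (Finset α)} {x : α × α × α} :
    x ∈ orderedFaces T ↔ Face T x.1 x.2.1 x.2.2 := by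
  simp only [orderedFaces, Finset.mem_filter, Finset.mem_product, Finset.mem_biUnion, id,
    and_iff_right_iff_imp]
  exact fun h => ⟨⟨_, h, by simp⟩, ⟨_, h, by simp⟩, ⟨_, h, by simp⟩⟩

/-- Every triple has six orderings. Ordered triples make the cancellation across an edge a plain
involution, and the factor is removed at the end. -/
theorem sum_orderedFaces {T : Finset (Finset α)} (hT : ∀ S ∈ T, S.card = 3)
    (g : Finset α → ℤ) :
    ∑ x ∈ orderedFaces T, g {x.1, x.2.1, x.2.2} = 6 * ∑ S ∈ T, g S := by
  rw [← Finset.sum_fiberwise_of_maps_to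
    (g := fun x : α × α × α => ({x.1, x.2.1, x.2.2} : Finset α)) (t := T)
    (fun x hx => mem_orderedFaces.1 hx), Finset.mul_sum]
  refine Finset.sum_congr rfl fun S hS => ?_
  rw [Finset.sum_congr rfl (g := fun _ => g S) (fun x hx => by rw [(Finset.mem_filter.1 hx).2]),
    Finset.sum_const]
  have hc := hT S hS
  obtain ⟨a, b, c, rfl⟩ := exists_triple hc
  obtain ⟨h1, h2, h3⟩ := triple_ne hc
  have : (orderedFaces T).filter (fun x => ({x.1, x.2.1, x.2.2} : Finset α) = {a, b, c}) =
      {(a, b, c), (a, c, b), (b, a, c), (b, c, a), (c, a, b), (c, b, a)} := by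
    ext ⟨x, y, z⟩
    simp only [Finset.mem_filter, mem_orderedFaces, Finset.mem_insert, Finset.mem_singleton,
      Prod.mk.injEq]
    constructor
    · rintro ⟨hx, he⟩
      exact triple_perm he (by rw [he, hc])
    · intro h
      have he : ({x, y, z} : Finset α) = {a, b, c} := by
        rcases h with ⟨rfl, rfl, rfl⟩ | ⟨rfl, rfl, rfl⟩ | ⟨rfl, rfl, rfl⟩ |
          ⟨rfl, rfl, rfl⟩ | ⟨rfl, rfl, rfl⟩ | ⟨rfl, rfl, rfl⟩ <;> ext <;> simp <;> tauto
      exact ⟨by rw [Face, he]; exact hS, he⟩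
  rw [this]
  have h6 : ({(a, b, c), (a, c, b), (b, a, c), (b, c, a), (c, a, b), (c, b, a)} :
      Finset (α × α × α)).card = 6 := by
    simp [Finset.card_insert_of_notMem, h1, h2, h3, h1.symm, h2.symm, h3.symm]
  rw [h6]; simp

end SimplicialMulticomplex

/-! ### From the local sign condition to a tiling of the plane. -/

namespace SimplicialMulticomplex

open EuclideanPlane

variable {α : Type*} [DecidableEq α] {T : Finset (Finset α)} {o : Finset α}
  {p : α → EuclideanPlane}

theorem Realizes.orient_ne_zero (hT : IsSphere T) (hp : Realizes T o p) {a b c : α}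
    (h : Face T a b c) : orient (p a) (p b) (p c) ≠ 0 := by
  obtain ⟨d, hd, h'⟩ := hT.exists_ne a b c h
  have := hp.neg a b c d h h' hd.symm
  intro h0
  simp [signedArea, h0] at this

theorem sign_mul_sign_of_mul_neg {x y : ℝ} (h : x * y < 0) :
    (SignType.sign x : ℤ) + SignType.sign y = 0 := by
  rcases mul_neg_iff.1 h with ⟨h1, h2⟩ | ⟨h1, h2⟩ <;> simp [h1, h2]

/-- Replacing the third vertex by the one across the edge keeps the crossing term and reverses the
sign of the signed area, so the terms cancel in pairs. -/
theorem Realizes.sum_crossing (hT : IsSphere T) (hp : Realizes T o p) (q : EuclideanPlane) :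
    ∑ x ∈ orderedFaces T, (SignType.sign (signedArea p o x.1 x.2.1 x.2.2) : ℤ) *
      crossing q (p x.1) (p x.2.1) = 0 := by
  choose! g hg hgT using hT.exists_ne
  refine Finset.sum_involution (fun x _ => (x.1, x.2.1, g x.1 x.2.1 x.2.2)) ?_ ?_ ?_ ?_
  · rintro ⟨a, b, c⟩ hx
    have hx := mem_orderedFaces.1 hx
    rw [← add_mul, sign_mul_sign_of_mul_neg
      (hp.neg _ _ _ _ hx (hgT _ _ _ hx) (hg _ _ _ hx).symm), zero_mul]
  · rintro ⟨a, b, c⟩ hx - h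
    exact hg _ _ _ (mem_orderedFaces.1 hx) (Prod.ext_iff.1 (Prod.ext_iff.1 h).2).2
  · rintro ⟨a, b, c⟩ hx
    exact mem_orderedFaces.2 (hgT _ _ _ (mem_orderedFaces.1 hx))
  · rintro ⟨a, b, c⟩ hx
    have hx := mem_orderedFaces.1 hx
    have h1 := hgT _ _ _ hx
    have h2 := hgT _ _ _ h1
    simp only [Prod.mk.injEq, true_and]
    exact (hT.eq_of_ne _ _ _ _ _ h1 hx h2 (hg _ _ _ hx) (hg _ _ _ h1).symm).symm

/-- `q` is not on the line through a side and not vertically above or below a vertex. -/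
def IsGeneric (T : Finset (Finset α)) (p : α → EuclideanPlane) (q : EuclideanPlane) : Prop :=
  ∀ x ∈ orderedFaces T, orient (p x.1) (p x.2.1) q ≠ 0 ∧ (p x.1) 0 ≠ q 0

theorem Realizes.dense_isGeneric (hT : IsSphere T) (hp : Realizes T o p) :
    Dense {q | IsGeneric T p q} := by
  have h : {q | IsGeneric T p q} = ⋂ x ∈ orderedFaces T,
      -- The second set is the complement of the vertical line through `p x.1`, so `IsGeneric` only
      -- excludes finitely many lines.
      ({q | orient (p x.1) (p x.2.1) q ≠ 0} ∩
        {q | orient (p x.1) (p x.1 + !₂[0, 1]) q ≠ 0}) := by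
    ext q
    simp only [IsGeneric, Set.mem_ofPred_eq, Set.mem_iInter, Set.mem_inter_iff]
    refine forall₂_congr fun x _ => and_congr_right fun _ => ?_
    have : orient (p x.1) (p x.1 + !₂[0, 1]) q = (p x.1) 0 - q 0 := by simp [orient]
    rw [this, sub_ne_zero]
  rw [h]
  have hd : ∀ x ∈ orderedFaces T, Dense ({q | orient (p x.1) (p x.2.1) q ≠ 0} ∩
        {q | orient (p x.1) (p x.1 + !₂[0, 1]) q ≠ 0}) := by
    intro x hx
    refine (dense_orient_ne_zero ?_).inter_of_isOpen_left (dense_orient_ne_zero ?_)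
      (isOpen_orient_ne_zero _ _)
    · intro h0
      refine hp.orient_ne_zero hT (mem_orderedFaces.1 hx) ?_
      rw [h0]; simp [orient]
    · intro h0
      have := congrArg (fun v : EuclideanPlane => v 1) h0
      simp at this
  refine dense_biInter_of_isOpen (S := (orderedFaces T : Set (α × α × α))) (fun x _ => ?_)
    (orderedFaces T).countable_toSet hd
  exact (isOpen_orient_ne_zero _ _).inter (isOpen_orient_ne_zero _ _)

open Classical in
-- The vanishing sum runs over one side of every ordered triangle. Rotation permutes the ordered
-- triangles, so all three sides may be summed, and `crossing_add` turns them into the indicator of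
-- the triangle.
theorem Realizes.sum_openFace (hT : IsSphere T) (hp : Realizes T o p) {q : EuclideanPlane}
    (hq : IsGeneric T p q) :
    ∑ S ∈ T, (if S = o then -1 else 1) * (if q ∈ openFace p S then 1 else 0) = (0 : ℤ) := by
  set f : α × α × α → ℤ := fun x => (SignType.sign (signedArea p o x.1 x.2.1 x.2.2) : ℤ) *
    crossing q (p x.1) (p x.2.1) with hf
  set r : α × α × α → α × α × α := fun x => (x.2.1, x.2.2, x.1) with hr
  have hr3 : ∀ x, r (r (r x)) = x := fun x => rfl
  have hrm : ∀ x ∈ orderedFaces T, r x ∈ orderedFaces T := fun x hx =>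
    mem_orderedFaces.2 (mem_orderedFaces.1 hx).rotate
  have hsum : ∀ g : α × α × α → ℤ,
      ∑ x ∈ orderedFaces T, g (r x) = ∑ x ∈ orderedFaces T, g x := fun g =>
    Finset.sum_nbij' r (fun x => r (r x)) hrm (fun x hx => hrm _ (hrm x hx)) (fun x _ => hr3 x)
      (fun x _ => hr3 x) fun _ _ => rfl
  have h0 : ∑ x ∈ orderedFaces T, f x = 0 := hp.sum_crossing hT q
  have h1 : ∑ x ∈ orderedFaces T, (f x + f (r x) + f (r (r x))) = 0 := by
    rw [Finset.sum_add_distrib, Finset.sum_add_distrib, hsum (fun x => f (r x)), hsum f, h0]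
    rfl
  have h2 := sum_orderedFaces hT.card_eq
    (fun S => (if S = o then -1 else 1) * (if q ∈ openFace p S then 1 else 0))
  suffices h : ∑ x ∈ orderedFaces T, (if ({x.1, x.2.1, x.2.2} : Finset α) = o then -1 else 1) *
      (if q ∈ openFace p {x.1, x.2.1, x.2.2} then 1 else 0) =
      -∑ x ∈ orderedFaces T, (f x + f (r x) + f (r (r x))) by
    rw [h1, h2] at h
    omega
  rw [← Finset.sum_neg_distrib]
  refine Finset.sum_congr rfl ?_
  rintro ⟨a, b, c⟩ hx
  have hx' := mem_orderedFaces.1 hx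
  obtain ⟨ga, ga'⟩ := hq _ hx
  obtain ⟨gb, gb'⟩ := hq _ (hrm _ hx)
  obtain ⟨gc, gc'⟩ := hq _ (hrm _ (hrm _ hx))
  have h3 := crossing_add (hp.orient_ne_zero hT hx') ga gb gc ga' gb' gc'
  have hsg : (SignType.sign (signedArea p o a b c) : ℤ) =
      (if ({a, b, c} : Finset α) = o then -1 else 1) *
        SignType.sign (orient (p a) (p b) (p c)) := by
    unfold signedArea
    split_ifs <;> simp [Left.sign_neg]
  simp only [hf, hr, signedArea_rotate, hsg]
  rw [openFace_triple p (hT.card_eq _ hx')]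
  linear_combination (if ({a, b, c} : Finset α) = o then (-1 : ℤ) else 1) * h3

theorem isOpen_region (hT : IsSphere T) (o : Finset α) (p : α → EuclideanPlane) {S : Finset α}
    (hS : S ∈ T) : IsOpen (region p o S) := by
  have hc := hT.card_eq S hS
  obtain ⟨a, b, c, rfl⟩ := exists_triple hc
  unfold region
  rw [closedFace_triple p hc, openFace_triple p hc]
  split_ifs
  · exact (isClosed_closedTri _ _ _).isOpen_compl
  · exact isOpen_openTri _ _ _

theorem openFace_subset_closedFace (p : α → EuclideanPlane) (S : Finset α) :
    openFace p S ⊆ closedFace p S := by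
  rintro q ⟨a, b, c, h, hq⟩
  exact ⟨a, b, c, h, openTri_subset_closedTri _ _ _ hq⟩

/-- An overlap is open, so it contains a generic point. There the counting identity allows at most
one inner triangle, and none for a point outside the outer triangle. -/
theorem Realizes.disjoint_region (hT : IsSphere T) (ho : o ∈ T) (hp : Realizes T o p)
    {S S' : Finset α} (hS : S ∈ T) (hS' : S' ∈ T) (hne : S ≠ S') :
    Disjoint (region p o S) (region p o S') := by
  classical
  rw [Set.disjoint_iff_inter_eq_empty]
  by_contra hn
  obtain ⟨q, ⟨hq1, hq2⟩, hq⟩ := (hp.dense_isGeneric hT).inter_open_nonempty _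
    ((isOpen_region hT o p hS).inter (isOpen_region hT o p hS'))
    (Set.nonempty_iff_ne_empty.2 hn)
  have hsum := hp.sum_openFace hT hq
  rw [← Finset.add_sum_erase _ _ ho, if_pos rfl] at hsum
  have h1 : ∀ R ∈ T.erase o, (0 : ℤ) ≤
      -- All terms but the one of `o` are non-negative, so one or two of them bound the whole sum
      -- from below.
      (if R = o then -1 else 1) * (if q ∈ openFace p R then 1 else 0) := by
    intro R hR
    rw [if_neg (Finset.ne_of_mem_erase hR)]
    split_ifs <;> simp
  have key : ∀ R R' : Finset α, R ∈ T → R' ∈ T → R ≠ R' → R ≠ o → q ∈ region p o R →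
      q ∈ region p o R' → False := by
    intro R R' hR hR' hRR hRo hq1 hq2
    have hm : R ∈ T.erase o := Finset.mem_erase.2 ⟨hRo, hR⟩
    have hv : ∀ R'', R'' ≠ o → q ∈ region p o R'' →
        (if R'' = o then -1 else 1) * (if q ∈ openFace p R'' then 1 else 0) = (1 : ℤ) := by
      intro R'' h hq
      rw [region, if_neg h] at hq
      simp [h, hq]
    by_cases hRo' : R' = o
    · rw [region, if_pos hRo'] at hq2
      have : q ∉ openFace p o := fun h => hq2 (openFace_subset_closedFace p R' (hRo' ▸ h))
      have h2 := Finset.single_le_sum h1 hm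
      rw [hv R hRo hq1] at h2
      rw [if_neg this] at hsum
      linarith
    · have h2 := Finset.add_le_sum h1 hm (Finset.mem_erase.2 ⟨hRo', hR'⟩) hRR
      rw [hv R hRo hq1, hv R' hRo' hq2] at h2
      split_ifs at hsum <;> linarith
  by_cases hSo : S = o
  · exact key S' S hS' hS hne.symm (fun h => hne (hSo.trans h.symm)) hq2 hq1
  · exact key S S' hS hS' hne hSo hq1 hq2

theorem Realizes.closure_region (hT : IsSphere T) (hp : Realizes T o p) {S : Finset α}
    (hS : S ∈ T) : closure (region p o S) =
      if S = o then (openFace p S)ᶜ else closedFace p S := by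
  have hc := hT.card_eq S hS
  obtain ⟨a, b, c, rfl⟩ := exists_triple hc
  unfold region
  rw [closedFace_triple p hc, openFace_triple p hc]
  split_ifs
  · exact closure_compl_closedTri (hp.orient_ne_zero hT hS)
  · exact closure_openTri (hp.orient_ne_zero hT hS)

/-- The finite union of the closures is closed and, by the counting identity, contains the dense set
of generic points. -/
theorem Realizes.exists_mem_closure_region (hT : IsSphere T) (ho : o ∈ T) (hp : Realizes T o p)
    (q : EuclideanPlane) : ∃ S ∈ T, q ∈ closure (region p o S) := by
  classical
  have hcl : IsClosed (⋃ S ∈ T, closure (region p o S)) :=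
    T.finite_toSet.isClosed_biUnion fun _ _ => isClosed_closure
  have hsub : {q | IsGeneric T p q} ⊆ ⋃ S ∈ T, closure (region p o S) := by
    intro q hq
    have hsum := hp.sum_openFace hT hq
    rw [← Finset.add_sum_erase _ _ ho, if_pos rfl] at hsum
    simp only [Set.mem_iUnion]
    by_cases hqo : q ∈ openFace p o
    · rw [if_pos hqo] at hsum
      obtain ⟨S, hS, hne⟩ := Finset.exists_ne_zero_of_sum_ne_zero
        (show ∑ x ∈ T.erase o, (if x = o then -1 else 1) *
          (if q ∈ openFace p x then 1 else 0) ≠ (0 : ℤ) by omega)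
      refine ⟨S, Finset.mem_of_mem_erase hS, subset_closure ?_⟩
      rw [region, if_neg (Finset.ne_of_mem_erase hS)]
      by_contra h
      simp [h] at hne
    · refine ⟨o, ho, ?_⟩
      rwa [hp.closure_region hT ho, if_pos rfl]
  have := (hp.dense_isGeneric hT).closure_eq ▸ closure_minimal hsub hcl
  simpa using this (Set.mem_univ q)

/-- Near an interior point of a side only the line of that side matters. The reversed sign in
`signedArea` makes the same inequality describe the exterior when the triangle is `o`. -/
theorem Realizes.side_mem_closure_region (hT : IsSphere T) (hp : Realizes T o p) {a b c : α}
    (h : Face T a b c) {q : EuclideanPlane} (hq : q ∈ openSegment ℝ (p a) (p b)) :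
    ∀ᶠ q' in nhds q, 0 ≤ signedArea p o a b c * orient (p a) (p b) q' →
      q' ∈ closure (region p o {a, b, c}) := by
  have h0 := hp.orient_ne_zero hT h
  have hpos : 0 < orient (p a) (p b) (p c) * orient (p a) (p b) (p c) := mul_self_pos.2 h0
  obtain ⟨t, ht0, ht1, -, hbc⟩ := orient_of_mem_openSegment hq
  obtain ⟨hb, hc⟩ := hbc (p c)
  have hcont : ∀ x y, Continuous fun q => orient (p a) (p b) (p c) * orient x y q := fun x y =>
    continuous_const.mul (continuous_orient continuous_const continuous_const continuous_id)
  have e1 := (hcont (p b) (p c)).continuousAt.eventually (lt_mem_nhds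
    (show 0 < orient (p a) (p b) (p c) * orient (p b) (p c) q by rw [hb]; nlinarith))
  have e2 := (hcont (p c) (p a)).continuousAt.eventually (lt_mem_nhds
    (show 0 < orient (p a) (p b) (p c) * orient (p c) (p a) q by rw [hc]; nlinarith))
  filter_upwards [e1, e2] with q' h1 h2 h3
  rw [hp.closure_region hT h, closedFace_triple p (hT.card_eq _ h),
    openFace_triple p (hT.card_eq _ h)]
  unfold signedArea at h3
  split_ifs with ho
  · rw [if_pos ho] at h3
    intro h4
    have := h4.1
    linarith
  · rw [if_neg ho] at h3
    exact ⟨by linarith, h1.le, h2.le⟩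

/-- The two triangles at `a b` lie on opposite sides of it, so their closures fill a neighbourhood
of `q`. A third region with `q` in its closure would meet one of these closures, against
disjointness. -/
theorem Realizes.subset_of_mem_openSegment (hT : IsSphere T) (ho : o ∈ T) (hp : Realizes T o p)
    {a b c : α} (h : Face T a b c) {q : EuclideanPlane} (hq : q ∈ openSegment ℝ (p a) (p b))
    {S : Finset α} (hS : S ∈ T) (hqS : q ∈ closure (region p o S)) : a ∈ S ∧ b ∈ S := by
  obtain ⟨d, hdc, hd⟩ := hT.exists_ne a b c h
  have hneg := hp.neg a b c d h hd hdc.symm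
  obtain ⟨q', h3, h1, h2⟩ := ((mem_closure_iff_frequently.1 hqS).and_eventually
    ((hp.side_mem_closure_region hT h hq).and (hp.side_mem_closure_region hT hd hq))).exists
  have key : ∀ S' ∈ T, q' ∈ closure (region p o S') → S = S' := by
    intro S' hS' hq'
    by_contra hne
    have := (hp.disjoint_region hT ho hS hS' hne).closure_right (isOpen_region hT o p hS)
    exact this.le_bot ⟨h3, hq'⟩
  rcases le_total 0 (signedArea p o a b c * orient (p a) (p b) q') with h4 | h4
  · rw [key _ h (h1 h4)]; simp
  · have h5 : 0 ≤ signedArea p o a b d * orient (p a) (p b) q' := by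
      rcases mul_neg_iff.1 hneg with ⟨k, l⟩ | ⟨k, l⟩
      · exact mul_nonneg_of_nonpos_of_nonpos l.le (nonpos_of_mul_nonpos_right h4 k)
      · refine mul_nonneg l.le ?_
        by_contra! h6
        nlinarith [mul_pos_of_neg_of_neg k h6]
    rw [key _ hd (h2 h5)]; simp

theorem Realizes.segment_subset_closure_region (hT : IsSphere T) (hp : Realizes T o p)
    {a b c : α} (h : Face T a b c) :
    segment ℝ (p a) (p b) ⊆ closure (region p o {a, b, c}) := by
  intro q hq
  have hside : q ∈ closedTri (p a) (p b) (p c) \ openTri (p a) (p b) (p c) := by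
    rw [closedTri_diff_openTri (hp.orient_ne_zero hT h)]
    exact Or.inl (Or.inl hq)
  rw [hp.closure_region hT h, closedFace_triple p (hT.card_eq _ h),
    openFace_triple p (hT.card_eq _ h)]
  split_ifs
  exacts [hside.2, hside.1]

/-- An edge of a realization that meets the interior of an edge is that edge. -/
theorem Realizes.edge_eq (hT : IsSphere T) (ho : o ∈ T) (hp : Realizes T o p)
    {a b c a' b' c' : α} (h : Face T a b c) (h' : Face T a' b' c') {q : EuclideanPlane}
    (hq : q ∈ openSegment ℝ (p a) (p b)) (hq' : q ∈ segment ℝ (p a') (p b')) :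
    (a = a' ∧ b = b') ∨ (a = b' ∧ b = a') := by
  obtain ⟨d', hd', hf⟩ := hT.exists_ne a' b' c' h'
  -- Both triangles at `a' b'` have `q` in their closures, hence contain `a` and `b`; but they have
  -- only `a'` and `b'` in common.
  have h1 := hp.subset_of_mem_openSegment hT ho h hq h'
    (hp.segment_subset_closure_region hT h' hq')
  have h2 := hp.subset_of_mem_openSegment hT ho h hq hf
    (hp.segment_subset_closure_region hT hf hq')
  have h3 := hT.ne h
  have h4 := hT.ne h'
  have h5 := hT.ne hf
  simp only [Finset.mem_insert, Finset.mem_singleton] at h1 h2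
  grind

end SimplicialMulticomplex

/-! ### Straight-line embeddings and their faces -/

namespace PlaneEmbedding

variable {V : Type*} {G : SimpleGraph V}

/-- A connected set covered by disjoint open sets stays in one of them, so any partition of the
complement into non-empty connected open sets is the family of its components. -/
theorem exists_equiv_faces (D : PlaneEmbedding G) {ι : Type*} (R : ι → Set EuclideanPlane)
    (hne : ∀ i, (R i).Nonempty) (ho : ∀ i, IsOpen (R i)) (hc : ∀ i, IsPreconnected (R i))
    (hd : ∀ i j, i ≠ j → Disjoint (R i) (R j)) (hU : ⋃ i, R i = D.drawingᶜ) :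
    ∃ φ : ι ≃ D.faces, ∀ i, (φ i : Set EuclideanPlane) = R i := by
  have hsub : ∀ i, R i ⊆ D.drawingᶜ := fun i => hU ▸ Set.subset_iUnion R i
  have key : ∀ i, ∀ x ∈ R i, connectedComponentIn D.drawingᶜ x = R i := by
    intro i x hx
    refine Set.Subset.antisymm ?_ ((hc i).subset_connectedComponentIn hx (hsub i))
    refine isPreconnected_connectedComponentIn.subset_left_of_subset_union (ho i)
      (isOpen_iUnion fun j : {j // j ≠ i} => ho j)
      (Set.disjoint_iUnion_right.2 fun j => hd i j j.2.symm) (fun y hy => ?_)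
      ⟨x, mem_connectedComponentIn (hsub i hx), hx⟩
    have hy := connectedComponentIn_subset _ _ hy
    rw [← hU] at hy
    obtain ⟨j, hj⟩ := Set.mem_iUnion.1 hy
    by_cases hji : j = i
    · exact Or.inl (hji ▸ hj)
    · exact Or.inr (Set.mem_iUnion.2 ⟨⟨j, hji⟩, hj⟩)
  have hmem : ∀ i, R i ∈ D.faces := fun i => by
    obtain ⟨x, hx⟩ := hne i
    exact ⟨x, hsub i hx, (key i x hx).symm⟩
  refine ⟨Equiv.ofBijective (fun i => ⟨R i, hmem i⟩) ⟨fun i j hij => ?_, ?_⟩, fun i => rfl⟩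
  · by_contra hn
    obtain ⟨x, hx⟩ := hne i
    have hij : R i = R j := congrArg Subtype.val hij
    exact (hd i j hn).le_bot ⟨hx, hij ▸ hx⟩
  · rintro ⟨F, x, hx, rfl⟩
    rw [← hU] at hx
    obtain ⟨i, hi⟩ := Set.mem_iUnion.1 hx
    exact ⟨i, Subtype.ext (key i x hi).symm⟩

/-- The union of the straight edges with the end points of `e`. -/
def straightArc (P : V → EuclideanPlane) (e : Sym2 V) : Set EuclideanPlane :=
  {q | ∃ u v, e = s(u, v) ∧ q ∈ segment ℝ (P u) (P v)}

theorem straightArc_mk (P : V → EuclideanPlane) (u v : V) :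
    straightArc P s(u, v) = segment ℝ (P u) (P v) := by
  ext q
  constructor
  · rintro ⟨u', v', he, hq⟩
    rcases Sym2.eq_iff.1 he with ⟨rfl, rfl⟩ | ⟨rfl, rfl⟩
    · exact hq
    · rwa [segment_symm]
  · exact fun hq => ⟨u, v, rfl, hq⟩

theorem isSimpleArc_segment {a b : EuclideanPlane} (h : a ≠ b) :
    IsSimpleArc a b (segment ℝ a b) := by
  exact ⟨Path.segment a b, Path.segment_injective_of_ne h, Path.range_segment a b⟩

/-- A straight-line drawing without crossings. -/
def straight (G : SimpleGraph V) (P : V → EuclideanPlane) (hP : Function.Injective P)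
    (hv : ∀ u v w, G.Adj u v → P w ∉ openSegment ℝ (P u) (P v))
    (he : ∀ u v u' v', G.Adj u v → G.Adj u' v' → ∀ q ∈ openSegment ℝ (P u) (P v),
      q ∈ segment ℝ (P u') (P v') → s(u, v) = s(u', v')) : PlaneEmbedding G where
  point := P
  arc e := straightArc P e
  point_injective := hP
  isSimpleArc u v h := by
    rw [straightArc_mk]
    exact isSimpleArc_segment fun h' => G.ne_of_adj h (hP h')
  mem_of_point_mem_arc := by
    rintro ⟨e, h⟩ w hw
    induction e with | h u v =>
    rw [straightArc_mk, ← insert_endpoints_openSegment] at hw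
    rcases hw with hw | hw | hw
    · simp [hP hw]
    · simp [hP hw]
    · exact absurd hw (hv u v w h)
  inter_arc := by
    rintro ⟨e, h⟩ ⟨f, h'⟩ hne x ⟨hx, hx'⟩
    induction e with | h u v =>
    induction f with | h u' v' =>
    simp only [straightArc_mk] at hx hx'
    have h1 : x ∉ openSegment ℝ (P u) (P v) := fun h1 =>
      hne (Subtype.ext (he u v u' v' h h' x h1 hx'))
    have h2 : x ∉ openSegment ℝ (P u') (P v') := fun h1 =>
      hne (Subtype.ext (he u' v' u v h' h x h1 hx).symm)
    rw [← insert_endpoints_openSegment] at hx hx'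
    rcases hx with hx | hx | hx
    · rcases hx' with hx' | hx' | hx'
      · exact ⟨u, by simp, by simp [hP (hx.symm.trans hx')], hx⟩
      · exact ⟨u, by simp, by simp [hP (hx.symm.trans hx')], hx⟩
      · exact absurd hx' h2
    · rcases hx' with hx' | hx' | hx'
      · exact ⟨v, by simp, by simp [hP (hx.symm.trans hx')], hx⟩
      · exact ⟨v, by simp, by simp [hP (hx.symm.trans hx')], hx⟩
      · exact absurd hx' h2
    · exact absurd hx h1

theorem mem_arcsWithin_straight {P : V → EuclideanPlane} {hP : Function.Injective P}
    {hv : ∀ u v w, G.Adj u v → P w ∉ openSegment ℝ (P u) (P v)}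
    {he : ∀ u v u' v', G.Adj u v → G.Adj u' v' → ∀ q ∈ openSegment ℝ (P u) (P v),
      q ∈ segment ℝ (P u') (P v') → s(u, v) = s(u', v')} {W : Set V} {q : EuclideanPlane} :
    q ∈ (straight G P hP hv he).arcsWithin W ↔
      ∃ u ∈ W, ∃ v ∈ W, G.Adj u v ∧ q ∈ segment ℝ (P u) (P v) := by
  constructor
  · intro h
    obtain ⟨⟨⟨e, h⟩, hW⟩, hq⟩ := Set.mem_iUnion.1 h
    induction e with | h u v =>
    refine ⟨u, hW u (by simp), v, hW v (by simp), h, ?_⟩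
    rw [← straightArc_mk]
    exact hq
  · rintro ⟨u, hu, v, hv, hadj, hq⟩
    refine Set.mem_iUnion.2 ⟨⟨⟨s(u, v), hadj⟩, ?_⟩, ?_⟩
    · simp [hu, hv]
    · rw [← straightArc_mk] at hq
      exact hq

theorem mem_drawing_straight {P : V → EuclideanPlane} {hP : Function.Injective P}
    {hv : ∀ u v w, G.Adj u v → P w ∉ openSegment ℝ (P u) (P v)}
    {he : ∀ u v u' v', G.Adj u v → G.Adj u' v' → ∀ q ∈ openSegment ℝ (P u) (P v),
      q ∈ segment ℝ (P u') (P v') → s(u, v) = s(u', v')} (hn : ∀ u, ∃ v, G.Adj u v)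
    {q : EuclideanPlane} :
    q ∈ (straight G P hP hv he).drawing ↔
      ∃ u v, G.Adj u v ∧ q ∈ segment ℝ (P u) (P v) := by
  constructor
  · rintro (⟨u, rfl⟩ | h)
    · obtain ⟨v, huv⟩ := hn u
      exact ⟨u, v, huv, left_mem_segment ℝ _ _⟩
    · obtain ⟨⟨e, h⟩, hq⟩ := Set.mem_iUnion.1 h
      induction e with | h u v =>
      refine ⟨u, v, h, ?_⟩
      rw [← straightArc_mk]
      exact hq
  · rintro ⟨u, v, hadj, hq⟩
    refine Or.inr (Set.mem_iUnion.2 ⟨⟨s(u, v), hadj⟩, ?_⟩)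
    rw [← straightArc_mk] at hq
    exact hq

end PlaneEmbedding

/-! ### The faces of the straight-line drawing of a realization. -/

namespace SimplicialMulticomplex

open EuclideanPlane PlaneEmbedding

variable {α : Type*} [DecidableEq α] {T : Finset (Finset α)} {o : Finset α}
  {p : α → EuclideanPlane}

theorem exists_face_of_adj (hT : IsSphere T) {u v : vertices T.val} (h : (graph T.val).Adj u v) :
    ∃ c, Face T u v c := by
  obtain ⟨hne, S, hS, hu, hv⟩ := h
  obtain ⟨c, hc⟩ := triple_of_mem (hT.card_eq S hS) hu hv fun h => hne (Subtype.ext h)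
  exact ⟨c, by rw [Face, ← hc]; exact hS⟩

theorem arcsWithin_eq_sides {M : Multiset (Finset α)} {P : vertices M → EuclideanPlane}
    {hP : Function.Injective P}
    {hv : ∀ u v w, (graph M).Adj u v → P w ∉ openSegment ℝ (P u) (P v)}
    {he : ∀ u v u' v', (graph M).Adj u v → (graph M).Adj u' v' →
      ∀ q ∈ openSegment ℝ (P u) (P v), q ∈ segment ℝ (P u') (P v') → s(u, v) = s(u', v')}
    {a b c : vertices M} (h : ({(a : α), (b : α), (c : α)} : Finset α) ∈ M)
    (h3 : ({(a : α), (b : α), (c : α)} : Finset α).card = 3) :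
    (straight (graph M) P hP hv he).arcsWithin
      {v | (v : α) ∈ ({(a : α), (b : α), (c : α)} : Finset α)} = sides (P a) (P b) (P c) := by
  obtain ⟨h1, h2, h4⟩ := triple_ne h3
  ext q
  rw [mem_arcsWithin_straight]
  simp only [Set.mem_ofPred_eq, Finset.mem_insert, Finset.mem_singleton, Subtype.coe_inj]
  constructor
  · rintro ⟨u, hu, v, hv, hadj, hq⟩
    have hne := (graph M).ne_of_adj hadj
    rcases hu with rfl | rfl | rfl <;> rcases hv with rfl | rfl | rfl
    · exact absurd rfl hne
    · exact Or.inl (Or.inl hq)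
    · exact Or.inr (by rwa [segment_symm])
    · exact Or.inl (Or.inl (by rwa [segment_symm]))
    · exact absurd rfl hne
    · exact Or.inl (Or.inr hq)
    · exact Or.inr hq
    · exact Or.inl (Or.inr (by rwa [segment_symm]))
    · exact absurd rfl hne
  · have hab : (graph M).Adj a b := ⟨fun h => h1 (h ▸ rfl), _, h, by simp, by simp⟩
    have hbc : (graph M).Adj b c := ⟨fun h => h2 (h ▸ rfl), _, h, by simp, by simp⟩
    have hca : (graph M).Adj c a := ⟨fun h => h4 (h ▸ rfl), _, h, by simp, by simp⟩
    rintro ((hq | hq) | hq)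
    · exact ⟨a, by simp, b, by simp, hab, hq⟩
    · exact ⟨b, by simp, c, by simp, hbc, hq⟩
    · exact ⟨c, by simp, a, by simp, hca, hq⟩

theorem Realizes.frontier_region (hT : IsSphere T) (hp : Realizes T o p) {a b c : α}
    (h : Face T a b c) : frontier (region p o {a, b, c}) = sides (p a) (p b) (p c) := by
  unfold region
  rw [closedFace_triple p (hT.card_eq _ h), openFace_triple p (hT.card_eq _ h)]
  split_ifs
  · exact frontier_compl_closedTri (hp.orient_ne_zero hT h)
  · exact frontier_openTri (hp.orient_ne_zero hT h)

/-- A point of a side is in the closures of two regions, and an open region meets the closure of no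
other one. Conversely, every point is in some closure, hence in a region or on its frontier, which
consists of sides. -/
theorem Realizes.exists_mem_region_iff (hT : IsSphere T) (ho : o ∈ T) (hp : Realizes T o p)
    {q : EuclideanPlane} : (∃ S ∈ T, q ∈ region p o S) ↔
      ¬∃ a b c, Face T a b c ∧ q ∈ segment ℝ (p a) (p b) := by
  constructor
  · rintro ⟨S, hS, hqS⟩ ⟨a, b, c, hc, hq⟩
    have key : ∀ c, Face T a b c → S = {a, b, c} := by
      intro c hc
      by_contra hne
      exact ((hp.disjoint_region hT ho hS hc hne).closure_right
        (isOpen_region hT o p hS)).le_bot ⟨hqS, hp.segment_subset_closure_region hT hc hq⟩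
    obtain ⟨d, hd, hd'⟩ := hT.exists_ne _ _ _ hc
    have h1 := hT.ne hc
    have h2 := hT.ne hd'
    rcases triple_perm ((key c hc).symm.trans (key d hd')) (hT.card_eq _ hc) with h | h | h | h |
      h | h <;> grind
  · intro hq
    obtain ⟨S, hS, hqS⟩ := hp.exists_mem_closure_region hT ho q
    obtain ⟨a, b, c, rfl⟩ := exists_triple (hT.card_eq S hS)
    have hS : Face T a b c := hS
    rw [closure_eq_self_union_frontier, hp.frontier_region hT hS] at hqS
    rcases hqS with h | (h | h) | h
    · exact ⟨_, hS, h⟩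
    · exact absurd ⟨_, _, _, hS, h⟩ hq
    · exact absurd ⟨_, _, _, hS.rotate, h⟩ hq
    · exact absurd ⟨_, _, _, hS.rotate.rotate, h⟩ hq

theorem Realizes.region_nonempty (hT : IsSphere T) (hp : Realizes T o p) {S : Finset α}
    (hS : S ∈ T) : (region p o S).Nonempty ∧ IsPreconnected (region p o S) := by
  have hc := hT.card_eq S hS
  obtain ⟨a, b, c, rfl⟩ := exists_triple hc
  have h0 := hp.orient_ne_zero hT hS
  unfold region
  rw [closedFace_triple p hc, openFace_triple p hc]
  split_ifs
  · exact ⟨compl_closedTri_nonempty h0, isPreconnected_compl_closedTri h0⟩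
  · exact ⟨openTri_nonempty h0, isPreconnected_openTri _ _ _⟩

theorem toType_ext {i j : T.val.ToType} (h : i.1 = j.1) : i = j := by
  obtain ⟨S, i⟩ := i
  obtain ⟨S', j⟩ := j
  obtain rfl : S = S' := h
  have := Multiset.nodup_iff_count_le_one.1 T.nodup S
  obtain rfl : i = j := Fin.ext (by omega)
  rfl

theorem exists_adj {M : Multiset (Finset α)} (hM : ∀ S ∈ M, S.card = 3) (u : vertices M) :
    ∃ v, (graph M).Adj u v := by
  obtain ⟨u, S, hS, hu⟩ := u
  obtain ⟨b, c, rfl⟩ := triple_of_mem_one (hM S hS) hu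
  exact ⟨⟨b, _, hS, by simp⟩, fun h => (triple_ne (hM _ hS)).1 (congrArg Subtype.val h), _, hS,
    by simp, by simp⟩

theorem Realizes.injective (hp : Realizes T o p) :
    Function.Injective fun v : vertices T.val => p v := by
  rintro ⟨a, S, hS, ha⟩ ⟨b, S', hS', hb⟩ hab
  exact Subtype.ext (hp.inj S hS S' hS' a ha b hb hab)

theorem Realizes.sym2_eq (hT : IsSphere T) (ho : o ∈ T) (hp : Realizes T o p)
    (u v u' v' : vertices T.val) (h : (graph T.val).Adj u v) (h' : (graph T.val).Adj u' v')
    (q : EuclideanPlane) (hq : q ∈ openSegment ℝ (p u) (p v))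
    (hq' : q ∈ segment ℝ (p u') (p v')) : s(u, v) = s(u', v') := by
  obtain ⟨c, hc⟩ := exists_face_of_adj hT h
  obtain ⟨c', hc'⟩ := exists_face_of_adj hT h'
  rw [Sym2.eq_iff]
  simp only [Subtype.ext_iff]
  exact hp.edge_eq hT ho hc hc' hq hq'

/-- Some edge ends at `w`, and it meets the interior of `u v`, so it is `u v` itself. Then `w` would
be an end point of a non-degenerate segment and also interior to it. -/
theorem Realizes.notMem_openSegment (hT : IsSphere T) (ho : o ∈ T) (hp : Realizes T o p)
    (u v w : vertices T.val) (h : (graph T.val).Adj u v) :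
    p w ∉ openSegment ℝ (p u) (p v) := by
  intro hw
  obtain ⟨x, hx⟩ := exists_adj hT.card_eq w
  have h1 := hp.sym2_eq hT ho u v w x h hx _ hw (left_mem_segment ℝ _ _)
  obtain ⟨c, hc⟩ := exists_face_of_adj hT h
  have h0 := hp.orient_ne_zero hT hc
  obtain ⟨t, ht0, ht1, -, h2⟩ := orient_of_mem_openSegment hw
  have h2 := h2 (p c)
  rcases Sym2.eq_iff.1 h1 with ⟨rfl, rfl⟩ | ⟨rfl, rfl⟩
  · rw [orient_self_right] at h2
    exact mul_ne_zero ht0.ne' h0 h2.2.symm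
  · rw [orient_self_left] at h2
    exact mul_ne_zero (sub_pos.2 ht1).ne' h0 h2.1.symm

/-- The straight-line embedding given by a realization. -/
def Realizes.embedding (hT : IsSphere T) (ho : o ∈ T) (hp : Realizes T o p) :
    PlaneEmbedding (graph T.val) :=
  straight (graph T.val) (fun v => p v) hp.injective (hp.notMem_openSegment hT ho)
    (hp.sym2_eq hT ho)

theorem Realizes.iUnion_region (hT : IsSphere T) (ho : o ∈ T) (hp : Realizes T o p) :
    ⋃ i : T.val.ToType, region p o i.1 = (hp.embedding hT ho).drawingᶜ := by
  ext q
  rw [Set.mem_compl_iff, Realizes.embedding, mem_drawing_straight (exists_adj hT.card_eq),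
    Set.mem_iUnion]
  have h1 : (∃ i : T.val.ToType, q ∈ region p o i.1) ↔ ∃ S ∈ T, q ∈ region p o S :=
    ⟨fun ⟨i, hi⟩ => ⟨i.1, Multiset.coe_mem, hi⟩,
      fun ⟨S, hS, h⟩ => ⟨Multiset.mkToType _ S ⟨0, Multiset.count_pos.2 hS⟩, h⟩⟩
  rw [h1, hp.exists_mem_region_iff hT ho]
  refine not_congr ⟨?_, ?_⟩
  · rintro ⟨a, b, c, h, hq⟩
    exact ⟨⟨a, _, h, by simp⟩, ⟨b, _, h, by simp⟩,
      ⟨fun h' => (hT.ne h).1 (congrArg Subtype.val h'), _, h, by simp, by simp⟩, hq⟩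
  · rintro ⟨u, v, hadj, hq⟩
    obtain ⟨c, hc⟩ := exists_face_of_adj hT hadj
    exact ⟨u, v, c, hc, hq⟩

theorem Realizes.isFaceFamily (hT : IsSphere T) (ho : o ∈ T) (hp : Realizes T o p) :
    IsFaceFamily T.val (hp.embedding hT ho) := by
  have hmem : ∀ i : T.val.ToType, i.1 ∈ T := fun i => Multiset.coe_mem
  obtain ⟨φ, hφ⟩ := (hp.embedding hT ho).exists_equiv_faces
    (fun i : T.val.ToType => region p o i.1)
    (fun i => (hp.region_nonempty hT (hmem i)).1) (fun i => isOpen_region hT o p (hmem i))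
    (fun i => (hp.region_nonempty hT (hmem i)).2)
    (fun i j hij => hp.disjoint_region hT ho (hmem i) (hmem j) fun h => hij (toType_ext h))
    (hp.iUnion_region hT ho)
  refine ⟨φ, fun i => ?_⟩
  rw [hφ]
  have hi := hmem i
  generalize i.1 = S at hi ⊢
  have hc := hT.card_eq _ hi
  obtain ⟨a, b, c, rfl⟩ := exists_triple hc
  rw [hp.frontier_region hT hi]
  exact (arcsWithin_eq_sides (P := fun v => p v) (a := ⟨a, _, hi, by simp⟩)
    (b := ⟨b, _, hi, by simp⟩) (c := ⟨c, _, hi, by simp⟩) hi hc).symm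

theorem IsFaceFamily.isPlaneTriangulation {M : Multiset (Finset α)} (hM : IsMulticomplex 2 M)
    {D : PlaneEmbedding (graph M)} (h : IsFaceFamily M D) : IsPlaneTriangulation (graph M) := by
  obtain ⟨φ, hφ⟩ := h
  refine ⟨?_, D, fun F hF => ?_⟩
  · have : vertices M = ((M.toFinset.biUnion id : Finset α) : Set α) := by
      ext v
      simp [vertices]
    rw [this]
    exact Finset.finite_toSet _
  · have hi : (φ.symm ⟨F, hF⟩).1 ∈ M := Multiset.coe_mem
    have hfr := hφ (φ.symm ⟨F, hF⟩)
    rw [φ.apply_symm_apply] at hfr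
    have hc := hM _ hi
    obtain ⟨a, b, c, habc⟩ := exists_triple hc
    rw [habc] at hi hfr hc
    obtain ⟨h1, h2, h3⟩ := triple_ne hc
    refine ⟨⟨a, _, hi, by simp⟩, ⟨b, _, hi, by simp⟩, ⟨c, _, hi, by simp⟩,
      ⟨fun h => h1 (congrArg Subtype.val h), _, hi, by simp, by simp⟩,
      ⟨fun h => h2 (congrArg Subtype.val h), _, hi, by simp, by simp⟩,
      ⟨fun h => h3 (congrArg Subtype.val h), _, hi, by simp, by simp⟩, hfr.trans ?_⟩
    congr 1
    ext v
    simp [Subtype.ext_iff]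

end SimplicialMulticomplex

/-! ### Separating triangles -/

namespace SimplicialMulticomplex

variable {α : Type*} [DecidableEq α] {T A : Finset (Finset α)} {K : Finset α}

theorem zmod_two_eq_of_add {x y : ZMod 2} (h : x + y = 0) : x = y :=
  CharTwo.add_eq_zero.1 h

/-- Vanishing cohomology excludes pinched vertices. The indicator of the edges from `w` to a union
`W` of components of its link is a cocycle, hence has a potential. The potential is constant on the
vertices other than `w`, so the indicator is constant on the whole link. -/
theorem IsSphere.link_connected (hT : IsSphere T) {w : α} (W : α → α → Prop)
    (hs : ∀ c d, W c d → W d c) (hW : ∀ c d, W c d → Face T w c d)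
    (hcl : ∀ c d e, W c d → Face T w c e → W c e) {c₀ d₀ : α} (h₀ : W c₀ d₀) {c d : α}
    (h : Face T w c d) : W c d := by
  classical
  obtain ⟨ψ, hψ⟩ := hT.exists_potential
    (fun a b => if (a = w ∧ ∃ d, W b d) ∨ (b = w ∧ ∃ d, W a d) then 1 else 0)
    (fun a b => by simp only [or_comm]) (by
      have key : ∀ b c, Face T w b c → ((∃ d, W b d) ↔ ∃ d, W c d) := fun b c h =>
        ⟨fun ⟨d, hd⟩ => ⟨b, hs _ _ (hcl _ _ _ hd h)⟩, fun ⟨d, hd⟩ => ⟨c, hs _ _ (hcl _ _ _ hd h.swap.rotate)⟩⟩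
      intro a b c habc
      obtain ⟨h1, h2, h3⟩ := hT.ne habc
      by_cases ha : a = w
      · subst ha
        have := key b c habc
        simp only [h1.symm, h3.symm, false_and, or_false, true_and, this, false_or, if_false]
        split_ifs <;> decide
      · by_cases hb : b = w
        · subst hb
          have := key c a habc.rotate
          simp only [h1, h2.symm, false_and, or_false, true_and, this, false_or, if_false]
          split_ifs <;> decide
        · by_cases hc : c = w
          · subst hc
            have := key a b habc.rotate.rotate
            simp only [h2, h3, false_and, or_false, true_and, this, false_or, if_false]
            split_ifs <;> decide
          · simp [ha, hb, hc])
  have hoff : ∀ a b c, Face T a b c → a ≠ w → b ≠ w → ψ a = ψ b := by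
    intro a b c h ha hb
    have := hψ a b c h
    simp only [ha, hb, false_and, or_false, if_false] at this
    exact zmod_two_eq_of_add this.symm
  have hon : ∀ b c, Face T w b c → (if ∃ d, W b d then (1 : ZMod 2) else 0) = ψ w + ψ b := by
    intro b c h
    have := hψ w b c h
    simpa [(hT.ne h).1.symm] using this
  -- Each edge lies in triangles with at least one vertex other than `w`, so equality of `ψ` away
  -- from `w` passes across edges and strong connectivity makes it global.
  have hU := hT.eq_of_closed (T.filter fun S => ∀ a ∈ S, a ≠ w → ψ a = ψ c₀)
    (Finset.filter_subset _ _) ⟨{w, c₀, d₀}, by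
      have hf := hW _ _ h₀
      refine Finset.mem_filter.2 ⟨hf, fun a ha haw => ?_⟩
      simp only [Finset.mem_insert, Finset.mem_singleton] at ha
      rcases ha with rfl | rfl | rfl
      · exact absurd rfl haw
      · rfl
      · exact (hoff _ _ _ hf.rotate (hT.ne hf).1.symm haw).symm⟩ (by
      intro a b c d h1 h2
      obtain ⟨h1, h3⟩ := Finset.mem_filter.1 h1
      refine Finset.mem_filter.2 ⟨h2, fun y hy hyw => ?_⟩
      simp only [Finset.mem_insert, Finset.mem_singleton] at hy
      rcases hy with rfl | rfl | rfl
      · exact h3 _ (by simp) hyw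
      · exact h3 _ (by simp) hyw
      · by_cases haw : a = w
        · have hbw : b ≠ w := fun h => (hT.ne h2).1 (haw.trans h.symm)
          rw [← hoff _ _ _ h2.rotate hbw hyw]
          exact h3 _ (by simp) hbw
        · rw [hoff _ _ _ h2.rotate.rotate hyw haw]
          exact h3 _ (by simp) haw)
  have hc : ψ c = ψ c₀ := by
    have hm : ({w, c, d} : Finset α) ∈ T := h
    rw [← hU] at hm
    exact (Finset.mem_filter.1 hm).2 c (by simp) (hT.ne h).1.symm
  have h1 := hon c d h
  rw [hc, ← hon c₀ d₀ (hW _ _ h₀), if_pos (show ∃ d, W c₀ d from ⟨d₀, h₀⟩)] at h1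
  obtain ⟨e, he⟩ : ∃ e, W c e := by
    by_contra hn
    simp [hn] at h1
  exact hcl c e d he h

/-- The boundary of a triangle as a chain. -/
noncomputable def chainBoundary (S : Finset α) : Finset α →₀ ZMod 2 :=
  ∑ e ∈ S.powersetCard 2, Finsupp.single e 1

theorem chainBoundary_apply (S e : Finset α) :
    chainBoundary S e = if e ⊆ S ∧ e.card = 2 then 1 else 0 := by
  rw [chainBoundary, Finsupp.finsetSum_apply]
  simp [Finsupp.single_apply, Finset.mem_powersetCard]

theorem chainBoundary_triple {a b c : α} (h : ({a, b, c} : Finset α).card = 3) :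
    chainBoundary {a, b, c} = Finsupp.single {a, b} (1 : ZMod 2) + Finsupp.single {b, c} 1 +
      Finsupp.single {c, a} 1 := by
  obtain ⟨h1, h2, h3⟩ := triple_ne h
  have hp : ({a, b, c} : Finset α).powersetCard 2 = {{a, b}, {b, c}, {c, a}} := by
    ext e
    simp only [Finset.mem_powersetCard, Finset.mem_insert, Finset.mem_singleton]
    constructor
    · rintro ⟨hs, hc⟩
      obtain ⟨x, y, hxy, rfl⟩ := Finset.card_eq_two.1 hc
      have hx := hs (show x ∈ _ by simp)
      have hy := hs (show y ∈ _ by simp)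
      simp only [Finset.mem_insert, Finset.mem_singleton] at hx hy
      rcases hx with rfl | rfl | rfl <;> rcases hy with rfl | rfl | rfl <;>
        simp_all [Finset.pair_comm]
    · rintro (rfl | rfl | rfl)
      · exact ⟨by intro; simp; tauto, Finset.card_pair h1⟩
      · exact ⟨by intro; simp; tauto, Finset.card_pair h2⟩
      · exact ⟨by intro; simp; tauto, Finset.card_pair h3.symm⟩
  have e1 : ({a, b} : Finset α) ≠ {b, c} := fun h => by
    have : a ∈ ({b, c} : Finset α) := h ▸ by simp
    simp [h1, h3] at this
  have e2 : ({a, b} : Finset α) ≠ {c, a} := fun h => by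
    have : b ∈ ({c, a} : Finset α) := h ▸ by simp
    simp [h1.symm, h2] at this
  have e3 : ({b, c} : Finset α) ≠ {c, a} := fun h => by
    have : b ∈ ({c, a} : Finset α) := h ▸ by simp
    simp [h1.symm, h2] at this
  rw [chainBoundary, hp, Finset.sum_insert (by simp [e1, e2]), Finset.sum_pair e3, add_assoc]

/-- By duality, a closed triangle of edges bounds a chain of members of `T`: a functional that kills
all boundaries of members is a cocycle, thus has a potential, and the potential differences cancel
around `u v x`. -/
theorem IsSphere.exists_chain (hT : IsSphere T) {u v x : α}
    (hK : ({u, v, x} : Finset α).card = 3) {a₁ a₂ a₃ : α} (h1 : Face T u v a₁)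
    (h2 : Face T v x a₂) (h3 : Face T x u a₃) :
    ∃ k : Finset α → ZMod 2, ∀ a b c d, Face T a b c → Face T a b d → c ≠ d →
      k {a, b, c} + k {a, b, d} = if ({a, b} : Finset α) ⊆ {u, v, x} then 1 else 0 := by
  have hspan : chainBoundary {u, v, x} ∈
      Submodule.span (ZMod 2) (chainBoundary '' (T : Set (Finset α))) := by
    by_contra hn
    obtain ⟨f, hf, hle⟩ := Submodule.exists_le_ker_of_notMem hn
    obtain ⟨ψ, hψ⟩ := hT.exists_potential (fun a b => f (Finsupp.single {a, b} 1))
      (fun a b => by rw [Finset.pair_comm]) (fun a b c h => by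
        rw [← map_add, ← map_add, ← chainBoundary_triple (hT.card_eq _ h)]
        exact hle (Submodule.subset_span ⟨_, h, rfl⟩))
    apply hf
    rw [chainBoundary_triple hK, map_add, map_add, hψ _ _ _ h1, hψ _ _ _ h2, hψ _ _ _ h3]
    have : ∀ p q r : ZMod 2, p + q + (q + r) + (r + p) = 0 := by decide
    exact this _ _ _
  obtain ⟨k, hk⟩ := Submodule.mem_span_image_finset_iff_exists_fun' (ZMod 2) |>.1 hspan
  refine ⟨k, fun a b c d hc hd hcd => ?_⟩
  obtain ⟨hab, hbc, hac⟩ := hT.ne hc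
  have := congrArg (fun g => g ({a, b} : Finset α)) hk
  simp only [Finsupp.finsetSum_apply, Finsupp.smul_apply, chainBoundary_apply,
    Finset.card_pair hab, and_true, smul_eq_mul, mul_ite, mul_one, mul_zero] at this
  rw [← this, ← Finset.sum_filter]
  have hfil : T.filter (fun S => ({a, b} : Finset α) ⊆ S) = {{a, b, c}, {a, b, d}} := by
    ext S
    simp only [Finset.mem_filter, Finset.mem_insert, Finset.mem_singleton]
    constructor
    · rintro ⟨hS, hsub⟩
      obtain ⟨e, rfl⟩ := triple_of_mem (hT.card_eq S hS) (hsub (by simp)) (hsub (by simp)) hab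
      by_cases hce : c = e
      · exact Or.inl (hce ▸ rfl)
      · exact Or.inr (hT.eq_of_ne a b c d e hc hd hS hcd hce ▸ rfl)
    · rintro (rfl | rfl)
      · exact ⟨hc, by intro; simp; tauto⟩
      · exact ⟨hd, by intro; simp; tauto⟩
  rw [hfil, Finset.sum_pair]
  intro h
  have hm : c ∈ ({a, b, d} : Finset α) := h ▸ by simp
  simp [hac.symm, hbc.symm, hcd] at hm

/-- `A` is one of the two sides of the triangle `K`, whose sides are edges of `T` but which is not
a member of `T`. -/
structure IsSeparation (T A : Finset (Finset α)) (K : Finset α) : Prop where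
  subset : A ⊆ T
  card_eq : K.card = 3
  notMem : K ∉ T
  edge : ∀ a ∈ K, ∀ b ∈ K, a ≠ b → ∃ c, Face T a b c
  cross : ∀ a ∈ K, ∀ b ∈ K, ∀ c d, Face T a b c → Face T a b d → c ≠ d →
    (Face A a b c ↔ ¬Face A a b d)
  same : ∀ a b c d, Face T a b c → Face T a b d → ¬(a ∈ K ∧ b ∈ K) → Face A a b c → Face A a b d

/-- One side is the support of the chain bounded by the triangle. Crossing an edge changes
membership exactly at the three sides of the triangle. -/
theorem IsSphere.exists_isSeparation (hT : IsSphere T) {u v x : α}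
    (hK : ({u, v, x} : Finset α).card = 3) {a₁ a₂ a₃ : α} (h1 : Face T u v a₁)
    (h2 : Face T v x a₂) (h3 : Face T x u a₃) (hn : ¬Face T u v x) :
    ∃ A, IsSeparation T A {u, v, x} := by
  obtain ⟨k, hk⟩ := hT.exists_chain hK h1 h2 h3
  have htwo : ∀ x y : ZMod 2, x + y = 1 → (x = 1 ↔ y ≠ 1) := by decide
  refine ⟨T.filter fun S => k S = 1, Finset.filter_subset _ _, hK, hn, ?_, ?_, ?_⟩
  · have r : ∀ {a b c}, Face T a b c → ∃ c, Face T b a c := fun h => ⟨_, h.swap⟩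
    intro a ha b hb hab
    simp only [Finset.mem_insert, Finset.mem_singleton] at ha hb
    rcases ha with rfl | rfl | rfl <;> rcases hb with rfl | rfl | rfl
    exacts [absurd rfl hab, ⟨_, h1⟩, r h3, r h1, absurd rfl hab, ⟨_, h2⟩, ⟨_, h3⟩, r h2,
      absurd rfl hab]
  · intro a ha b hb c d hc hd hcd
    have := hk a b c d hc hd hcd
    rw [if_pos (by intro y hy; simp only [Finset.mem_insert, Finset.mem_singleton] at hy;
                   rcases hy with rfl | rfl <;> assumption)] at this
    simp only [Face, Finset.mem_filter] at *
    simp only [hc, hd, true_and]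
    exact htwo _ _ this
  · intro a b c d hc hd hab h
    by_cases hcd : c = d
    · exact hcd ▸ h
    have := hk a b c d hc hd hcd
    rw [if_neg (fun hs => hab ⟨hs (by simp), hs (by simp)⟩)] at this
    refine Finset.mem_filter.2 ⟨hd, ?_⟩
    rw [← zmod_two_eq_of_add this]
    exact (Finset.mem_filter.1 h).2

theorem IsSeparation.compl (h : IsSeparation T A K) : IsSeparation T (T \ A) K where
  subset := Finset.sdiff_subset
  card_eq := h.card_eq
  notMem := h.notMem
  edge := h.edge
  cross a ha b hb c d hc hd hcd := by
    have := h.cross a ha b hb c d hc hd hcd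
    simp only [Face, Finset.mem_sdiff] at *
    tauto
  same a b c d hc hd hab hm := by
    have := h.same a b d c hd hc hab
    simp only [Face, Finset.mem_sdiff] at *
    tauto

theorem face_insert {a b c : α} :
    Face (insert K A) a b c ↔ ({a, b, c} : Finset α) = K ∨ Face A a b c :=
  Finset.mem_insert

theorem IsSeparation.exists_face (hT : IsSphere T) (h : IsSeparation T A K) {a b : α}
    (ha : a ∈ K) (hb : b ∈ K) (hab : a ≠ b) : ∃ c, Face A a b c := by
  obtain ⟨c, hc⟩ := h.edge a ha b hb hab
  obtain ⟨d, hd, hd'⟩ := hT.exists_ne a b c hc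
  have := h.cross a ha b hb c d hc hd' hd.symm
  by_cases hA : Face A a b c
  · exact ⟨c, hA⟩
  · exact ⟨d, by tauto⟩

/-- At a vertex outside `K` no edge separates the two sides, so connectedness of its link puts its
whole star on one side. -/
theorem IsSeparation.mem_of_mem (hT : IsSphere T) (h : IsSeparation T A K) {S S' : Finset α}
    (hS : S ∈ A) (hS' : S' ∈ T) (hS'' : S' ∉ A) {w : α} (hw : w ∈ S) (hw' : w ∈ S') : w ∈ K := by
  by_contra hK
  obtain ⟨b, c, rfl⟩ := triple_of_mem_one (hT.card_eq _ (h.subset hS)) hw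
  obtain ⟨b', c', rfl⟩ := triple_of_mem_one (hT.card_eq _ hS') hw'
  refine hS'' (hT.link_connected (w := w) (fun b c => Face A w b c) (fun c d h => ?_)
    (fun c d h' => h.subset h') (fun c d e h1 h2 => ?_) hS hS')
  · exact Face.rotate (Face.swap h)
  · exact h.same _ _ _ _ (h.subset h1) h2 (fun h => hK h.1) h1

/-- The other side has triangles at two sides of `K`. They are different, as a common one would be
`K`, so at least two members are replaced by one. -/
theorem IsSeparation.card_lt (hT : IsSphere T) (h : IsSeparation T A K) :
    (insert K A).card < T.card := by
  have hn : K ∉ A := fun hK => h.notMem (h.subset hK)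
  have hlt : 1 < (T \ A).card := by
    obtain ⟨u, v, x, rfl⟩ := exists_triple h.card_eq
    obtain ⟨h1, h2, h3⟩ := triple_ne h.card_eq
    obtain ⟨b, hb⟩ := h.compl.exists_face hT (a := u) (b := v) (by simp) (by simp) h1
    obtain ⟨c, hc⟩ := h.compl.exists_face hT (a := v) (b := x) (by simp) (by simp) h2
    refine Finset.one_lt_card.2 ⟨_, hb, _, hc, fun he => ?_⟩
    have hx : x ∈ ({u, v, b} : Finset α) := he ▸ by simp
    simp only [Finset.mem_insert, Finset.mem_singleton, h3.symm, h2.symm, false_or] at hx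
    exact h.notMem (hx ▸ h.compl.subset hb)
  rw [Finset.card_insert_of_notMem hn]
  have := Finset.card_sdiff_add_card_eq_card h.subset
  omega

/-- At the sides of `K` the new triangle takes the place of the triangle on the removed side. A
closed family without `K` would be closed in `T`, and a cocycle extends to `T` because it has a
potential on `K`. -/
theorem IsSeparation.isSphere (hT : IsSphere T) (h : IsSeparation T A K) :
    IsSphere (insert K A) := by
  have hAT : ∀ {a b c}, Face A a b c → Face T a b c := fun hf => h.subset hf
  have hcard : ∀ S ∈ insert K A, S.card = 3 := by
    intro S hS
    rcases Finset.mem_insert.1 hS with rfl | hS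
    exacts [h.card_eq, hT.card_eq _ (h.subset hS)]
  have hAK : ∀ {a b c}, Face A a b c → ({a, b, c} : Finset α) ≠ K := fun hf he =>
    h.notMem (he ▸ h.subset hf)
  have hclosed : ∀ U ⊆ insert K A, U.Nonempty → K ∉ U →
      ¬(∀ a b c d, Face U a b c → Face (insert K A) a b d → Face U a b d) := by
    intro U hU hne hKU hcl
    have hUA : U ⊆ A := fun S hS => (Finset.mem_insert.1 (hU hS)).resolve_left
      fun he => hKU (he ▸ hS)
    have hUT := hT.eq_of_closed U (hUA.trans h.subset) hne (by
      intro a b c d h1 h2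
      have h1A : Face A a b c := hUA h1
      by_cases hab : a ∈ K ∧ b ∈ K
      · obtain ⟨y, rfl⟩ := triple_of_mem h.card_eq hab.1 hab.2 (hT.ne h2).1
        exact absurd (hcl a b c y h1 (Finset.mem_insert_self _ _)) hKU
      · exact hcl a b c d h1 (Finset.mem_insert_of_mem (h.same a b c d (hAT h1A) h2 hab h1A)))
    obtain ⟨u, v, x, hK⟩ := exists_triple h.card_eq
    have hne := triple_ne (hK ▸ h.card_eq)
    obtain ⟨c, hc⟩ := h.compl.exists_face hT (a := u) (b := v) (by simp [hK]) (by simp [hK]) hne.1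
    have hcT := h.compl.subset hc
    rw [← hUT] at hcT
    exact (Finset.mem_sdiff.1 hc).2 (hUA hcT)
  refine ⟨hcard, ?_, ?_, ?_, ?_⟩
  · intro a b c hf
    have hne := triple_ne (hcard _ hf)
    rcases face_insert.1 hf with hf | hf
    · obtain ⟨d, hd⟩ := h.exists_face hT (a := a) (b := b) (by simp [← hf]) (by simp [← hf]) hne.1
      exact ⟨d, fun hdc => hAK hd (hdc ▸ hf), face_insert.2 (Or.inr hd)⟩
    · by_cases hab : a ∈ K ∧ b ∈ K
      · obtain ⟨y, hy⟩ := triple_of_mem h.card_eq hab.1 hab.2 hne.1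
        exact ⟨y, fun hyc => hAK hf (hyc ▸ hy.symm), face_insert.2 (Or.inl hy.symm)⟩
      · obtain ⟨d, hd, hd'⟩ := hT.exists_ne a b c (hAT hf)
        exact ⟨d, hd, face_insert.2 (Or.inr (h.same a b c d (hAT hf) hd' hab hf))⟩
  · intro a b c d e hc hd he hcd hce
    by_cases hab : a ∈ K ∧ b ∈ K
    · have hP : ∀ z z', ({a, b, z} : Finset α) = K → ({a, b, z'} : Finset α) = K → z = z' := by
        intro z z' hz hz'
        have hzn := triple_ne (hz ▸ h.card_eq)
        have hm : z ∈ ({a, b, z'} : Finset α) := by rw [hz', ← hz]; simp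
        simpa [hzn.2.1.symm, hzn.2.2.symm] using hm
      have hQ : ∀ z z', Face A a b z → Face A a b z' → z = z' := by
        intro z z' hz hz'
        by_contra hzz
        exact (h.cross a hab.1 b hab.2 z z' (hAT hz) (hAT hz') hzz).1 hz hz'
      rcases face_insert.1 hc with hc | hc <;> rcases face_insert.1 hd with hd | hd <;>
        rcases face_insert.1 he with he | he
      exacts [hP _ _ hd he, absurd (hP _ _ hc hd) hcd, absurd (hP _ _ hc he) hce, hQ _ _ hd he,
        hP _ _ hd he, absurd (hQ _ _ hc he) hce, absurd (hQ _ _ hc hd) hcd, hQ _ _ hd he]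
    · have hA : ∀ z, Face (insert K A) a b z → Face T a b z := fun z hz =>
        (face_insert.1 hz).elim (fun he => absurd ⟨he ▸ by simp, he ▸ by simp⟩ hab) hAT
      exact hT.eq_of_ne a b c d e (hA _ hc) (hA _ hd) (hA _ he) hcd hce
  · intro U hU hne hcl
    by_cases hKU : K ∈ U
    · by_contra hUne
      -- Being closed is symmetric, so the complement of a closed family is closed and, as it lacks
      -- `K`, must be empty.
      have hsd : (insert K A \ U).Nonempty := by
        rw [Finset.sdiff_nonempty]
        exact fun hs => hUne (hU.antisymm hs)
      refine hclosed _ Finset.sdiff_subset hsd (by simp [hKU]) ?_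
      intro a b c d h1 h2
      have h1 := Finset.mem_sdiff.1 h1
      exact Finset.mem_sdiff.2 ⟨h2, fun hd => h1.2 (hcl a b d c hd h1.1)⟩
    · exact absurd hcl (hclosed U hU hne hKU)
  · intro φ hs hφ
    classical
    obtain ⟨u, v, x, hK⟩ := exists_triple h.card_eq
    obtain ⟨huv, hvx, hux⟩ := triple_ne (hK ▸ h.card_eq)
    let ψ₀ : α → ZMod 2 := fun a => if a = v then φ u v else if a = x then φ u x else 0
    have hK0 : φ u v + φ v x + φ x u = 0 := hφ u v x (face_insert.2 (Or.inl hK.symm))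
    have hψ₀ : ∀ a ∈ K, ∀ b ∈ K, a ≠ b → φ a b = ψ₀ a + ψ₀ b := by
      have e3 : φ v x = φ u v + φ u x := by
        rw [hs x u] at hK0
        generalize φ u v = p at hK0 ⊢
        generalize φ v x = q at hK0 ⊢
        generalize φ u x = r at hK0 ⊢
        revert p q r; decide
      have eu : ψ₀ u = 0 := by simp [ψ₀, huv, hux]
      have ev : ψ₀ v = φ u v := by simp [ψ₀]
      have ex : ψ₀ x = φ u x := by simp [ψ₀, hvx.symm]
      intro a ha b hb hab
      simp only [hK, Finset.mem_insert, Finset.mem_singleton] at ha hb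
      rcases ha with rfl | rfl | rfl <;> rcases hb with rfl | rfl | rfl
      · exact absurd rfl hab
      · simp [eu, ev]
      · simp [eu, ex]
      · simp [eu, ev, hs a b]
      · exact absurd rfl hab
      · rw [ev, ex, e3]
      · simp [eu, ex, hs a b]
      · rw [ev, ex, hs, e3, add_comm]
      · exact absurd rfl hab
    let VA : α → Prop := fun a => ∃ S ∈ A, a ∈ S
    -- The extension is a coboundary on the removed side. The two formulas agree where the sides
    -- meet, since common vertices of the sides lie in `K`, on which `ψ₀` is a potential of `φ`.
    let φ' : α → α → ZMod 2 := fun a b => if VA a ∧ VA b then φ a b else ψ₀ a + ψ₀ b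
    obtain ⟨ψ, hψ⟩ := hT.exists_potential φ'
      (fun a b => by simp only [φ', and_comm, hs a b, add_comm]) (by
        intro a b c habc
        by_cases hA : Face A a b c
        · have va : VA a := ⟨_, hA, by simp⟩
          have vb : VA b := ⟨_, hA, by simp⟩
          have vc : VA c := ⟨_, hA, by simp⟩
          simp only [φ', va, vb, vc, and_self, if_true]
          exact hφ a b c (face_insert.2 (Or.inr hA))
        · have key : ∀ y ∈ ({a, b, c} : Finset α), ∀ z ∈ ({a, b, c} : Finset α), y ≠ z →
              φ' y z = ψ₀ y + ψ₀ z := by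
            intro y hy z hz hyz
            simp only [φ']
            split_ifs with hV
            · obtain ⟨⟨S, hS, hyS⟩, S', hS', hzS'⟩ := hV
              exact hψ₀ y (h.mem_of_mem hT hS habc hA hyS hy) z
                (h.mem_of_mem hT hS' habc hA hzS' hz) hyz
            · rfl
          obtain ⟨h1, h2, h3⟩ := hT.ne habc
          rw [key a (by simp) b (by simp) h1, key b (by simp) c (by simp) h2,
            key c (by simp) a (by simp) h3.symm]
          have : ∀ p q r : ZMod 2, p + q + (q + r) + (r + p) = 0 := by decide
          exact this _ _ _)
    refine ⟨ψ, fun a b c hf => ?_⟩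
    obtain ⟨d, hd⟩ : ∃ d, Face A a b d := by
      rcases face_insert.1 hf with hf' | hf'
      · exact h.exists_face hT (by simp [← hf']) (by simp [← hf']) (triple_ne (hcard _ hf)).1
      · exact ⟨c, hf'⟩
    rw [← hψ a b d (hAT hd)]
    have va : VA a := ⟨_, hd, by simp⟩
    have vb : VA b := ⟨_, hd, by simp⟩
    simp [φ', va, vb]

end SimplicialMulticomplex

/-! ### Gluing realizations along a separating triangle -/

namespace EuclideanPlane

theorem eq_of_forall_orient_eq_zero {x y : EuclideanPlane} (h : ∀ z, orient x y z = 0) :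
    x = y := by
  have h1 := h (x + !₂[1, 0])
  have h2 := h (x + !₂[0, 1])
  simp [orient] at h1 h2
  ext i
  fin_cases i <;> simp <;> linarith

theorem exists_affine {a b c a' b' c' : EuclideanPlane} (h : orient a b c ≠ 0)
    (h' : orient a' b' c' ≠ 0) : ∃ (M : EuclideanPlane → EuclideanPlane) (k : ℝ), k ≠ 0 ∧
      M a = a' ∧ M b = b' ∧ M c = c' ∧ Function.Injective M ∧
      ∀ x y z, orient (M x) (M y) (M z) = k * orient x y z := by
  -- The barycentric coordinates with respect to `a b c` are used with respect to `a' b' c'`. The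
  -- factor `k` is the ratio of the areas and may be negative.
  let M : EuclideanPlane → EuclideanPlane := fun q => (orient a b c)⁻¹ •
    (orient b c q • a' + orient c a q • b' + orient a b q • c')
  have hM : ∀ x y z, orient (M x) (M y) (M z) =
      orient a' b' c' / orient a b c * orient x y z := by
    intro x y z
    have key : orient a b c ^ 2 * orient (M x) (M y) (M z) =
        orient a' b' c' * orient a b c * orient x y z := by
      have hm : ∀ q i, M q i = (orient a b c)⁻¹ *
          (orient b c q * a' i + orient c a q * b' i + orient a b q * c' i) := fun q i => by
        simp [M]
        ring
      have h0 : ∀ q i, orient a b c * M q i =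
          orient b c q * a' i + orient c a q * b' i + orient a b q * c' i := fun q i => by
        rw [hm, mul_inv_cancel_left₀ h]
      have e : orient a b c ^ 2 * orient (M x) (M y) (M z) =
          (orient a b c * M y 0 - orient a b c * M x 0) *
            (orient a b c * M z 1 - orient a b c * M x 1) -
          (orient a b c * M y 1 - orient a b c * M x 1) *
            (orient a b c * M z 0 - orient a b c * M x 0) := by
        rw [orient.eq_1 (M x)]; ring
      rw [e]
      simp only [h0]
      unfold orient
      ring
    field_simp
    apply mul_left_cancel₀ h
    linear_combination key
  have hk : orient a' b' c' / orient a b c ≠ 0 := div_ne_zero h' h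
  refine ⟨M, _, hk, ?_, ?_, ?_, ?_, hM⟩
  · simp [M, orient_self_left, orient_self_right, orient_rotate, smul_smul, h]
  · simp [M, orient_self_left, orient_self_right, ← orient_rotate a b c, smul_smul]
    rw [orient_rotate b c a, inv_mul_cancel₀ (by rwa [orient_rotate]), one_smul]
  · simp [M, orient_self_left, orient_self_right, smul_smul, h]
  · intro x y hxy
    refine eq_of_forall_orient_eq_zero fun z => ?_
    have := hM x y z
    rw [hxy] at this
    have h0 : orient (M y) (M y) (M z) = 0 := by unfold orient; ring
    rw [h0] at this
    exact (mul_eq_zero.1 this.symm).resolve_left hk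

end EuclideanPlane

namespace SimplicialMulticomplex

open EuclideanPlane

variable {α : Type*} [DecidableEq α] {T A : Finset (Finset α)} {K o : Finset α}
  {p : α → EuclideanPlane}

theorem Realizes.vertex_mem_closure_region (hT : IsSphere T) (hp : Realizes T o p) {S : Finset α}
    (hS : S ∈ T) {a : α} (ha : a ∈ S) : p a ∈ closure (region p o S) := by
  obtain ⟨b, c, rfl⟩ := triple_of_mem_one (hT.card_eq S hS) ha
  exact hp.segment_subset_closure_region hT hS (left_mem_segment ℝ _ _)

theorem isClosed_closedFace (hK : K.card = 3) (p : α → EuclideanPlane) :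
    IsClosed (closedFace p K) := by
  obtain ⟨a, b, c, rfl⟩ := exists_triple hK
  rw [closedFace_triple p hK]
  exact isClosed_closedTri _ _ _

/-- Every other region is disjoint from the exterior, so its closure lies in the closed outer
triangle. A vertex of `o` is seen from a triangle adjacent to `o`. -/
theorem Realizes.vertex_mem_outer (hT : IsSphere T) (ho : o ∈ T) (hp : Realizes T o p)
    {S : Finset α} (hS : S ∈ T) {a : α} (ha : a ∈ S) : p a ∈ closedFace p o := by
  have key : ∀ S ∈ T, S ≠ o → a ∈ S → p a ∈ closedFace p o := by
    intro S hS hne ha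
    have hd := hp.disjoint_region hT ho hS ho hne
    have ho' : region p o o = (closedFace p o)ᶜ := if_pos rfl
    rw [ho', Set.disjoint_compl_right_iff_subset] at hd
    exact closure_minimal hd (isClosed_closedFace (hT.card_eq o ho) p)
      (hp.vertex_mem_closure_region hT hS ha)
  by_cases hne : S = o
  · subst hne
    obtain ⟨b, c, rfl⟩ := triple_of_mem_one (hT.card_eq S hS) ha
    obtain ⟨d, hd, hd'⟩ := hT.exists_ne a b c hS
    refine key _ hd' (fun he => ?_) (by simp)
    have hm : d ∈ ({a, b, c} : Finset α) := he ▸ by simp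
    have := hT.ne hd'
    simp [this.2.1.symm, this.2.2.symm, hd] at hm
  · exact key S hS hne ha

/-- A vertex in the open triangle contradicts disjointness. On a side it would be a corner of the
side, or all triangles at it would contain both ends of the side, which two triangles with a common
edge at it cannot. -/
theorem Realizes.vertex_notMem_inner (hT : IsSphere T) (ho : o ∈ T) (hp : Realizes T o p)
    (hK : K ∈ T) (hKo : K ≠ o) {S : Finset α} (hS : S ∈ T) {a : α} (ha : a ∈ S) (haK : a ∉ K) :
    p a ∉ closedFace p K := by
  intro hcl
  have hc := hT.card_eq K hK
  have hreg : region p o K = openFace p K := if_neg hKo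
  have hopen : p a ∉ openFace p K := by
    intro hmem
    have hne : K ≠ S := fun h => haK (h ▸ ha)
    have hd := (hp.disjoint_region hT ho hK hS hne).closure_right (isOpen_region hT o p hK)
    rw [hreg] at hd
    exact hd.le_bot ⟨hmem, hp.vertex_mem_closure_region hT hS ha⟩
  have hside : ∀ u v x, Face T u v x → a ≠ u → a ≠ v → p a ∉ segment ℝ (p u) (p v) := by
    intro u v x hf hau hav hmem
    rw [← insert_endpoints_openSegment] at hmem
    rcases hmem with hmem | hmem | hmem
    · exact hau (hp.inj S hS _ hf a ha u (by simp) hmem)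
    · exact hav (hp.inj S hS _ hf a ha v (by simp) hmem)
    · have key : ∀ S ∈ T, a ∈ S → u ∈ S ∧ v ∈ S := fun S hS ha =>
        hp.subset_of_mem_openSegment hT ho hf hmem hS (hp.vertex_mem_closure_region hT hS ha)
      obtain ⟨y, rfl⟩ := triple_of_mem (hT.card_eq S hS) ha (key S hS ha).1 hau
      obtain ⟨z, hz, hz'⟩ := hT.exists_ne a u y hS
      have h1 := (key _ hS (by simp)).2
      have h2 := (key _ hz' (by simp)).2
      simp only [Finset.mem_insert, Finset.mem_singleton, hav.symm, (hT.ne hf).1.symm,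
        false_or] at h1 h2
      exact hz (h2.symm.trans h1)
  obtain ⟨u, v, x, rfl⟩ := exists_triple hc
  simp only [Finset.mem_insert, Finset.mem_singleton, not_or] at haK
  rw [closedFace_triple p hc] at hcl
  rw [openFace_triple p hc] at hopen
  have hs : p a ∈ sides (p u) (p v) (p x) := by
    rw [← closedTri_diff_openTri (hp.orient_ne_zero hT hK)]
    exact ⟨hcl, hopen⟩
  have hK : Face T u v x := hK
  rcases hs with (h | h) | h
  · exact hside u v x hK haK.1 haK.2.1 h
  · exact hside v x u hK.rotate haK.2.1 haK.2.2 h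
  · exact hside x u v hK.rotate.rotate haK.2.2 haK.1 h

/-- The second drawing, with outer triangle `K`, is fitted into the inner triangle `K` of the first
one. A negative `k` does no harm, as only products of two signed areas matter. -/
theorem IsSeparation.exists_realizes (hT : IsSphere T) (h : IsSeparation T A K) (ho : o ∈ A)
    {pA pB : α → EuclideanPlane} (hA : Realizes (insert K A) o pA)
    (hB : Realizes (insert K (T \ A)) K pB) : ∃ p, Realizes T o p := by
  classical
  have hTA := h.isSphere hT
  have hTB := h.compl.isSphere hT
  have hKo : K ≠ o := fun he => h.notMem (he ▸ h.subset ho)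
  obtain ⟨u, v, x, hK⟩ := exists_triple h.card_eq
  have hKA : Face (insert K A) u v x := face_insert.2 (Or.inl hK.symm)
  have hKB : Face (insert K (T \ A)) u v x := face_insert.2 (Or.inl hK.symm)
  obtain ⟨M, k, hk, hMu, hMv, hMx, hMi, hM⟩ :=
    exists_affine (hB.orient_ne_zero hTB hKB) (hA.orient_ne_zero hTA hKA)
  have hMK : ∀ a ∈ K, M (pB a) = pA a := by
    intro a ha
    simp only [hK, Finset.mem_insert, Finset.mem_singleton] at ha
    rcases ha with rfl | rfl | rfl <;> assumption
  let p : α → EuclideanPlane := fun a => if ∃ S ∈ A, a ∈ S then pA a else M (pB a)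
  have pA_eq : ∀ S ∈ A, ∀ a ∈ S, p a = pA a := fun S hS a ha => if_pos ⟨S, hS, ha⟩
  have pB_eq : ∀ S ∈ T, S ∉ A → ∀ a ∈ S, p a = M (pB a) := by
    intro S hS hSA a ha
    by_cases hV : ∃ S ∈ A, a ∈ S
    · obtain ⟨S', hS', ha'⟩ := hV
      rw [pA_eq S' hS' a ha', hMK a (h.mem_of_mem hT hS' hS hSA ha' ha)]
    · exact if_neg hV
  have sA : ∀ a b c, Face A a b c → signedArea p o a b c = signedArea pA o a b c := by
    intro a b c hf
    simp only [signedArea]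
    rw [pA_eq _ hf a (by simp), pA_eq _ hf b (by simp), pA_eq _ hf c (by simp)]
  have sB : ∀ a b c, Face T a b c → ¬Face A a b c →
      signedArea p o a b c = k * signedArea pB K a b c := by
    intro a b c hf hn
    simp only [signedArea]
    rw [if_neg (fun he => hn (by rw [Face, he]; exact ho)),
      if_neg (fun he => h.notMem (by rw [← he]; exact hf)), pB_eq _ hf hn a (by simp), pB_eq _ hf hn b (by simp),
      pB_eq _ hf hn c (by simp), hM]
    ring
  have inA : ∀ {a b c}, Face A a b c → Face (insert K A) a b c := fun hf =>
    Finset.mem_insert_of_mem hf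
  have inB : ∀ {a b c}, Face T a b c → ¬Face A a b c → Face (insert K (T \ A)) a b c :=
    fun hf hn => Finset.mem_insert_of_mem (Finset.mem_sdiff.2 ⟨hf, hn⟩)
  have mixed : ∀ a b c d, Face T a b c → Face T a b d → Face A a b c → ¬Face A a b d →
      signedArea p o a b c * signedArea p o a b d < 0 := by
    intro a b c d hc hd hcA hdA
    have hab : a ∈ K ∧ b ∈ K := by
      by_contra hab
      exact hdA (h.same a b c d hc hd hab hcA)
    -- The third vertex `y` of `K` serves as reference: `c` is across `a b` from `y`, and `d` is on
    -- the side of `y`. The minus sign in `h3` arises because `K` is inner for `pA` but outer for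
    -- `pB`.
    obtain ⟨y, hy⟩ := triple_of_mem h.card_eq hab.1 hab.2 (hT.ne hc).1
    have hcy : c ≠ y := fun he => h.notMem (by rw [hy, ← he]; exact hc)
    have hdy : d ≠ y := fun he => h.notMem (by rw [hy, ← he]; exact hd)
    have h1 := hA.neg a b c y (inA hcA) (face_insert.2 (Or.inl hy.symm)) hcy
    have h2 := hB.neg a b d y (inB hd hdA) (face_insert.2 (Or.inl hy.symm)) hdy
    have h3 : signedArea pA o a b y = -(k * signedArea pB K a b y) := by
      simp only [signedArea]
      rw [if_neg (fun he => hKo (hy.trans he)), if_pos hy.symm, ← hMK a hab.1, ← hMK b hab.2,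
        ← hMK y (by rw [hy]; simp), hM]
      ring
    rw [sA _ _ _ hcA, sB _ _ _ hd hdA]
    rw [h3] at h1
    generalize signedArea pA o a b c = r at *
    generalize signedArea pB K a b d = s at *
    generalize signedArea pB K a b y = t at *
    have h4 : 0 < (r * -(k * t)) * (s * t) := mul_pos_of_neg_of_neg h1 h2
    have h5 : 0 < t ^ 2 := by
      have : t ≠ 0 := by rintro rfl; simp at h2
      positivity
    by_contra! h6
    nlinarith [mul_nonneg h6 h5.le]
  refine ⟨p, ?_, ?_⟩
  · intro a b c d hc hd hcd
    by_cases hcA : Face A a b c <;> by_cases hdA : Face A a b d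
    · rw [sA _ _ _ hcA, sA _ _ _ hdA]
      exact hA.neg a b c d (inA hcA) (inA hdA) hcd
    · exact mixed a b c d hc hd hcA hdA
    · rw [mul_comm]
      exact mixed a b d c hd hc hdA hcA
    · rw [sB _ _ _ hc hcA, sB _ _ _ hd hdA]
      have := hB.neg a b c d (inB hc hcA) (inB hd hdA) hcd
      nlinarith [mul_self_pos.2 hk]
  · have both : ∀ a ∈ K, (∃ S ∈ A, a ∈ S) ∧ ∃ S ∈ T, S ∉ A ∧ a ∈ S := by
      intro a ha
      obtain ⟨b, hb, hba⟩ := Finset.exists_mem_ne (by rw [h.card_eq]; omega : 1 < K.card) a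
      obtain ⟨c, hc⟩ := h.exists_face hT ha hb hba.symm
      obtain ⟨d, hd⟩ := h.compl.exists_face hT ha hb hba.symm
      exact ⟨⟨_, hc, by simp⟩, _, h.compl.subset hd, (Finset.mem_sdiff.1 hd).2, by simp⟩
    have inj_A : ∀ S ∈ A, ∀ S' ∈ A, ∀ a ∈ S, ∀ b ∈ S', p a = p b → a = b := by
      intro S hS S' hS' a ha b hb hab
      rw [pA_eq S hS a ha, pA_eq S' hS' b hb] at hab
      exact hA.inj S (Finset.mem_insert_of_mem hS) S' (Finset.mem_insert_of_mem hS') a ha b hb hab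
    have inj_B : ∀ S ∈ T, S ∉ A → ∀ S' ∈ T, S' ∉ A → ∀ a ∈ S, ∀ b ∈ S', p a = p b → a = b := by
      intro S hS hSA S' hS' hSA' a ha b hb hab
      rw [pB_eq S hS hSA a ha, pB_eq S' hS' hSA' b hb] at hab
      exact hB.inj S (Finset.mem_insert_of_mem (Finset.mem_sdiff.2 ⟨hS, hSA⟩)) S'
        (Finset.mem_insert_of_mem (Finset.mem_sdiff.2 ⟨hS', hSA'⟩)) a ha b hb (hMi hab)
    have inj_AB : ∀ S ∈ A, ∀ S' ∈ T, S' ∉ A → ∀ a ∈ S, ∀ b ∈ S', p a = p b → a = b := by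
      intro S hS S' hS' hSA' a ha b hb hab
      by_cases haK : a ∈ K
      · obtain ⟨-, R, hR, hRA, haR⟩ := both a haK
        exact inj_B R hR hRA S' hS' hSA' a haR b hb hab
      by_cases hbK : b ∈ K
      · obtain ⟨⟨R, hR, hbR⟩, -⟩ := both b hbK
        exact inj_A S hS R hR a ha b hbR hab
      -- Outside `K`, the vertices of the first drawing avoid the closed triangle of `K`, and those
      -- of the second lie in it.
      exfalso
      have h1 := hA.vertex_notMem_inner hTA (Finset.mem_insert_of_mem ho)
        (Finset.mem_insert_self K A) hKo (Finset.mem_insert_of_mem hS) ha haK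
      have h2 := hB.vertex_mem_outer hTB (Finset.mem_insert_self _ _)
        (Finset.mem_insert_of_mem (Finset.mem_sdiff.2 ⟨hS', hSA'⟩)) hb
      rw [pA_eq S hS a ha, pB_eq S' hS' hSA' b hb] at hab
      have hK3 : ({u, v, x} : Finset α).card = 3 := hK ▸ h.card_eq
      rw [hab, hK, closedFace_triple pA hK3, ← hMu, ← hMv, ← hMx] at h1
      rw [hK, closedFace_triple pB hK3] at h2
      apply h1
      have hkk : ∀ s t : ℝ, 0 ≤ s * t → 0 ≤ k * s * (k * t) := fun s t hst => by
        have : k * s * (k * t) = k * k * (s * t) := by ring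
        rw [this]
        exact mul_nonneg (mul_self_nonneg k) hst
      simp only [closedTri, Set.mem_ofPred_eq, hM]
      exact ⟨hkk _ _ h2.1, hkk _ _ h2.2.1, hkk _ _ h2.2.2⟩
    intro S hS S' hS' a ha b hb hab
    by_cases hSA : S ∈ A <;> by_cases hSA' : S' ∈ A
    · exact inj_A S hSA S' hSA' a ha b hb hab
    · exact inj_AB S hSA S' hS' hSA' a ha b hb hab
    · exact (inj_AB S' hSA' S hS hSA b hb a ha hab.symm).symm
    · exact inj_B S hS hSA S' hS' hSA' a ha b hb hab

end SimplicialMulticomplex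

/-! ### Contracting an edge -/

namespace SimplicialMulticomplex

variable {α : Type*} [DecidableEq α] {T : Finset (Finset α)} {u v x y : α}

theorem IsSphere.exists_other (hT : IsSphere T) {a b c : α} (h : Face T a b c) :
    ∃ d, d ≠ c ∧ ∀ e, Face T a b e ↔ e = c ∨ e = d := by
  obtain ⟨d, hd, hd'⟩ := hT.exists_ne a b c h
  refine ⟨d, hd, fun e => ⟨fun he => ?_, ?_⟩⟩
  · by_cases hce : e = c
    · exact Or.inl hce
    · exact Or.inr (hT.eq_of_ne a b c d e h hd' he hd.symm (Ne.symm hce)).symm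
  · rintro (rfl | rfl) <;> assumption

/-- The edge `u v` of the sphere `T` can be contracted: its end points have no common neighbours
except for the third vertices `x`, `y` of the two triangles that contain it, and the contraction
identifies no two other triangles. -/
structure IsContractible (T : Finset (Finset α)) (u v x y : α) : Prop where
  left : Face T u v x
  right : Face T u v y
  ne : x ≠ y
  common : ∀ z c d, Face T u z c → Face T v z d → Face T u v z
  excl : ∀ a b, Face T u a b → ¬Face T v a b

theorem IsContractible.eq_or_eq (hT : IsSphere T) (h : IsContractible T u v x y) {z : α}
    (hz : Face T u v z) : z = x ∨ z = y := by
  by_cases hxz : x = z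
  · exact Or.inl hxz.symm
  · exact Or.inr (hT.eq_of_ne u v x y z h.left h.right hz h.ne hxz).symm

/-- An alternating sum around the star of `u`, cut open along the edge `u v`. -/
theorem IsContractible.add_eq_zero (hT : IsSphere T) (h : IsContractible T u v x y) {M : Type*}
    [AddCommGroup M] (f : α → α → M) (hs : ∀ a b, f a b + f b a = 0)
    (hf : ∀ a b c, a ≠ v → b ≠ v → c ≠ v → Face T u a b → Face T u a c → b ≠ c →
      f a b + f a c = 0) {a₀ a₁ : α} (h0 : Face T u x a₀) (h0v : a₀ ≠ v) (h1 : Face T u y a₁)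
    (h1v : a₁ ≠ v) : f x a₀ + f y a₁ = 0 := by
  classical
  have hxv := (hT.ne h.left).2.1.symm
  have hyv := (hT.ne h.right).2.1.symm
  -- These are the oriented link edges of `u` that avoid `v`. Swapping the two ends cancels the sum
  -- over all of them, and passing to the next triangle cancels the part whose first vertex is not
  -- `x` or `y`. Only the two end terms are left.
  set P : Finset (α × α) := ((T.biUnion id) ×ˢ (T.biUnion id)).filter
    fun q => Face T u q.1 q.2 ∧ q.1 ≠ v ∧ q.2 ≠ v with hP
  have hmem : ∀ q, q ∈ P ↔ Face T u q.1 q.2 ∧ q.1 ≠ v ∧ q.2 ≠ v := by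
    intro q
    simp only [hP, Finset.mem_filter, Finset.mem_product, Finset.mem_biUnion, id,
      and_iff_right_iff_imp]
    exact fun h => ⟨⟨_, h.1, by simp⟩, ⟨_, h.1, by simp⟩⟩
  have hsum : ∑ q ∈ P, f q.1 q.2 = 0 := by
    refine Finset.sum_involution (fun q _ => (q.2, q.1)) (fun q _ => hs _ _) ?_ ?_ ?_
    · rintro ⟨a, b⟩ hq - he
      have := hT.ne ((hmem _).1 hq).1
      exact this.2.1 (Prod.ext_iff.1 he).2
    · intro q hq
      rw [hmem] at hq ⊢
      exact ⟨hq.1.swap.rotate, hq.2.2, hq.2.1⟩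
    · intro q _; rfl
  have hother : ∀ z, Face T u v z → ∀ a b, Face T u z a → a ≠ v → Face T u z b → b ≠ v → a = b :=
    fun z hz a b ha hav hb hbv => hT.eq_of_ne u z v a b hz.swap.rotate ha hb hav.symm hbv.symm
  have hends : P.filter (fun q => q.1 = x ∨ q.1 = y) = {(x, a₀), (y, a₁)} := by
    ext ⟨a, b⟩
    simp only [Finset.mem_filter, hmem, Finset.mem_insert, Finset.mem_singleton, Prod.mk.injEq]
    constructor
    · rintro ⟨⟨hab, hav, hbv⟩, rfl | rfl⟩
      · exact Or.inl ⟨rfl, hother _ h.left _ _ hab hbv h0 h0v⟩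
      · exact Or.inr ⟨rfl, hother _ h.right _ _ hab hbv h1 h1v⟩
    · rintro (⟨rfl, rfl⟩ | ⟨rfl, rfl⟩)
      · exact ⟨⟨h0, hxv, h0v⟩, Or.inl rfl⟩
      · exact ⟨⟨h1, hyv, h1v⟩, Or.inr rfl⟩
  have hrest : ∑ q ∈ P.filter (fun q => ¬(q.1 = x ∨ q.1 = y)), f q.1 q.2 = 0 := by
    choose! g hg hgT using hT.exists_ne
    have hgv : ∀ q ∈ P.filter (fun q => ¬(q.1 = x ∨ q.1 = y)), g u q.1 q.2 ≠ v := by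
      intro q hq he
      rw [Finset.mem_filter, hmem] at hq
      have := hgT _ _ _ hq.1.1
      rw [he] at this
      exact hq.2 (h.eq_or_eq hT this.swap.rotate)
    refine Finset.sum_involution (fun q _ => (q.1, g u q.1 q.2)) ?_ ?_ ?_ ?_
    · intro q hq
      have hgv := hgv q hq
      rw [Finset.mem_filter, hmem] at hq
      exact hf _ _ _ hq.1.2.1 hq.1.2.2 hgv hq.1.1 (hgT _ _ _ hq.1.1) (hg _ _ _ hq.1.1).symm
    · rintro ⟨a, b⟩ hq - he
      rw [Finset.mem_filter, hmem] at hq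
      exact hg _ _ _ hq.1.1 (Prod.ext_iff.1 he).2
    · intro q hq
      have hgv := hgv q hq
      rw [Finset.mem_filter, hmem] at hq ⊢
      exact ⟨⟨hgT _ _ _ hq.1.1, hq.1.2.1, hgv⟩, hq.2⟩
    · rintro ⟨a, b⟩ hq
      rw [Finset.mem_filter, hmem] at hq
      have h1 := hgT _ _ _ hq.1.1
      have h2 := hgT _ _ _ h1
      simp only [Prod.mk.injEq, true_and]
      exact (hT.eq_of_ne _ _ _ _ _ h1 hq.1.1 h2 (hg _ _ _ hq.1.1) (hg _ _ _ h1).symm).symm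
  rw [← Finset.sum_filter_add_sum_filter_not P (fun q => q.1 = x ∨ q.1 = y), hrest, add_zero,
    hends, Finset.sum_pair (fun he => h.ne (Prod.ext_iff.1 he).1)] at hsum
  exact hsum

/-- The map that moves `v` to `u`. -/
def moveTo (u v a : α) : α := if a = v then u else a

/-- The result of contracting the edge `u v` to `u`. -/
def contract (T : Finset (Finset α)) (u v : α) : Finset (Finset α) :=
  (T.image fun S => S.image (moveTo u v)).filter fun S => S.card = 3

theorem moveTo_eq_iff {a b : α} : moveTo u v a = moveTo u v b ↔
    a = b ∨ (a = u ∧ b = v) ∨ (a = v ∧ b = u) := by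
  unfold moveTo
  split_ifs <;> grind

theorem moveTo_ne (huv : u ≠ v) (a : α) : moveTo u v a ≠ v := by
  unfold moveTo
  split_ifs <;> assumption

theorem moveTo_of_ne {a : α} (h : a ≠ v) : moveTo u v a = a := if_neg h

theorem moveTo_self : moveTo u v v = u := if_pos rfl

theorem image_triple (f : α → α) (a b c : α) :
    ({a, b, c} : Finset α).image f = {f a, f b, f c} := by
  rw [Finset.image_insert, Finset.image_insert, Finset.image_singleton]

theorem face_contract_iff (hT : IsSphere T) {a b c : α} : Face (contract T u v) a b c ↔
    ({a, b, c} : Finset α).card = 3 ∧ ∃ a' b' c', Face T a' b' c' ∧ moveTo u v a' = a ∧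
      moveTo u v b' = b ∧ moveTo u v c' = c := by
  simp only [Face, contract, Finset.mem_filter, Finset.mem_image]
  constructor
  · rintro ⟨⟨S, hS, he⟩, h3⟩
    refine ⟨h3, ?_⟩
    have hl : ∀ z ∈ ({a, b, c} : Finset α), ∃ z' ∈ S, moveTo u v z' = z := fun z hz =>
      Finset.mem_image.1 (he ▸ hz)
    obtain ⟨a', ha, rfl⟩ := hl a (by simp)
    obtain ⟨b', hb, rfl⟩ := hl b (by simp)
    obtain ⟨c', hc, rfl⟩ := hl c (by simp)
    obtain ⟨h1, h2, h4⟩ := triple_ne h3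
    refine ⟨a', b', c', ?_, rfl, rfl, rfl⟩
    have hsub : ({a', b', c'} : Finset α) ⊆ S := by
      intro z hz
      simp only [Finset.mem_insert, Finset.mem_singleton] at hz
      rcases hz with rfl | rfl | rfl <;> assumption
    have hc3 : ({a', b', c'} : Finset α).card = 3 := Finset.card_eq_three.2
      ⟨a', b', c', fun h => h1 (h ▸ rfl), fun h => h4 (h ▸ rfl), fun h => h2 (h ▸ rfl), rfl⟩
    have heq := Finset.eq_of_subset_of_card_le hsub (by rw [hc3, hT.card_eq S hS])
    exact heq ▸ hS
  · rintro ⟨h3, a', b', c', hf, rfl, rfl, rfl⟩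
    exact ⟨⟨_, hf, image_triple _ _ _ _⟩, h3⟩

theorem face_moveTo (hT : IsSphere T) {a b c : α} (h : Face T a b c)
    (hab : moveTo u v a ≠ moveTo u v b) (hbc : moveTo u v b ≠ moveTo u v c)
    (hac : moveTo u v a ≠ moveTo u v c) :
    Face (contract T u v) (moveTo u v a) (moveTo u v b) (moveTo u v c) :=
  (face_contract_iff hT).2 ⟨Finset.card_eq_three.2 ⟨_, _, _, hab, hac, hbc, rfl⟩, a, b, c, h, rfl,
    rfl, rfl⟩

theorem contract_card_lt (hT : IsSphere T) (h : Face T u v x) :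
    (contract T u v).card < T.card := by
  have hsub : contract T u v ⊆ (T.erase {u, v, x}).image fun S => S.image (moveTo u v) := by
    intro S hS
    obtain ⟨hS, h3⟩ := Finset.mem_filter.1 hS
    obtain ⟨S', hS', rfl⟩ := Finset.mem_image.1 hS
    refine Finset.mem_image.2 ⟨S', Finset.mem_erase.2 ⟨?_, hS'⟩, rfl⟩
    rintro rfl
    rw [image_triple, moveTo_self, moveTo_of_ne (hT.ne h).1] at h3
    exact (triple_ne h3).1 rfl
  have h1 := (Finset.card_le_card hsub).trans Finset.card_image_le
  have h2 : ({u, v, x} : Finset α) ∈ T := h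
  have := Finset.card_erase_lt_of_mem h2
  omega

/-- Every edge of the contraction lies in exactly two triangles. -/
theorem IsContractible.exists_two (hT : IsSphere T) (h : IsContractible T u v x y) {a b c : α}
    (hf : Face (contract T u v) a b c) :
    ∃ c₀ c₁, c₀ ≠ c₁ ∧ ∀ e, Face (contract T u v) a b e ↔ e = c₀ ∨ e = c₁ := by
  have huv := (hT.ne h.left).1
  have hnv : ∀ {a b c}, Face (contract T u v) a b c → a ≠ v ∧ b ≠ v ∧ c ≠ v := by
    intro a b c hf
    obtain ⟨-, a', b', c', -, rfl, rfl, rfl⟩ := (face_contract_iff hT).1 hf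
    exact ⟨moveTo_ne huv _, moveTo_ne huv _, moveTo_ne huv _⟩
  have mu : moveTo u v u = u := moveTo_of_ne huv
  have hu : ∀ b c, Face (contract T u v) u b c →
      ∃ c₀ c₁, c₀ ≠ c₁ ∧ ∀ e, Face (contract T u v) u b e ↔ e = c₀ ∨ e = c₁ := by
    intro b c hf
    have hb := (hnv hf).2.1
    have hub := (triple_ne ((face_contract_iff hT).1 hf).1).1
    have hface : ∀ e, Face (contract T u v) u b e ↔
        e ≠ u ∧ e ≠ v ∧ (Face T u b e ∨ Face T v b e) := by
      intro e
      constructor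
      · intro he
        have hne := triple_ne ((face_contract_iff hT).1 he).1
        obtain ⟨-, a', b', c', hf', ha', hb', hc'⟩ := (face_contract_iff hT).1 he
        have hbb : b' = b := by unfold moveTo at hb'; split_ifs at hb' <;> grind
        have hcc : c' = e := by unfold moveTo at hc'; split_ifs at hc' <;> grind
        subst hbb hcc
        refine ⟨hne.2.2.symm, (hnv he).2.2, ?_⟩
        unfold moveTo at ha'
        split_ifs at ha' with hav
        · exact Or.inr (hav ▸ hf')
        · exact Or.inl (ha' ▸ hf')
      · rintro ⟨heu, hev, hf' | hf'⟩
        · have := face_moveTo (u := u) (v := v) hT hf'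
          rw [mu, moveTo_of_ne hb, moveTo_of_ne hev] at this
          exact this hub (hT.ne hf').2.1 heu.symm
        · have := face_moveTo (u := u) (v := v) hT hf'
          rw [moveTo_self, moveTo_of_ne hb, moveTo_of_ne hev] at this
          exact this hub (hT.ne hf').2.1 heu.symm
    -- If `u v b` is collapsed, the edges `u b` and `v b` merge, and each contributes its triangle
    -- other than `u v b`. Otherwise `common` allows only one of them to be an edge.
    by_cases huvb : Face T u v b
    · obtain ⟨a₀, ha, ha'⟩ := hT.exists_other huvb.rotate.rotate.swap
      obtain ⟨b₀, hb₀, hb'⟩ := hT.exists_other huvb.rotate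
      have fa := (ha' a₀).2 (Or.inr rfl)
      have fb := (hb' b₀).2 (Or.inr rfl)
      refine ⟨a₀, b₀, fun he => h.excl b a₀ fa (he ▸ fb), fun e => ?_⟩
      rw [hface, ha', hb']
      have h1 := hT.ne fa
      have h2 := hT.ne fb
      constructor
      · grind
      · rintro (rfl | rfl)
        · exact ⟨h1.2.2.symm, ha, Or.inl (Or.inr rfl)⟩
        · exact ⟨hb₀, h2.2.2.symm, Or.inr (Or.inr rfl)⟩
    · obtain ⟨hcu, hcv, hf'⟩ := (hface c).1 hf
      rcases hf' with hf' | hf'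
      · obtain ⟨d, hd, hd'⟩ := hT.exists_other hf'
        refine ⟨c, d, hd.symm, fun e => ?_⟩
        rw [hface, hd']
        have fd := (hd' d).2 (Or.inr rfl)
        constructor
        · rintro ⟨h1, h2, h3 | h3⟩
          · exact h3
          · exact absurd (h.common _ _ _ hf' h3) huvb
        · rintro (rfl | rfl)
          · exact ⟨hcu, hcv, Or.inl (Or.inl rfl)⟩
          · exact ⟨(hT.ne fd).2.2.symm, fun he => huvb (he ▸ fd).swap.rotate.swap.rotate.swap.rotate,
              Or.inl (Or.inr rfl)⟩
      · obtain ⟨d, hd, hd'⟩ := hT.exists_other hf'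
        refine ⟨c, d, hd.symm, fun e => ?_⟩
        rw [hface, hd']
        have fd := (hd' d).2 (Or.inr rfl)
        constructor
        · rintro ⟨h1, h2, h3 | h3⟩
          · exact absurd (h.common _ _ _ h3 hf') huvb
          · exact h3
        · rintro (rfl | rfl)
          · exact ⟨hcu, hcv, Or.inr (Or.inl rfl)⟩
          · exact ⟨fun he => huvb (he ▸ fd).rotate.rotate, (hT.ne fd).2.2.symm,
              Or.inr (Or.inr rfl)⟩
  by_cases hau : a = u
  · subst hau
    exact hu b c hf
  by_cases hbu : b = u
  · subst hbu
    obtain ⟨c₀, c₁, hne, hcc⟩ := hu a c hf.swap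
    exact ⟨c₀, c₁, hne, fun e => by rw [← hcc]; exact ⟨Face.swap, Face.swap⟩⟩
  obtain ⟨h3, a', b', c', hf', ha', hb', rfl⟩ := (face_contract_iff hT).1 hf
  have haa : a' = a := by unfold moveTo at ha'; split_ifs at ha' <;> grind
  have hbb : b' = b := by unfold moveTo at hb'; split_ifs at hb' <;> grind
  subst haa hbb
  obtain ⟨d, hd, hd'⟩ := hT.exists_other hf'
  have fd := (hd' d).2 (Or.inr rfl)
  have hav := (hnv hf).1
  have hbv := (hnv hf).2.1
  refine ⟨moveTo u v c', moveTo u v d, fun he => ?_, fun e => ⟨fun he => ?_, ?_⟩⟩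
  · rcases moveTo_eq_iff.1 he with he | ⟨rfl, rfl⟩ | ⟨rfl, rfl⟩
    · exact hd he.symm
    · exact h.excl _ _ hf'.rotate.rotate fd.rotate.rotate
    · exact h.excl _ _ fd.rotate.rotate hf'.rotate.rotate
  · obtain ⟨-, a₁, b₁, e', hf₁, ha₁, hb₁, rfl⟩ := (face_contract_iff hT).1 he
    have haa : a₁ = a' := by unfold moveTo at ha₁; split_ifs at ha₁ <;> grind
    have hbb : b₁ = b' := by unfold moveTo at hb₁; split_ifs at hb₁ <;> grind
    subst haa hbb
    rcases (hd' e').1 hf₁ with rfl | rfl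
    exacts [Or.inl rfl, Or.inr rfl]
  · have key : ∀ z, Face T a' b' z → Face (contract T u v) a' b' (moveTo u v z) := by
      intro z hz
      have hzn := hT.ne hz
      have := face_moveTo (u := u) (v := v) hT hz
      rw [moveTo_of_ne hav, moveTo_of_ne hbv] at this
      refine this hzn.1 (fun he => ?_) (fun he => ?_)
      · unfold moveTo at he; split_ifs at he <;> grind
      · unfold moveTo at he; split_ifs at he <;> grind
    rintro (rfl | rfl)
    exacts [key _ hf', key _ fd]

end SimplicialMulticomplex

/-! ### The contraction is again a sphere. -/

namespace SimplicialMulticomplex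

variable {α : Type*} [DecidableEq α] {T : Finset (Finset α)} {u v x y : α}

theorem face_contract_or (hT : IsSphere T) (huv : u ≠ v) {a b c : α} (h : Face T a b c) :
    Face (contract T u v) (moveTo u v a) (moveTo u v b) (moveTo u v c) ∨
      ∃ z, ({a, b, c} : Finset α) = {u, v, z} := by
  by_cases hm : u ∈ ({a, b, c} : Finset α) ∧ v ∈ ({a, b, c} : Finset α)
  · exact Or.inr (triple_of_mem (hT.card_eq _ h) hm.1 hm.2 huv)
  · left
    obtain ⟨h1, h2, h3⟩ := hT.ne h
    simp only [Finset.mem_insert, Finset.mem_singleton] at hm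
    refine face_moveTo hT h ?_ ?_ ?_ <;> rw [Ne, moveTo_eq_iff] <;> grind

/-- A closed family of triangles of the contraction that contains a triangle at one of the two
edges onto which triangles are collapsed also contains one at the other. -/
theorem IsContractible.exists_face_of_closed (hT : IsSphere T) (h : IsContractible T u v x y)
    {W : Finset (Finset α)}
    (hcl : ∀ a b c d, Face W a b c → Face (contract T u v) a b d → Face W a b d) {e : α}
    (he : Face W u x e) : ∃ e', Face W u y e' := by
  classical
  have huv := (hT.ne h.left).1
  have hbase : ∀ z, Face T u v z → ∃ a₀, a₀ ≠ v ∧ Face T u z a₀ := fun z hz => by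
    obtain ⟨a₀, h0, h1⟩ := hT.exists_ne _ _ _ hz.rotate.rotate.swap
    exact ⟨a₀, h0, h1⟩
  have hcon : ∀ a b, a ≠ v → b ≠ v → Face T u a b → Face (contract T u v) u a b := by
    intro a b ha hb hf
    obtain ⟨h1, h2, h3⟩ := hT.ne hf
    have := face_moveTo (u := u) (v := v) hT hf
    rw [moveTo_of_ne huv, moveTo_of_ne ha, moveTo_of_ne hb] at this
    exact this h1 h2 h3
  obtain ⟨a₀, h0v, h0⟩ := hbase x h.left
  obtain ⟨a₁, h1v, h1⟩ := hbase y h.right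
  -- Closedness makes membership in `W` constant along the star of `u`; modulo 2, a constant
  -- indicator satisfies the alternating condition.
  have key := h.add_eq_zero hT (M := ZMod 2) (fun a b => if Face W u a b then 1 else 0)
    (fun a b => by
      have : Face W u a b ↔ Face W u b a := ⟨fun h => h.swap.rotate, fun h => h.swap.rotate⟩
      simp only [this]
      split_ifs <;> decide)
    (fun a b c ha hb hc hab hac _ => by
      have : Face W u a b ↔ Face W u a c :=
        ⟨fun h => hcl _ _ _ _ h (hcon a c ha hc hac), fun h => hcl _ _ _ _ h (hcon a b ha hb hab)⟩
      simp only [this]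
      split_ifs <;> decide)
    h0 h0v h1 h1v
  have hx : Face W u x a₀ :=
    hcl _ _ _ _ he (hcon x a₀ (hT.ne h.left).2.1.symm h0v h0)
  rw [if_pos hx] at key
  by_contra hn
  rw [if_neg fun h => hn ⟨_, h⟩] at key
  exact absurd key (by decide)

theorem IsContractible.of_faces (h : IsContractible T u v x y) {z z' : α} (hz : Face T u v z)
    (hz' : Face T u v z') (hne : z ≠ z') : IsContractible T u v z z' :=
  ⟨hz, hz', hne, h.common, h.excl⟩

/-- Closed families and cocycles are pulled back to `T`. The two collapsed triangles need separate
care, as they have no image among the triangles of the contraction. -/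
theorem IsContractible.isSphere_contract (hT : IsSphere T) (h : IsContractible T u v x y) :
    IsSphere (contract T u v) := by
  classical
  have huv := (hT.ne h.left).1
  have mu : moveTo u v u = u := moveTo_of_ne huv
  have hne : ∀ {a b c}, Face (contract T u v) a b c → a ≠ b ∧ b ≠ c ∧ a ≠ c := fun hf =>
    triple_ne (Finset.mem_filter.1 hf).2
  have hzv : ∀ {z}, Face T u v z → moveTo u v z = z := fun hz =>
    moveTo_of_ne (hT.ne hz).2.1.symm
  refine ⟨fun S hS => (Finset.mem_filter.1 hS).2, ?_, ?_, ?_, ?_⟩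
  · intro a b c hf
    obtain ⟨c₀, c₁, hc, hiff⟩ := h.exists_two hT hf
    rcases (hiff c).1 hf with rfl | rfl
    · exact ⟨c₁, hc.symm, (hiff _).2 (Or.inr rfl)⟩
    · exact ⟨c₀, hc, (hiff _).2 (Or.inl rfl)⟩
  · intro a b c d e hc hd he hcd hce
    obtain ⟨c₀, c₁, -, hiff⟩ := h.exists_two hT hc
    rw [hiff] at hc hd he
    grind
  · intro W hW hWne hcl
    -- A collapsed triangle `u v z` is added when the edge `u z` to which it shrinks is a side of a
    -- member of `W`, so that paths of triangles can pass through it.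
    have hU := hT.eq_of_closed (T.filter fun S => S.image (moveTo u v) ∈ W ∨
        ∃ z e, S = {u, v, z} ∧ Face W u z e) (Finset.filter_subset _ _) (by
      obtain ⟨S, hS⟩ := hWne
      obtain ⟨S', hS', rfl⟩ := Finset.mem_image.1 (Finset.mem_filter.1 (hW hS)).1
      exact ⟨S', Finset.mem_filter.2 ⟨hS', Or.inl hS⟩⟩) (by
      intro a b c d hc hd
      obtain ⟨hcT, hc⟩ := Finset.mem_filter.1 hc
      have hcT : Face T a b c := hcT
      refine Finset.mem_filter.2 ⟨hd, ?_⟩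
      rw [image_triple] at hc ⊢
      rcases face_contract_or hT huv hd with hd' | ⟨z', hz'⟩
      · left
        rcases hc with hc | ⟨z, e, hz, he⟩
        · exact hcl _ _ _ _ hc hd'
        · have hzT : Face T u v z := by rw [Face, ← hz]; exact hcT
          have mz := hzv hzT
          rcases triple_perm hz (hT.card_eq _ hcT) with ⟨rfl, rfl, rfl⟩ | ⟨rfl, rfl, rfl⟩ |
            ⟨rfl, rfl, rfl⟩ | ⟨rfl, rfl, rfl⟩ | ⟨rfl, rfl, rfl⟩ | ⟨rfl, rfl, rfl⟩
          · exact absurd (mu.trans moveTo_self.symm) (hne hd').1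
          · rw [mu, mz] at hd' ⊢
            exact hcl _ _ _ _ he hd'
          · exact absurd (mu.trans moveTo_self.symm).symm (hne hd').1
          · rw [moveTo_self, mz] at hd' ⊢
            exact hcl _ _ _ _ he hd'
          · rw [mu, mz] at hd' ⊢
            exact hcl _ _ _ _ (Face.swap he) hd'
          · rw [moveTo_self, mz] at hd' ⊢
            exact hcl _ _ _ _ (Face.swap he) hd'
      · right
        have hzT' : Face T u v z' := by rw [Face, ← hz']; exact hd
        have mz := hzv hzT'
        rcases hc with hc | ⟨z, e, hz, he⟩
        · have hc : Face W (moveTo u v a) (moveTo u v b) (moveTo u v c) := hc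
          have hnc := (hne (hW hc)).1
          suffices ∃ e, Face W u z' e from this.elim fun e he => ⟨z', e, hz', he⟩
          rcases triple_perm hz' (hT.card_eq _ hd) with ⟨rfl, rfl, rfl⟩ | ⟨rfl, rfl, rfl⟩ |
            ⟨rfl, rfl, rfl⟩ | ⟨rfl, rfl, rfl⟩ | ⟨rfl, rfl, rfl⟩ | ⟨rfl, rfl, rfl⟩
          · exact absurd (mu.trans moveTo_self.symm) hnc
          · rw [mu, mz] at hc
            exact ⟨_, hc⟩
          · exact absurd (mu.trans moveTo_self.symm).symm hnc
          · rw [moveTo_self, mz] at hc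
            exact ⟨_, hc⟩
          · rw [mu, mz] at hc
            exact ⟨_, hc.swap⟩
          · rw [moveTo_self, mz] at hc
            exact ⟨_, hc.swap⟩
        · by_cases hzz : z = z'
          · subst hzz
            exact ⟨z, e, hz', he⟩
          · have hzT : Face T u v z := by rw [Face, ← hz]; exact hcT
            obtain ⟨e', he'⟩ := (h.of_faces hzT hzT' hzz).exists_face_of_closed hT hcl he
            exact ⟨z', e', hz', he'⟩)
    refine hW.antisymm fun S hS => ?_
    obtain ⟨hS, h3⟩ := Finset.mem_filter.1 hS
    obtain ⟨S', hS', rfl⟩ := Finset.mem_image.1 hS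
    rw [← hU] at hS'
    rcases (Finset.mem_filter.1 hS').2 with hm | ⟨z, e, rfl, -⟩
    · exact hm
    · rw [image_triple, mu, moveTo_self] at h3
      exact absurd rfl (triple_ne h3).1
  · intro φ hs hφ
    have hadd : ∀ a b, φ a b + φ b a = 0 := fun a b => by rw [hs, CharTwo.add_self_eq_zero]
    -- The pull-back vanishes on the collapsed edge, so its potential agrees at `u` and `v` and
    -- descends to the contraction.
    obtain ⟨ψ, hψ⟩ := hT.exists_potential (fun a b => if moveTo u v a = moveTo u v b then 0 else
        φ (moveTo u v a) (moveTo u v b))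
      (fun a b => by simp only [eq_comm, hs (moveTo u v a)]) (by
        intro a b c hf
        rcases face_contract_or hT huv hf with hf' | ⟨z, hz⟩
        · obtain ⟨h1, h2, h3⟩ := hne hf'
          simp only [h1, h2, h3.symm, if_false]
          exact hφ _ _ _ hf'
        · have hzT : Face T u v z := by rw [Face, ← hz]; exact hf
          have mz := hzv hzT
          have huz := (hT.ne hzT).2.2
          rcases triple_perm hz (hT.card_eq _ hf) with ⟨rfl, rfl, rfl⟩ | ⟨rfl, rfl, rfl⟩ |
            ⟨rfl, rfl, rfl⟩ | ⟨rfl, rfl, rfl⟩ | ⟨rfl, rfl, rfl⟩ | ⟨rfl, rfl, rfl⟩ <;>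
          simp [mu, mz, moveTo_self, huz, huz.symm, hadd])
    have hψuv : ψ u = ψ v := by
      have := hψ u v x h.left
      rw [if_pos (mu.trans moveTo_self.symm)] at this
      exact CharTwo.add_eq_zero.1 this.symm
    have hψm : ∀ a, ψ (moveTo u v a) = ψ a := by
      intro a
      unfold moveTo
      split_ifs with ha
      · rw [ha, hψuv]
      · rfl
    refine ⟨ψ, fun a b c hf => ?_⟩
    obtain ⟨h3, a', b', c', hf', rfl, rfl, rfl⟩ := (face_contract_iff hT).1 hf
    have := hψ a' b' c' hf'
    rw [if_neg (triple_ne h3).1] at this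
    rw [this, hψm, hψm]

end SimplicialMulticomplex

/-! ### Existence of realizations -/

namespace EuclideanPlane

theorem orient_add_neg (c x d : EuclideanPlane) :
    orient c x (c + -d) = -orient c x (c + d) := by
  simp only [orient, PiLp.add_apply, PiLp.neg_apply]; ring

/-- The hypotheses say that the rays from `c` through `x` and `y` are distinct, so some directed
line through `c` has them on opposite sides. -/
theorem exists_orient_neg_pos {c x y : EuclideanPlane} (hx : x ∉ segment ℝ c y)
    (hy : y ∉ segment ℝ c x) : ∃ d, orient c x (c + d) < 0 ∧ 0 < orient c y (c + d) := by
  have hform : ∀ z r s, orient c z (c + !₂[r, s]) = (z 0 - c 0) * s - (z 1 - c 1) * r := by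
    intro z r s
    simp [orient]
  set X0 := x 0 - c 0 with hX0
  set X1 := x 1 - c 1 with hX1
  set Y0 := y 0 - c 0 with hY0
  set Y1 := y 1 - c 1 with hY1
  have hxc : 0 < X0 ^ 2 + X1 ^ 2 := by
    by_contra hn
    have h0 : X0 = 0 := by nlinarith [sq_nonneg X0, sq_nonneg X1]
    have h1 : X1 = 0 := by nlinarith [sq_nonneg X0, sq_nonneg X1]
    apply hx
    have : x = c := by
      ext i
      fin_cases i <;> simp <;> linarith
    rw [this]
    exact left_mem_segment ℝ _ _
  by_cases hcr : X0 * Y1 - X1 * Y0 = 0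
  -- Parallel vectors with non-negative inner product span the same ray, and then the nearer point
  -- lies on the segment to the farther one.
  · have hdot : X0 * Y0 + X1 * Y1 < 0 := by
      by_contra! hdot
      have e0 : (X0 ^ 2 + X1 ^ 2) * Y0 = (X0 * Y0 + X1 * Y1) * X0 := by
        linear_combination (-X1) * hcr
      have e1 : (X0 ^ 2 + X1 ^ 2) * Y1 = (X0 * Y0 + X1 * Y1) * X1 := by
        linear_combination X0 * hcr
      rcases le_total (X0 * Y0 + X1 * Y1) (X0 ^ 2 + X1 ^ 2) with hle | hle
      · apply hy
        rw [segment_eq_image']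
        refine ⟨(X0 * Y0 + X1 * Y1) / (X0 ^ 2 + X1 ^ 2), ⟨by positivity,
          (div_le_one hxc).2 hle⟩, ?_⟩
        ext i
        fin_cases i
        · simp only [Fin.zero_eta, PiLp.add_apply, PiLp.smul_apply, PiLp.sub_apply, smul_eq_mul]
          rw [← hX0]
          field_simp
          linear_combination -e0
        · simp only [Fin.mk_one, PiLp.add_apply, PiLp.smul_apply, PiLp.sub_apply, smul_eq_mul]
          rw [← hX1]
          field_simp
          linear_combination -e1
      · apply hx
        have hpos : 0 < X0 * Y0 + X1 * Y1 := hxc.trans_le hle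
        rw [segment_eq_image']
        refine ⟨(X0 ^ 2 + X1 ^ 2) / (X0 * Y0 + X1 * Y1), ⟨by positivity,
          (div_le_one hpos).2 hle⟩, ?_⟩
        ext i
        fin_cases i
        · simp only [Fin.zero_eta, PiLp.add_apply, PiLp.smul_apply, PiLp.sub_apply, smul_eq_mul]
          rw [← hY0]
          field_simp
          linear_combination e0
        · simp only [Fin.mk_one, PiLp.add_apply, PiLp.smul_apply, PiLp.sub_apply, smul_eq_mul]
          rw [← hY1]
          field_simp
          linear_combination e1
    refine ⟨!₂[X1, -X0], ?_, ?_⟩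
    · rw [hform]; nlinarith
    · rw [hform]; nlinarith
  · have hsq : 0 < (X0 * Y1 - X1 * Y0) ^ 2 := by positivity
    -- The sum of the two vectors separates them; the factor adjusts the sign, and both orientations
    -- become plus or minus the squared determinant.
    refine ⟨!₂[-(X0 * Y1 - X1 * Y0) * (X0 + Y0), -(X0 * Y1 - X1 * Y0) * (X1 + Y1)], ?_, ?_⟩
    · rw [hform]; nlinarith
    · rw [hform]; nlinarith

end EuclideanPlane

/-! ### The direction of expansion. -/

namespace SimplicialMulticomplex

open EuclideanPlane

variable {α : Type*} [DecidableEq α] {T : Finset (Finset α)} {o : Finset α} {u v x y : α}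
  {p : α → EuclideanPlane}

theorem signedArea_swap_right (p : α → EuclideanPlane) (o : Finset α) (a b c : α) :
    signedArea p o a c b = -signedArea p o a b c := by
  rw [← signedArea_rotate p o a c b, signedArea_swap p o b c a, signedArea_rotate p o a b c]

theorem Realizes.vertex_notMem_segment (hT : IsSphere T) (ho : o ∈ T) (hp : Realizes T o p)
    {a b c d e : α} (h : Face T a b c) (h' : Face T a d e) (hbd : b ≠ d) :
    p d ∉ segment ℝ (p a) (p b) := by
  intro hd
  have hn := hT.ne h'
  rw [← insert_endpoints_openSegment] at hd
  rcases hd with hd | hd | hd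
  · exact hn.1 (hp.inj _ h' _ h' d (by simp) a (by simp) hd).symm
  · exact hbd (hp.inj _ h' _ h d (by simp) b (by simp) hd).symm
  · rcases hp.edge_eq hT ho h h' hd (right_mem_segment ℝ _ _) with ⟨-, h1⟩ | ⟨h1, -⟩
    · exact hbd h1
    · exact hn.1 h1

theorem face_contract_left (hT : IsSphere T) (huv : u ≠ v) {a b : α} (ha : a ≠ v) (hb : b ≠ v)
    (h : Face T u a b) : Face (contract T u v) u a b := by
  obtain ⟨h1, h2, h3⟩ := hT.ne h
  have := face_moveTo (u := u) (v := v) hT h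
  rw [moveTo_of_ne huv, moveTo_of_ne ha, moveTo_of_ne hb] at this
  exact this h1 h2 h3

theorem face_contract_right (hT : IsSphere T) {a b : α} (ha : a ≠ u) (hb : b ≠ u)
    (h : Face T v a b) : Face (contract T u v) u a b := by
  obtain ⟨h1, h2, h3⟩ := hT.ne h
  have := face_moveTo (u := u) (v := v) hT h
  rw [moveTo_self, moveTo_of_ne h1.symm, moveTo_of_ne h3.symm] at this
  exact this ha.symm h2 hb.symm

/-- The direction in which `v` is moved away from `u` to undo the contraction. -/
theorem IsContractible.exists_direction (hT : IsSphere T) (h : IsContractible T u v x y)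
    (ho : o ∈ contract T u v) (hp : Realizes (contract T u v) o p) {a₀ a₁ : α}
    (h0 : Face T u x a₀) (h0v : a₀ ≠ v) (h1 : Face T u y a₁) (h1v : a₁ ≠ v) :
    ∃ d, orient (p u) (p x) (p u + d) * signedArea p o u x a₀ < 0 ∧
      orient (p u) (p y) (p u + d) * signedArea p o u y a₁ < 0 ∧
      orient (p u) (p x) (p u + d) * orient (p u) (p y) (p u + d) < 0 := by
  have huv := (hT.ne h.left).1
  have hT' := h.isSphere_contract hT
  have hxv := (hT.ne h.left).2.1.symm
  have hyv := (hT.ne h.right).2.1.symm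
  have f0 := face_contract_left hT huv hxv h0v h0
  have f1 := face_contract_left hT huv hyv h1v h1
  -- Signs alternate across the edges at `u`, so the triangles at the two ends of the cut star lie
  -- on opposite sides as seen from `u x` and `u y`. This makes the two conditions on `d`
  -- compatible, up to replacing `d` by `-d`.
  have key := h.add_eq_zero hT (M := ℤ) (fun a b => SignType.sign (signedArea p o u a b))
    (fun a b => by
      rw [signedArea_swap_right p o u a b, Left.sign_neg]
      simp)
    (fun a b c ha hb hc hab hac hbc => sign_mul_sign_of_mul_neg (hp.neg _ _ _ _
      (face_contract_left hT huv ha hb hab) (face_contract_left hT huv ha hc hac) hbc))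
    h0 h0v h1 h1v
  have hne : ∀ {a b}, Face (contract T u v) u a b → signedArea p o u a b ≠ 0 := by
    intro a b hf h0
    obtain ⟨d, hd, hd'⟩ := hT'.exists_ne _ _ _ hf
    have := hp.neg _ _ _ _ hf hd' hd.symm
    simp [h0] at this
  obtain ⟨d, hd0, hd1⟩ := exists_orient_neg_pos
    (hp.vertex_notMem_segment hT' ho f1 f0 h.ne.symm) (hp.vertex_notMem_segment hT' ho f0 f1 h.ne)
  have e0 := hne f0
  have e1 := hne f1
  generalize signedArea p o u x a₀ = s₀ at *
  generalize signedArea p o u y a₁ = s₁ at *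
  rcases e0.lt_or_gt with e0 | e0 <;> rcases e1.lt_or_gt with e1 | e1
  · simp [sign_neg e0, sign_neg e1] at key
  · refine ⟨-d, ?_, ?_, ?_⟩ <;> simp only [orient_add_neg] <;> nlinarith
  · exact ⟨d, by nlinarith, by nlinarith, by nlinarith⟩
  · simp [sign_pos e0, sign_pos e1] at key

end SimplicialMulticomplex

/-! ### Undoing a contraction by a small displacement. -/

namespace SimplicialMulticomplex

open EuclideanPlane Filter Topology

variable {α : Type*} [DecidableEq α] {T : Finset (Finset α)} {o : Finset α} {u v x y : α}
  {p : α → EuclideanPlane}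

theorem image_moveTo_of_notMem {S : Finset α} (hv : v ∉ S) : S.image (moveTo u v) = S := by
  ext a
  rw [Finset.mem_image]
  constructor
  · rintro ⟨b, hb, rfl⟩
    rwa [moveTo_of_ne fun he : b = v => hv (he ▸ hb)]
  · exact fun ha => ⟨a, ha, moveTo_of_ne fun he => hv (he ▸ ha)⟩

theorem mem_contract_of_notMem (hT : IsSphere T) {S : Finset α} (hS : S ∈ T) (hv : v ∉ S) :
    S ∈ contract T u v :=
  Finset.mem_filter.2 ⟨Finset.mem_image.2 ⟨S, hS, image_moveTo_of_notMem hv⟩, hT.card_eq S hS⟩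

/-- The positions in which `v` is placed near `u`. -/
noncomputable def expand (p : α → EuclideanPlane) (u v : α) (d : EuclideanPlane) (ε : ℝ) (a : α) :
    EuclideanPlane :=
  if a = v then p u + ε • d else p a

theorem expand_of_ne {d : EuclideanPlane} {ε : ℝ} {a : α} (h : a ≠ v) :
    expand p u v d ε a = p a := if_neg h

theorem expand_self {d : EuclideanPlane} {ε : ℝ} : expand p u v d ε v = p u + ε • d := if_pos rfl

theorem continuous_expand (p : α → EuclideanPlane) (u v : α) (d : EuclideanPlane) (a : α) :
    Continuous fun ε => expand p u v d ε a := by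
  unfold expand
  split_ifs <;> fun_prop

theorem continuous_signedArea_expand (p : α → EuclideanPlane) (u v : α) (d : EuclideanPlane)
    (o : Finset α) (a b c : α) : Continuous fun ε => signedArea (expand p u v d ε) o a b c :=
  continuous_const.mul (continuous_orient (continuous_expand ..) (continuous_expand ..)
    (continuous_expand ..))

theorem expand_zero (p : α → EuclideanPlane) (u v : α) (d : EuclideanPlane) (a : α) :
    expand p u v d 0 a = p (moveTo u v a) := by
  unfold expand moveTo
  split_ifs <;> simp

/-- At `ε = 0` the positions are those of the contraction. The sign factor agrees too, because by
`excl` no triangle at `v` is moved onto `o`. -/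
theorem IsContractible.signedArea_expand_zero (hT : IsSphere T) (h : IsContractible T u v x y)
    (ho : o ∈ T) (hv : v ∉ o) (d : EuclideanPlane) {a b c : α} (hf : Face T a b c) :
    signedArea (expand p u v d 0) o a b c =
      signedArea p o (moveTo u v a) (moveTo u v b) (moveTo u v c) := by
  have : ({a, b, c} : Finset α) = o ↔
      ({moveTo u v a, moveTo u v b, moveTo u v c} : Finset α) = o := by
    rw [← image_triple]
    by_cases hvm : v ∈ ({a, b, c} : Finset α)
    · refine iff_of_false (fun he => hv (he ▸ hvm)) fun he => ?_
      obtain ⟨e, f, hef⟩ := triple_of_mem_one (hT.card_eq _ hf) hvm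
      have hf' : Face T v e f := by rw [Face, ← hef]; exact hf
      obtain ⟨h1, h2, h3⟩ := hT.ne hf'
      rw [hef, image_triple, moveTo_self, moveTo_of_ne h1.symm, moveTo_of_ne h3.symm] at he
      exact h.excl e f (by rw [Face, he]; exact ho) hf'
    · rw [image_moveTo_of_notMem hvm]
  simp only [signedArea, expand_zero, this]

theorem signedArea_expand_edge (huv : u ≠ v) (hv : v ∉ o) (d : EuclideanPlane) (ε : ℝ) {z : α}
    (hz : z ≠ v) : signedArea (expand p u v d ε) o u v z = -(ε * orient (p u) (p z) (p u + d)) := by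
  rw [signedArea, if_neg fun he : ({u, v, z} : Finset α) = o => hv (by rw [← he]; simp), expand_of_ne huv, expand_self,
    expand_of_ne hz]
  simp only [orient, PiLp.add_apply, PiLp.smul_apply, smul_eq_mul]
  ring

theorem signedArea_expand_of_ne {d : EuclideanPlane} {ε : ℝ} {a b c : α} (ha : a ≠ v) (hb : b ≠ v)
    (hc : c ≠ v) : signedArea (expand p u v d ε) o a b c = signedArea p o a b c := by
  rw [signedArea, signedArea, expand_of_ne ha, expand_of_ne hb, expand_of_ne hc]

/-- The area of a collapsed triangle is linear in `ε`, so its sign is that of the slope. The three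
cases below are its sides `u v`, `u z` and `v z`. -/
theorem IsContractible.eventually_neg_of_edge (hT : IsSphere T) (h : IsContractible T u v x y)
    (ho : o ∈ T) (hv : v ∉ o) (hp : Realizes (contract T u v) o p) {d : EuclideanPlane}
    (hE : ∀ z a, Face T u v z → Face T u z a → a ≠ v →
      orient (p u) (p z) (p u + d) * signedArea p o u z a < 0)
    (hEE : ∀ z z', Face T u v z → Face T u v z' → z ≠ z' →
      orient (p u) (p z) (p u + d) * orient (p u) (p z') (p u + d) < 0)
    {a b c e z : α} (hc : Face T a b c) (he : Face T a b e) (hce : c ≠ e)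
    (hz : ({a, b, c} : Finset α) = {u, v, z}) :
    ∀ᶠ ε in 𝓝[>] (0 : ℝ), signedArea (expand p u v d ε) o a b c *
      signedArea (expand p u v d ε) o a b e < 0 := by
  have huv := (hT.ne h.left).1
  have hzT : Face T u v z := by rw [Face, ← hz]; exact hc
  obtain ⟨-, hvz, huz⟩ := hT.ne hzT
  have hpos : ∀ᶠ ε in 𝓝[>] (0 : ℝ), 0 < ε := self_mem_nhdsWithin
  have h1 : ∀ e, Face T u v e → z ≠ e → ∀ᶠ ε in 𝓝[>] (0 : ℝ),
      signedArea (expand p u v d ε) o u v z * signedArea (expand p u v d ε) o u v e < 0 := by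
    intro e he hze
    filter_upwards [hpos] with ε hε
    rw [signedArea_expand_edge huv hv _ _ hvz.symm,
      signedArea_expand_edge huv hv _ _ (hT.ne he).2.1.symm]
    have := hEE z e hzT he hze
    have := mul_neg_of_pos_of_neg (mul_pos hε hε) this
    linarith
  have h2 : ∀ e, Face T u z e → v ≠ e → ∀ᶠ ε in 𝓝[>] (0 : ℝ),
      signedArea (expand p u v d ε) o u z v * signedArea (expand p u v d ε) o u z e < 0 := by
    intro e he hve
    filter_upwards [hpos] with ε hε
    rw [signedArea_swap_right, signedArea_expand_edge huv hv _ _ hvz.symm,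
      signedArea_expand_of_ne huv hvz.symm hve.symm]
    have := mul_neg_of_pos_of_neg hε (hE z e hzT he hve.symm)
    linarith
  have h3 : ∀ e, Face T v z e → u ≠ e → ∀ᶠ ε in 𝓝[>] (0 : ℝ),
      signedArea (expand p u v d ε) o v z u * signedArea (expand p u v d ε) o v z e < 0 := by
    intro e he hue
    obtain ⟨a₀, h0v, h0⟩ := hT.exists_ne _ _ _ hzT.rotate.rotate.swap
    have hve := (hT.ne he).2.2
    have hlim : Tendsto (fun ε => signedArea (expand p u v d ε) o v z e) (𝓝[>] 0)
        (𝓝 (signedArea p o u z e)) := by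
      have := ((continuous_signedArea_expand p u v d o v z e).tendsto 0).mono_left
        (nhdsWithin_le_nhds (s := Set.Ioi 0))
      rwa [h.signedArea_expand_zero hT ho hv d he, moveTo_self, moveTo_of_ne hvz.symm,
        moveTo_of_ne hve.symm] at this
    -- In the contraction the triangles beyond `u z` and beyond `v z` become neighbours across `u
    -- z`, so the condition on `d` for the first determines the sign for the second.
    have hprod := hp.neg _ _ _ _ (face_contract_left hT huv hvz.symm h0v h0)
      (face_contract_right hT huz.symm hue.symm he) (fun hae => h.excl _ _ h0 (hae ▸ he))
    have hE0 := hE z a₀ hzT h0 h0v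
    have hEe : 0 < orient (p u) (p z) (p u + d) * signedArea p o u z e := by
      rcases mul_neg_iff.1 hprod with ⟨h4, h5⟩ | ⟨h4, h5⟩ <;> nlinarith
    filter_upwards [hpos, (hlim.const_mul _).eventually (lt_mem_nhds hEe)] with ε hε hε'
    rw [signedArea_rotate _ _ u v z, signedArea_expand_edge huv hv _ _ hvz.symm]
    have := mul_pos hε hε'
    linarith
  have hswap : ∀ a b c e, (∀ᶠ ε in 𝓝[>] (0 : ℝ), signedArea (expand p u v d ε) o a b c *
      signedArea (expand p u v d ε) o a b e < 0) → ∀ᶠ ε in 𝓝[>] (0 : ℝ),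
      signedArea (expand p u v d ε) o b a c * signedArea (expand p u v d ε) o b a e < 0 := by
    intro a b c e hh
    simpa only [signedArea_swap _ o a b, neg_mul_neg] using hh
  rcases triple_perm hz (hT.card_eq _ hc) with ⟨rfl, rfl, rfl⟩ | ⟨rfl, rfl, rfl⟩ |
    ⟨rfl, rfl, rfl⟩ | ⟨rfl, rfl, rfl⟩ | ⟨rfl, rfl, rfl⟩ | ⟨rfl, rfl, rfl⟩
  · exact h1 _ he hce
  · exact h2 _ he hce
  · exact hswap _ _ _ _ (h1 _ he.swap hce)
  · exact h3 _ he hce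
  · exact hswap _ _ _ _ (h2 _ he.swap hce)
  · exact hswap _ _ _ _ (h3 _ he.swap hce)

/-- Only finitely many strict inequalities are needed. For two surviving triangles they hold at `ε =
0` and persist by continuity; those at collapsed triangles hold for small positive `ε` by the choice
of `d`. -/
theorem IsContractible.exists_realizes (hT : IsSphere T) (h : IsContractible T u v x y)
    (ho : o ∈ T) (hv : v ∉ o) (hp : Realizes (contract T u v) o p) : ∃ p', Realizes T o p' := by
  have huv := (hT.ne h.left).1
  have hoc := mem_contract_of_notMem (u := u) hT ho hv
  obtain ⟨a₀, h0v, h0⟩ := hT.exists_ne _ _ _ h.left.rotate.rotate.swap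
  obtain ⟨a₁, h1v, h1⟩ := hT.exists_ne _ _ _ h.right.rotate.rotate.swap
  obtain ⟨d, hd0, hd1, hd⟩ := h.exists_direction hT hoc hp h0 h0v h1 h1v
  have hE : ∀ z a, Face T u v z → Face T u z a → a ≠ v →
      orient (p u) (p z) (p u + d) * signedArea p o u z a < 0 := by
    intro z a hz ha hav
    rcases h.eq_or_eq hT hz with rfl | rfl
    · rwa [hT.eq_of_ne u z v a a₀ hz.swap.rotate ha h0 hav.symm h0v.symm]
    · rwa [hT.eq_of_ne u z v a a₁ hz.swap.rotate ha h1 hav.symm h1v.symm]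
  have hEE : ∀ z z', Face T u v z → Face T u v z' → z ≠ z' →
      orient (p u) (p z) (p u + d) * orient (p u) (p z') (p u + d) < 0 := by
    intro z z' hz hz' hne
    rcases h.eq_or_eq hT hz with rfl | rfl <;> rcases h.eq_or_eq hT hz' with rfl | rfl
    · exact absurd rfl hne
    · exact hd
    · rwa [mul_comm]
    · exact absurd rfl hne
  have hdne : d ≠ 0 := by
    rintro rfl
    rw [add_zero, orient_self_left, zero_mul] at hd
    exact lt_irrefl _ hd
  -- Restricting to the finite vertex set allows the conditions to be imposed simultaneously for one
  -- small `ε`.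
  set W := T.biUnion id with hW
  have hmemW : ∀ {a b c}, Face T a b c → a ∈ W := fun hf =>
    Finset.mem_biUnion.2 ⟨_, hf, by simp⟩
  have hneg : ∀ᶠ ε in 𝓝[>] (0 : ℝ), ∀ a ∈ W, ∀ b ∈ W, ∀ c ∈ W, ∀ e ∈ W, Face T a b c →
      Face T a b e → c ≠ e → signedArea (expand p u v d ε) o a b c *
        signedArea (expand p u v d ε) o a b e < 0 := by
    simp only [eventually_all_finset]
    intro a _ b _ c _ e _
    by_cases hc : Face T a b c
    swap
    · exact .of_forall fun _ hf => absurd hf hc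
    by_cases he : Face T a b e
    swap
    · exact .of_forall fun _ _ hf => absurd hf he
    by_cases hce : c = e
    · exact .of_forall fun _ _ _ hf => absurd hce hf
    suffices ∀ᶠ ε in 𝓝[>] (0 : ℝ), signedArea (expand p u v d ε) o a b c *
        signedArea (expand p u v d ε) o a b e < 0 from this.mono fun _ h _ _ _ => h
    by_cases hm : u ∈ ({a, b, c} : Finset α) ∧ v ∈ ({a, b, c} : Finset α)
    · obtain ⟨z, hz⟩ := triple_of_mem (hT.card_eq _ hc) hm.1 hm.2 huv
      exact h.eventually_neg_of_edge hT ho hv hp hE hEE hc he hce hz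
    by_cases hm' : u ∈ ({a, b, e} : Finset α) ∧ v ∈ ({a, b, e} : Finset α)
    · obtain ⟨z, hz⟩ := triple_of_mem (hT.card_eq _ he) hm'.1 hm'.2 huv
      simp only [mul_comm (signedArea _ o a b c)]
      exact h.eventually_neg_of_edge hT ho hv hp hE hEE he hc (Ne.symm hce) hz
    have hlim := (((continuous_signedArea_expand p u v d o a b c).mul
      (continuous_signedArea_expand p u v d o a b e)).tendsto 0).mono_left
        (nhdsWithin_le_nhds (s := Set.Ioi 0))
    refine hlim.eventually (gt_mem_nhds ?_)
    rw [Pi.mul_apply, h.signedArea_expand_zero hT ho hv d hc, h.signedArea_expand_zero hT ho hv d he]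
    have hfc := (face_contract_or hT huv hc).resolve_right fun ⟨z, hz⟩ =>
      hm (by rw [hz]; simp)
    have hfe := (face_contract_or hT huv he).resolve_right fun ⟨z, hz⟩ =>
      hm' (by rw [hz]; simp)
    refine hp.neg _ _ _ _ hfc hfe fun hr => ?_
    rcases moveTo_eq_iff.1 hr with hr | ⟨rfl, rfl⟩ | ⟨rfl, rfl⟩
    · exact hce hr
    · exact h.excl _ _ hc.rotate.rotate he.rotate.rotate
    · exact h.excl _ _ he.rotate.rotate hc.rotate.rotate
  have hcon : ∀ a ∈ W, a ≠ v → ∃ S ∈ contract T u v, a ∈ S := by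
    intro a ha hav
    obtain ⟨S, hS, haS⟩ := Finset.mem_biUnion.1 ha
    obtain ⟨b, c, rfl⟩ := triple_of_mem_one (hT.card_eq S hS) haS
    by_cases hau : a = u
    · subst hau
      exact ⟨_, face_contract_left hT huv (hT.ne h.left).2.1.symm h0v h0, by simp⟩
    rcases face_contract_or hT huv hS with hf | ⟨z, hz⟩
    · refine ⟨_, hf, ?_⟩
      rw [moveTo_of_ne hav]
      simp
    · have haz : a = z := by
        have : a ∈ ({a, b, c} : Finset α) := by simp
        rw [hz] at this
        simpa [hau, hav] using this
      subst haz
      have hzT : Face T u v a := by rw [Face, ← hz]; exact hS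
      rcases h.eq_or_eq hT hzT with rfl | rfl
      · exact ⟨_, face_contract_left hT huv hav h0v h0, by simp⟩
      · exact ⟨_, face_contract_left hT huv hav h1v h1, by simp⟩
  have hinj : ∀ᶠ ε in 𝓝[>] (0 : ℝ), ∀ a ∈ W, a ≠ v → p u + ε • d ≠ p a := by
    simp only [eventually_all_finset]
    intro a ha
    by_cases hav : a = v
    · exact .of_forall fun _ hf => absurd hav hf
    suffices ∀ᶠ ε in 𝓝[>] (0 : ℝ), p u + ε • d ≠ p a from this.mono fun _ h _ => h
    by_cases hau : a = u
    · subst hau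
      filter_upwards [self_mem_nhdsWithin] with ε hε
      simpa using ⟨(ne_of_gt hε : ε ≠ 0), hdne⟩
    · have hcont : Continuous fun ε : ℝ => p u + ε • d := by fun_prop
      refine ((hcont.tendsto 0).mono_left nhdsWithin_le_nhds).eventually_ne ?_
      rw [zero_smul, add_zero]
      intro he
      obtain ⟨S, hS, haS⟩ := hcon a ha hav
      have hfu := face_contract_left hT huv (hT.ne h.left).2.1.symm h0v h0
      exact hau (hp.inj _ hfu S hS u (by simp) a haS he).symm
  obtain ⟨ε, hε, hε'⟩ := (hneg.and hinj).exists
  refine ⟨expand p u v d ε, fun a b c e hc he hce => ?_, fun S hS S' hS' a ha b hb hab => ?_⟩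
  · exact hε a (hmemW hc) b (hmemW hc.swap) c (hmemW hc.rotate.rotate) e (hmemW he.rotate.rotate)
      hc he hce
  · have haW : a ∈ W := Finset.mem_biUnion.2 ⟨S, hS, ha⟩
    have hbW : b ∈ W := Finset.mem_biUnion.2 ⟨S', hS', hb⟩
    by_cases hav : a = v <;> by_cases hbv : b = v
    · rw [hav, hbv]
    · rw [hav, expand_self, expand_of_ne hbv] at hab
      exact absurd hab (hε' b hbW hbv)
    · rw [hbv, expand_self, expand_of_ne hav] at hab
      exact absurd hab.symm (hε' a haW hav)
    · rw [expand_of_ne hav, expand_of_ne hbv] at hab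
      obtain ⟨S₁, hS₁, h₁⟩ := hcon a haW hav
      obtain ⟨S₂, hS₂, h₂⟩ := hcon b hbW hbv
      exact hp.inj S₁ hS₁ S₂ hS₂ a h₁ b h₂ hab

end SimplicialMulticomplex

/-! ### The tetrahedron and the induction. -/

namespace SimplicialMulticomplex

open EuclideanPlane

variable {α : Type*} [DecidableEq α] {T : Finset (Finset α)} {o : Finset α} {u v a b : α}

theorem eq_insert_erase_of_subset {S W : Finset α} (hS : S ⊆ W) (hc : W.card = S.card + 1) :
    ∃ w ∈ W, w ∉ S ∧ S = W.erase w := by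
  obtain ⟨w, hw, hwS⟩ := Finset.exists_mem_notMem_of_card_lt_card (s := S) (t := W) (by omega)
  refine ⟨w, hw, hwS, Finset.eq_of_subset_of_card_le (fun z hz => Finset.mem_erase.2
    ⟨fun he => hwS (he ▸ hz), hS hz⟩) ?_⟩
  rw [Finset.card_erase_of_mem hw]
  omega

/-- In the boundary of the tetrahedron every edge already has its two triangles, so this family is
closed in `T` and strong connectivity makes it all of `T`. -/
theorem IsSphere.eq_powersetCard (hT : IsSphere T) (h1 : Face T u a b) (h2 : Face T v a b)
    (h3 : Face T u v a) (h4 : Face T u v b) : T = Finset.powersetCard 3 {u, v, a, b} := by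
  obtain ⟨hua, hab, hub⟩ := hT.ne h1
  obtain ⟨hva, -, hvb⟩ := hT.ne h2
  have huv := (hT.ne h3).1
  have hW : ({u, v, a, b} : Finset α).card = 4 := by
    rw [Finset.card_insert_of_notMem, Finset.card_insert_of_notMem, Finset.card_pair hab] <;>
    simp [*]
  have hsub : Finset.powersetCard 3 {u, v, a, b} ⊆ T := by
    intro S hS
    obtain ⟨hS, hS3⟩ := Finset.mem_powersetCard.1 hS
    obtain ⟨w, hw, -, rfl⟩ := eq_insert_erase_of_subset hS (by rw [hW, hS3])
    simp only [Finset.mem_insert, Finset.mem_singleton] at hw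
    rcases hw with rfl | rfl | rfl | rfl
    · convert h2 using 1; ext z; simp; grind
    · convert h1 using 1; ext z; simp; grind
    · convert h4 using 1; ext z; simp; grind
    · convert h3 using 1; ext z; simp; grind
  refine (hT.eq_of_closed _ hsub ⟨{u, a, b}, Finset.mem_powersetCard.2
    ⟨by intro z; simp; grind, hT.card_eq _ h1⟩⟩ ?_).symm
  intro p q r s hr hs
  have hrT : Face T p q r := hsub hr
  obtain ⟨hpq, hqr, hpr⟩ := hT.ne hrT
  obtain ⟨hrW, hr3⟩ := Finset.mem_powersetCard.1 hr
  obtain ⟨w, hw, hwS, -⟩ := eq_insert_erase_of_subset hrW (by rw [hW, hr3])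
  simp only [Finset.mem_insert, Finset.mem_singleton, not_or] at hwS
  have hw' : Face (Finset.powersetCard 3 {u, v, a, b}) p q w := by
    refine Finset.mem_powersetCard.2 ⟨?_, Finset.card_eq_three.2
      ⟨p, q, w, hpq, Ne.symm hwS.1, Ne.symm hwS.2.1, rfl⟩⟩
    intro z hz
    simp only [Finset.mem_insert, Finset.mem_singleton] at hz
    rcases hz with rfl | rfl | rfl
    · exact hrW (by simp)
    · exact hrW (by simp)
    · exact hw
  by_cases hrs : r = s
  · exact hrs ▸ hr
  · rwa [hT.eq_of_ne _ _ _ _ _ hrT hs (hsub hw') hrs (Ne.symm hwS.2.2)]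

/-- The boundary of a tetrahedron has a realization. -/
theorem exists_realizes_powersetCard (h4 : ({u, v, a, b} : Finset α).card = 4) :
    ∃ p, Realizes (Finset.powersetCard 3 {u, v, a, b}) {u, a, b} p := by
  have hne : u ≠ v ∧ u ≠ a ∧ u ≠ b ∧ v ≠ a ∧ v ≠ b ∧ a ≠ b := by
    refine ⟨?_, ?_, ?_, ?_, ?_, ?_⟩ <;> rintro rfl <;> revert h4 <;> simp <;>
    refine ne_of_lt (lt_of_le_of_lt Finset.card_le_three (by norm_num))
  obtain ⟨huv, hua, hub, hva, hvb, hab⟩ := hne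
  -- The vertex `v` is placed inside the outer triangle `u a b`.
  set p : α → EuclideanPlane := fun z => if z = u then !₂[0, 0] else if z = a then !₂[1, 0] else
    if z = b then !₂[0, 1] else !₂[1 / 4, 1 / 4] with hp
  have pu : p u = !₂[0, 0] := if_pos rfl
  have pa : p a = !₂[1, 0] := by simp [hp, hua.symm]
  have pb : p b = !₂[0, 1] := by simp [hp, hub.symm, hab.symm]
  have pv : p v = !₂[1 / 4, 1 / 4] := by simp [hp, huv.symm, hva, hvb]
  refine ⟨p, fun x y z w hz hw hzw => ?_, fun S hS S' hS' x hx y hy hxy => ?_⟩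
  · have hall : ∀ x y z : α, signedArea p {u, a, b} y z x = signedArea p {u, a, b} x y z ∧
        signedArea p {u, a, b} y x z = -signedArea p {u, a, b} x y z := fun x y z =>
      ⟨signedArea_rotate .., signedArea_swap ..⟩
    have s1 : signedArea p {u, a, b} u a b = -1 := by
      rw [signedArea, if_pos rfl, pu, pa, pb]
      simp [orient]
    have hvo : ∀ x y, ({x, y, v} : Finset α) ≠ {u, a, b} := by
      intro x y he
      have : v ∈ ({u, a, b} : Finset α) := by rw [← he]; simp
      simp [huv.symm, hva, hvb] at this
    have s2 : signedArea p {u, a, b} u a v = 1 / 4 := by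
      rw [signedArea, if_neg (hvo _ _), pu, pa, pv]
      norm_num [orient]
    have s3 : signedArea p {u, a, b} a b v = 1 / 2 := by
      rw [signedArea, if_neg (hvo _ _), pa, pb, pv]
      norm_num [orient]
    have s4 : signedArea p {u, a, b} b u v = 1 / 4 := by
      rw [signedArea, if_neg (hvo _ _), pb, pu, pv]
      norm_num [orient]
    have hperm : ∀ {x y z : α} {k : ℝ}, signedArea p {u, a, b} x y z = k →
        signedArea p {u, a, b} y z x = k ∧ signedArea p {u, a, b} z x y = k ∧
        signedArea p {u, a, b} y x z = -k ∧ signedArea p {u, a, b} z y x = -k ∧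
        signedArea p {u, a, b} x z y = -k := by
      rintro x y z _ rfl
      exact ⟨signedArea_rotate .., (signedArea_rotate _ _ z x y).symm, signedArea_swap ..,
        by rw [signedArea_swap, signedArea_rotate], signedArea_swap_right ..⟩
    obtain ⟨s11, s12, s13, s14, s15⟩ := hperm s1
    obtain ⟨s21, s22, s23, s24, s25⟩ := hperm s2
    obtain ⟨s31, s32, s33, s34, s35⟩ := hperm s3
    obtain ⟨s41, s42, s43, s44, s45⟩ := hperm s4
    obtain ⟨hzW, hz3⟩ := Finset.mem_powersetCard.1 hz
    obtain ⟨hwW, hw3⟩ := Finset.mem_powersetCard.1 hw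
    obtain ⟨hxy, hyz, hxz⟩ := triple_ne hz3
    obtain ⟨-, hyw, hxw⟩ := triple_ne hw3
    have hx : x ∈ ({u, v, a, b} : Finset α) := hzW (by simp)
    have hy : y ∈ ({u, v, a, b} : Finset α) := hzW (by simp)
    have hz : z ∈ ({u, v, a, b} : Finset α) := hzW (by simp)
    have hw : w ∈ ({u, v, a, b} : Finset α) := hwW (by simp)
    simp only [Finset.mem_insert, Finset.mem_singleton] at hx hy hz hw
    clear hall hvo hperm hzW hwW hz3 hw3 h4 pu pa pb pv hp
    clear_value p
    rcases hx with rfl | rfl | rfl | rfl <;> rcases hy with rfl | rfl | rfl | rfl <;>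
    first
    | exact absurd rfl hxy
    | rcases hz with rfl | rfl | rfl | rfl <;>
      first
      | exact absurd rfl hxz
      | exact absurd rfl hyz
      | rcases hw with rfl | rfl | rfl | rfl <;>
        first
        | exact absurd rfl hxw
        | exact absurd rfl hyw
        | exact absurd rfl hzw
        | simp only [*]; norm_num
  · have hx' := (Finset.mem_powersetCard.1 hS).1 hx
    have hy' := (Finset.mem_powersetCard.1 hS').1 hy
    simp only [Finset.mem_insert, Finset.mem_singleton] at hx' hy'
    have h0 := congrArg (fun q : EuclideanPlane => q 0) hxy
    have h1 := congrArg (fun q : EuclideanPlane => q 1) hxy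
    rcases hx' with rfl | rfl | rfl | rfl <;> rcases hy' with rfl | rfl | rfl | rfl <;>
    first
    | rfl
    | have h01 := And.intro h0 h1
      norm_num [pu, pa, pb, pv] at h01

theorem IsSphere.exists_realizes (hT : IsSphere T) (ho : o ∈ T) : ∃ p, Realizes T o p := by
  induction hn : T.card using Nat.strong_induction_on generalizing T o with
  | _ n ih =>
  subst hn
  obtain ⟨u, b, c, rfl⟩ := exists_triple (hT.card_eq o ho)
  -- Since `v` is not in `o`, contracting `u v` to `u` keeps `o` a member, and moving `v` back does
  -- not disturb the outer triangle.
  obtain ⟨v, hvc, hv⟩ := hT.exists_ne u b c ho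
  obtain ⟨hub, hbv, huv⟩ := hT.ne hv
  have hvo : v ∉ ({u, b, c} : Finset α) := by simp [huv.symm, hbv.symm, hvc]
  have hf : Face T u v b := hv.swap.rotate
  by_cases hcommon : ∀ z c d, Face T u z c → Face T v z d → Face T u v z
  · by_cases hexcl : ∀ a b, Face T u a b → ¬Face T v a b
    · obtain ⟨y, hy, hfy⟩ := hT.exists_ne _ _ _ hf
      have hC : IsContractible T u v b y := ⟨hf, hfy, hy.symm, hcommon, hexcl⟩
      obtain ⟨p, hp⟩ := ih _ (contract_card_lt hT hf) (hC.isSphere_contract hT)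
        (mem_contract_of_notMem (u := u) hT ho hvo) rfl
      exact hC.exists_realizes hT ho hvo hp
    · push Not at hexcl
      obtain ⟨a', b', h1, h2⟩ := hexcl
      -- The ends `a'`, `b'` of an edge opposite to both `u` and `v` are common neighbours, so all
      -- four triangles on these vertices are members.
      have hK := hT.eq_powersetCard h1 h2 (hcommon _ _ _ h1 h2)
        (hcommon _ _ _ h1.swap.rotate h2.swap.rotate)
      obtain ⟨hua', hab', hub'⟩ := hT.ne h1
      obtain ⟨hva', -, hvb'⟩ := hT.ne h2
      have h4 : ({u, v, a', b'} : Finset α).card = 4 := by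
        rw [Finset.card_insert_of_notMem, Finset.card_insert_of_notMem, Finset.card_pair hab'] <;>
        simp [*]
      have hoe : ({u, b, c} : Finset α) = {u, a', b'} := by
        rw [hK] at ho
        obtain ⟨ho, ho3⟩ := Finset.mem_powersetCard.1 ho
        refine Finset.eq_of_subset_of_card_le (fun z hz => ?_) (by
          rw [ho3]; exact Finset.card_le_three)
        have := ho hz
        simp only [Finset.mem_insert, Finset.mem_singleton] at this ⊢
        rcases this with h | h | h | h
        · exact Or.inl h
        · exact absurd (h ▸ hz) hvo
        · exact Or.inr (Or.inl h)
        · exact Or.inr (Or.inr h)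
      rw [hoe, hK]
      exact exists_realizes_powersetCard h4
  · push Not at hcommon
    obtain ⟨z, c', d', h1, h2, h3⟩ := hcommon
    have hK3 : ({u, v, z} : Finset α).card = 3 :=
      Finset.card_eq_three.2 ⟨u, v, z, huv, (hT.ne h1).1, (hT.ne h2).1, rfl⟩
    obtain ⟨A, hA⟩ := hT.exists_isSeparation hK3 hf h2 h1.swap h3
    -- The side containing `o` keeps `o` as its outer triangle; the other side is drawn with the
    -- separating triangle as outer one.
    have key : ∀ A, IsSeparation T A {u, v, z} → {u, b, c} ∈ A → ∃ p, Realizes T {u, b, c} p := by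
      intro A hA hoA
      obtain ⟨pA, hpA⟩ := ih _ (hA.card_lt hT) (hA.isSphere hT) (Finset.mem_insert_of_mem hoA) rfl
      obtain ⟨pB, hpB⟩ := ih _ (hA.compl.card_lt hT) (hA.compl.isSphere hT)
        (Finset.mem_insert_self _ _) rfl
      exact hA.exists_realizes hT hoA hpA hpB
    by_cases hoA : {u, b, c} ∈ A
    · exact key A hA hoA
    · exact key _ hA.compl (Finset.mem_sdiff.2 ⟨ho, hoA⟩)

end SimplicialMulticomplex

/-! ### Circuits with few edges are spheres -/

namespace SimplicialMulticomplex

variable {α : Type*} [DecidableEq α] {F : Finset (Finset α)}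

/-- The incidence matrix over `ℤ/2` of a relation. -/
def incidence {β γ : Type*} (X : Finset β) (Y : Finset γ) (R : β → γ → Prop) [DecidableRel R] :
    Matrix X Y (ZMod 2) :=
  Matrix.of fun x y => if R x y then 1 else 0

theorem incidence_mulVec {β γ : Type*} (X : Finset β) (Y : Finset γ) (R : β → γ → Prop)
    [DecidableRel R] (f : γ → ZMod 2) (x : X) :
    (incidence X Y R).mulVec (fun y => f y) x = ∑ y ∈ Y.filter (R x), f y := by
  simp only [Matrix.mulVec, dotProduct, incidence, Matrix.of_apply, ite_mul, one_mul, zero_mul,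
    Finset.sum_filter]
  exact Finset.sum_coe_sort Y fun y => if R x y then f y else 0

theorem exists_restrict_eq {β γ : Type*} [Zero γ] [DecidableEq β] (X : Finset β) (f : X → γ) :
    ∃ g : β → γ, f = fun x : X => g x :=
  ⟨fun b => if h : b ∈ X then f ⟨b, h⟩ else 0, by ext x; simp⟩

theorem finrank_le_one_of_forall_eq {β : Type*} [Fintype β] (K : Submodule (ZMod 2) (β → ZMod 2))
    (h : ∀ f ∈ K, ∀ x y, f x = f y) : Module.finrank (ZMod 2) K ≤ 1 := by
  have hle : K ≤ Submodule.span (ZMod 2) {fun _ => 1} := by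
    intro f hf
    rw [Submodule.mem_span_singleton]
    rcases isEmpty_or_nonempty β with hβ | ⟨⟨x⟩⟩
    · exact ⟨0, Subsingleton.elim _ _⟩
    · exact ⟨f x, by ext y; simp [h f hf x y]⟩
  exact (Submodule.finrank_mono hle).trans ((finrank_span_le_card _).trans (by simp))

/-- A family of triples that is a circuit: every pair lies in an even number of members, and no
smaller non-empty family has this property. -/
structure IsEvenCircuit (F : Finset (Finset α)) : Prop where
  card_eq : ∀ S ∈ F, S.card = 3
  nonempty : F.Nonempty
  even : ∀ e : Finset α, e.card = 2 → Even (F.filter (e ⊆ ·)).card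
  eq_of_even : ∀ U ⊆ F, U.Nonempty →
    (∀ e : Finset α, e.card = 2 → Even (U.filter (e ⊆ ·)).card) → U = F

/-- The set of vertices of a family of sets. -/
def vertexFinset (F : Finset (Finset α)) : Finset α := F.biUnion id

/-- The set of pairs that lie in some member of the family. -/
def edgeFinset (F : Finset (Finset α)) : Finset (Finset α) := F.biUnion (Finset.powersetCard 2)

theorem mem_vertexFinset {a : α} : a ∈ vertexFinset F ↔ ∃ S ∈ F, a ∈ S := by
  simp [vertexFinset]

theorem mem_edgeFinset {e : Finset α} : e ∈ edgeFinset F ↔ e.card = 2 ∧ ∃ S ∈ F, e ⊆ S := by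
  simp only [edgeFinset, Finset.mem_biUnion, Finset.mem_powersetCard]
  grind

/-- At each edge a closed subfamily contains all members of `F` or none, so it inherits evenness and
minimality applies. -/
theorem IsEvenCircuit.eq_of_closed (hF : IsEvenCircuit F) {U : Finset (Finset α)} (hU : U ⊆ F)
    (hne : U.Nonempty)
    (hcl : ∀ e : Finset α, e.card = 2 → ∀ S ∈ U, ∀ S' ∈ F, e ⊆ S → e ⊆ S' → S' ∈ U) : U = F := by
  refine hF.eq_of_even U hU hne fun e he => ?_
  by_cases h : ∃ S ∈ U, e ⊆ S
  · obtain ⟨S, hS, heS⟩ := h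
    have : U.filter (e ⊆ ·) = F.filter (e ⊆ ·) := by
      ext S'
      simp only [Finset.mem_filter, and_congr_left_iff]
      exact fun heS' => ⟨fun h => hU h, fun h => hcl e he S hS S' h heS heS'⟩
    rw [this]
    exact hF.even e he
  · rw [Finset.filter_eq_empty_iff.2 fun S hS heS => h ⟨S, hS, heS⟩]
    simp

theorem IsEvenCircuit.apply_eq_of_edge (hF : IsEvenCircuit F) {ψ : α → ZMod 2}
    (hψ : ∀ e ∈ edgeFinset F, ∑ a ∈ e, ψ a = 0) {a b : α} (ha : a ∈ vertexFinset F)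
    (hb : b ∈ vertexFinset F) : ψ a = ψ b := by
  have hS : ∀ S ∈ F, ∀ a ∈ S, ∀ b ∈ S, ψ a = ψ b := by
    intro S hS a ha b hb
    by_cases hab : a = b
    · rw [hab]
    have := hψ {a, b} (mem_edgeFinset.2 ⟨Finset.card_pair hab, S, hS, by
      simp [Finset.insert_subset_iff, ha, hb]⟩)
    rw [Finset.sum_pair hab] at this
    exact CharTwo.add_eq_zero.1 this
  obtain ⟨S, hSF, haS⟩ := mem_vertexFinset.1 ha
  obtain ⟨S', hSF', hbS⟩ := mem_vertexFinset.1 hb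
  have hU := hF.eq_of_closed (U := F.filter fun S => ∀ b ∈ S, ψ b = ψ a) (Finset.filter_subset _ _)
    ⟨S, Finset.mem_filter.2 ⟨hSF, fun b hb => hS S hSF b hb a haS⟩⟩ (by
      intro e he S₁ h₁ S₂ h₂ he₁ he₂
      obtain ⟨c, hc⟩ := Finset.card_pos.1 (by rw [he]; norm_num : 0 < e.card)
      refine Finset.mem_filter.2 ⟨h₂, fun b hb => ?_⟩
      rw [hS S₂ h₂ b hb c (he₂ hc)]
      exact (Finset.mem_filter.1 h₁).2 c (he₁ hc))
  rw [← hU] at hSF'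
  exact ((Finset.mem_filter.1 hSF').2 b hbS).symm

/-- The support of a chain without boundary is an even subfamily, so it is empty or all of `F`. -/
theorem IsEvenCircuit.apply_eq_of_boundary (hF : IsEvenCircuit F) {f : Finset α → ZMod 2}
    (hf : ∀ e ∈ edgeFinset F, ∑ S ∈ F.filter (e ⊆ ·), f S = 0) {S S' : Finset α} (hS : S ∈ F)
    (hS' : S' ∈ F) : f S = f S' := by
  have h01 : ∀ z : ZMod 2, z ≠ 0 → z = 1 := by decide
  by_cases hU : (F.filter fun S => f S ≠ 0).Nonempty
  · have := hF.eq_of_even _ (Finset.filter_subset _ _) hU (by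
      intro e he
      by_cases heE : e ∈ edgeFinset F
      · have h0 := hf e heE
        rw [← ZMod.natCast_eq_zero_iff_even, Finset.card_eq_sum_ones, Nat.cast_sum,
          Finset.filter_comm, Finset.sum_filter]
        refine Eq.trans ?_ h0
        refine Finset.sum_congr rfl fun S _ => ?_
        split_ifs with h
        · simp [h01 _ h]
        · exact (not_not.1 h).symm
      · rw [Finset.filter_eq_empty_iff.2 fun S hS heS => heE (mem_edgeFinset.2
          ⟨he, S, (Finset.mem_filter.1 hS).1, heS⟩)]
        simp)
    rw [← this] at hS hS'
    rw [h01 _ (Finset.mem_filter.1 hS).2, h01 _ (Finset.mem_filter.1 hS').2]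
  · rw [Finset.not_nonempty_iff_eq_empty, Finset.filter_eq_empty_iff] at hU
    rw [not_not.1 (hU hS), not_not.1 (hU hS')]

/-- By connectedness only constant functions on the vertices have zero coboundary; rank and nullity
then give the bound. -/
theorem IsEvenCircuit.card_vertexFinset_le (hF : IsEvenCircuit F) :
    (vertexFinset F).card ≤
      (incidence (edgeFinset F) (vertexFinset F) fun e a => a ∈ e).rank + 1 := by
  set M := incidence (edgeFinset F) (vertexFinset F) fun e a => a ∈ e with hM
  have h1 := M.mulVecLin.finrank_range_add_finrank_ker
  have h2 := finrank_le_one_of_forall_eq (LinearMap.ker M.mulVecLin) (by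
    intro f hf a b
    obtain ⟨ψ, rfl⟩ := exists_restrict_eq _ f
    refine hF.apply_eq_of_edge (fun e he => ?_) a.2 b.2
    have := congrFun (LinearMap.mem_ker.1 hf) ⟨e, he⟩
    rw [Matrix.mulVecLin_apply, hM, incidence_mulVec] at this
    refine Eq.trans ?_ this
    refine Finset.sum_congr ?_ fun _ _ => rfl
    obtain ⟨-, S, hS, heS⟩ := mem_edgeFinset.1 he
    ext a
    simp only [Finset.mem_filter]
    exact ⟨fun ha => ⟨mem_vertexFinset.2 ⟨S, hS, heS ha⟩, ha⟩, fun h => h.2⟩)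
  rw [Module.finrank_fintype_fun_eq_card, Fintype.card_coe] at h1
  rw [Matrix.rank]
  omega

theorem IsEvenCircuit.card_le (hF : IsEvenCircuit F) :
    F.card ≤ (incidence F (edgeFinset F) fun S e => e ⊆ S).rank + 1 := by
  set M := incidence F (edgeFinset F) fun S e => e ⊆ S with hM
  have hMt : M.transpose = incidence (edgeFinset F) F (fun e S => e ⊆ S) := rfl
  -- The transpose is the boundary map on chains of triples, whose kernel is controlled by
  -- minimality.
  rw [← Matrix.rank_transpose, hMt, Matrix.rank]
  clear hMt
  have h1 := (incidence (edgeFinset F) F (fun e S => e ⊆ S)).mulVecLin.finrank_range_add_finrank_ker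
  have h2 := finrank_le_one_of_forall_eq
      (LinearMap.ker (incidence (edgeFinset F) F (fun e S => e ⊆ S)).mulVecLin) (by
    intro f hf S S'
    obtain ⟨g, rfl⟩ := exists_restrict_eq _ f
    refine hF.apply_eq_of_boundary (fun e he => ?_) S.2 S'.2
    have := congrFun (LinearMap.mem_ker.1 hf) ⟨e, he⟩
    rwa [Matrix.mulVecLin_apply, incidence_mulVec] at this)
  rw [Module.finrank_fintype_fun_eq_card, Fintype.card_coe] at h1
  omega

theorem edgeFinset_filter_subset {S : Finset α} (hS : S ∈ F) :
    (edgeFinset F).filter (· ⊆ S) = Finset.powersetCard 2 S := by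
  ext e
  simp only [Finset.mem_filter, mem_edgeFinset, Finset.mem_powersetCard]
  exact ⟨fun h => ⟨h.2, h.1.1⟩, fun h => ⟨⟨h.2, S, hS, h.1⟩, h.1⟩⟩

theorem sum_powersetCard_two {M : Type*} [AddCommMonoid M] (f : Finset α → M) {a b c : α}
    (h : ({a, b, c} : Finset α).card = 3) :
    ∑ e ∈ Finset.powersetCard 2 {a, b, c}, f e = f {a, b} + f {b, c} + f {c, a} := by
  obtain ⟨h1, h2, h3⟩ := triple_ne h
  have h23 : ({b, c} : Finset α) ≠ {c, a} := fun he => by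
    have : b ∈ ({c, a} : Finset α) := by rw [← he]; simp
    simp [h2, h1.symm] at this
  have h12 : ({a, b} : Finset α) ≠ {b, c} := fun he => by
    have : a ∈ ({b, c} : Finset α) := by rw [← he]; simp
    simp [h1, h3] at this
  have h13 : ({a, b} : Finset α) ≠ {c, a} := fun he => by
    have : b ∈ ({c, a} : Finset α) := by rw [← he]; simp
    simp [h2, h1.symm] at this
  have : Finset.powersetCard 2 {a, b, c} = ({{a, b}, {b, c}, {c, a}} : Finset (Finset α)) := by
    symm
    refine Finset.eq_of_subset_of_card_le (fun e he => ?_) ?_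
    · simp only [Finset.mem_insert, Finset.mem_singleton] at he
      rw [Finset.mem_powersetCard]
      rcases he with rfl | rfl | rfl
      · exact ⟨by simp [Finset.insert_subset_iff], Finset.card_pair h1⟩
      · exact ⟨by simp, Finset.card_pair h2⟩
      · exact ⟨by simp [Finset.insert_subset_iff], Finset.card_pair h3.symm⟩
    · rw [Finset.card_powersetCard, h, Finset.card_eq_three.2 ⟨_, _, _, h12, h13, h23, rfl⟩]
      decide
  rw [this, Finset.sum_insert (by simp [h12, h13]), Finset.sum_pair h23, add_assoc]

theorem IsEvenCircuit.two_le (hF : IsEvenCircuit F) {e : Finset α} (he : e ∈ edgeFinset F) :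
    2 ≤ (F.filter (e ⊆ ·)).card := by
  obtain ⟨he2, S, hS, heS⟩ := mem_edgeFinset.1 he
  obtain ⟨k, hk⟩ := hF.even e he2
  have : 0 < (F.filter (e ⊆ ·)).card := Finset.card_pos.2 ⟨S, Finset.mem_filter.2 ⟨hS, heS⟩⟩
  omega

theorem IsEvenCircuit.three_mul_card (hF : IsEvenCircuit F) :
    3 * F.card = ∑ e ∈ edgeFinset F, (F.filter (e ⊆ ·)).card := by
  have := Finset.sum_card_bipartiteAbove_eq_sum_card_bipartiteBelow (s := F) (t := edgeFinset F)
    (fun S e => e ⊆ S)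
  simp only [Finset.bipartiteAbove, Finset.bipartiteBelow] at this
  rw [← this, Finset.sum_congr rfl fun S hS => by
    rw [edgeFinset_filter_subset hS, Finset.card_powersetCard, hF.card_eq S hS]]
  simp [Nat.choose, mul_comm]

/-- Every vertex of a triple lies in two of its three edges, so a coboundary sums to zero around the
triple. -/
theorem IsEvenCircuit.range_le_ker (hF : IsEvenCircuit F) :
    LinearMap.range (incidence (edgeFinset F) (vertexFinset F) fun e a => a ∈ e).mulVecLin ≤
      LinearMap.ker (incidence F (edgeFinset F) fun S e => e ⊆ S).mulVecLin := by
  rintro _ ⟨f, rfl⟩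
  obtain ⟨ψ, rfl⟩ := exists_restrict_eq _ f
  rw [LinearMap.mem_ker]
  have h1 : (incidence (edgeFinset F) (vertexFinset F) fun e a => a ∈ e).mulVecLin (fun a => ψ a) =
      fun e : edgeFinset F => ∑ a ∈ e.1, ψ a := by
    ext e
    rw [Matrix.mulVecLin_apply, incidence_mulVec]
    refine Finset.sum_congr ?_ fun _ _ => rfl
    obtain ⟨-, S, hS, heS⟩ := mem_edgeFinset.1 e.2
    ext a
    simp only [Finset.mem_filter]
    exact ⟨fun h => h.2, fun ha => ⟨mem_vertexFinset.2 ⟨S, hS, heS ha⟩, ha⟩⟩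
  rw [h1]
  ext S
  have := incidence_mulVec F (edgeFinset F) (fun S e => e ⊆ S) (fun e => ∑ a ∈ e, ψ a) S
  rw [Matrix.mulVecLin_apply, this, edgeFinset_filter_subset S.2]
  obtain ⟨a, b, c, hS⟩ := exists_triple (hF.card_eq S S.2)
  have h3 := hF.card_eq S S.2
  rw [hS] at h3 ⊢
  obtain ⟨hab, hbc, hac⟩ := triple_ne h3
  rw [sum_powersetCard_two _ h3, Finset.sum_pair hab, Finset.sum_pair hbc, Finset.sum_pair hac.symm]
  have h2 := CharTwo.two_eq_zero (R := ZMod 2)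
  simp only [Pi.zero_apply]
  linear_combination (ψ a + ψ b + ψ c) * h2

end SimplicialMulticomplex

/-! ### Equality in the rank count. -/

namespace SimplicialMulticomplex

variable {α : Type*} [DecidableEq α] {F : Finset (Finset α)}

/-- The rank bounds give F ≤ E - V + 2, which is 2E/3 by the edge count, while double counting gives
3F ≥ 2E. Hence every estimate used is an equality, both the degrees of the edges and the dimensions.
-/
theorem IsEvenCircuit.card_eq_and_ker_le (hF : IsEvenCircuit F)
    (hE : (edgeFinset F).card + 6 = 3 * (vertexFinset F).card) :
    (∀ e ∈ edgeFinset F, (F.filter (e ⊆ ·)).card = 2) ∧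
    LinearMap.ker (incidence F (edgeFinset F) fun S e => e ⊆ S).mulVecLin =
      LinearMap.range (incidence (edgeFinset F) (vertexFinset F) fun e a => a ∈ e).mulVecLin := by
  have h1 := hF.card_vertexFinset_le
  have h2 := hF.card_le
  have h3 := Submodule.finrank_mono hF.range_le_ker
  have h4 := (incidence F (edgeFinset F) fun S e => e ⊆ S).mulVecLin.finrank_range_add_finrank_ker
  rw [Module.finrank_fintype_fun_eq_card, Fintype.card_coe] at h4
  rw [Matrix.rank] at h1 h2
  have h5 := hF.three_mul_card
  have h6 : ∑ e ∈ edgeFinset F, 2 ≤ ∑ e ∈ edgeFinset F, (F.filter (e ⊆ ·)).card :=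
    Finset.sum_le_sum fun e he => hF.two_le he
  have h7 : ∑ e ∈ edgeFinset F, 2 = (edgeFinset F).card * 2 := by simp
  constructor
  · have h8 : ∑ e ∈ edgeFinset F, 2 = ∑ e ∈ edgeFinset F, (F.filter (e ⊆ ·)).card := by omega
    exact fun e he => ((Finset.sum_eq_sum_iff_of_le fun e he => hF.two_le he).1 h8 e he).symm
  · exact (Submodule.eq_of_le_of_finrank_le hF.range_le_ker (by omega)).symm

theorem exists_edge_function {φ : α → α → ZMod 2} (hs : ∀ a b, φ a b = φ b a) :
    ∃ f : Finset α → ZMod 2, ∀ a b, a ≠ b → f {a, b} = φ a b := by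
  classical
  have : ∀ e : Finset α, ∃ z, ∀ a b, a ≠ b → e = {a, b} → z = φ a b := by
    intro e
    by_cases he : e.card = 2
    · obtain ⟨a, b, hab, rfl⟩ := Finset.card_eq_two.1 he
      refine ⟨φ a b, fun c d hcd hc => ?_⟩
      have hc' : c ∈ ({a, b} : Finset α) := by rw [hc]; simp
      have hd' : d ∈ ({a, b} : Finset α) := by rw [hc]; simp
      simp only [Finset.mem_insert, Finset.mem_singleton] at hc' hd'
      rcases hc' with rfl | rfl <;> rcases hd' with rfl | rfl
      · exact absurd rfl hcd
      · rfl
      · exact hs _ _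
      · exact absurd rfl hcd
    · exact ⟨0, fun a b hab h => absurd (h ▸ Finset.card_pair hab) he⟩
  choose f hf using this
  exact ⟨f, fun a b hab => hf _ a b hab rfl⟩

/-- The degree equality gives the two triangles at each edge, minimality gives strong connectivity,
and the equality of kernel and range provides the potentials. -/
theorem IsEvenCircuit.isSphere (hF : IsEvenCircuit F)
    (hE : (edgeFinset F).card + 6 = 3 * (vertexFinset F).card) : IsSphere F := by
  obtain ⟨hdeg, hker⟩ := hF.card_eq_and_ker_le hE
  have hedge : ∀ {a b c}, Face F a b c → ({a, b} : Finset α) ∈ edgeFinset F := fun {a b c} hf =>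
    mem_edgeFinset.2 ⟨Finset.card_pair (triple_ne (hF.card_eq _ hf)).1, _, hf, by
      simp [Finset.insert_subset_iff]⟩
  have hmem : ∀ {a b c}, Face F a b c → ({a, b, c} : Finset α) ∈ F.filter ({a, b} ⊆ ·) :=
    fun {a b c} hf => Finset.mem_filter.2 ⟨hf, by simp [Finset.insert_subset_iff]⟩
  have htri : ∀ {a b c d}, Face F a b c → c ≠ d → ({a, b, c} : Finset α) ≠ {a, b, d} := by
    intro a b c d hf hcd he
    obtain ⟨h1, h2, h3⟩ := triple_ne (hF.card_eq _ hf)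
    have : c ∈ ({a, b, d} : Finset α) := by rw [← he]; simp
    simp [h2.symm, h3.symm, hcd] at this
  refine ⟨hF.card_eq, ?_, ?_, ?_, ?_⟩
  · intro a b c hf
    obtain ⟨S, hS, hne⟩ := Finset.exists_mem_ne (by rw [hdeg _ (hedge hf)]; norm_num)
      ({a, b, c} : Finset α)
    obtain ⟨hSF, hab⟩ := Finset.mem_filter.1 hS
    obtain ⟨d, rfl⟩ := triple_of_mem (hF.card_eq S hSF) (hab (by simp)) (hab (by simp))
      (triple_ne (hF.card_eq _ hf)).1
    exact ⟨d, fun h => hne (h ▸ rfl), hSF⟩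
  · intro a b c d e hc hd he hcd hce
    by_contra hde
    have hsub : ({{a, b, c}, {a, b, d}, {a, b, e}} : Finset (Finset α)) ⊆
        F.filter ({a, b} ⊆ ·) := by
      intro S hS
      simp only [Finset.mem_insert, Finset.mem_singleton] at hS
      rcases hS with rfl | rfl | rfl
      exacts [hmem hc, hmem hd, hmem he]
    have := Finset.card_le_card hsub
    rw [hdeg _ (hedge hc), Finset.card_eq_three.2
      ⟨_, _, _, htri hc hcd, htri hc hce, htri hd hde, rfl⟩] at this
    omega
  · intro U hU hne hcl
    refine hF.eq_of_closed hU hne fun e he S hS S' hS' heS heS' => ?_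
    obtain ⟨a, b, hab, rfl⟩ := Finset.card_eq_two.1 he
    obtain ⟨c, rfl⟩ := triple_of_mem (hF.card_eq S (hU hS)) (heS (by simp)) (heS (by simp)) hab
    obtain ⟨d, rfl⟩ := triple_of_mem (hF.card_eq S' hS') (heS' (by simp)) (heS' (by simp)) hab
    exact hcl a b c d hS hS'
  · intro φ hs hφ
    obtain ⟨f, hf⟩ := exists_edge_function hs
    have hfker : (fun e : edgeFinset F => f e) ∈
        LinearMap.ker (incidence F (edgeFinset F) fun S e => e ⊆ S).mulVecLin := by
      rw [LinearMap.mem_ker]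
      ext S
      rw [Matrix.mulVecLin_apply, incidence_mulVec F (edgeFinset F) (fun S e => e ⊆ S) f S,
        edgeFinset_filter_subset S.2]
      obtain ⟨a, b, c, hS⟩ := exists_triple (hF.card_eq S S.2)
      have h3 := hF.card_eq S S.2
      have hSF := S.2
      rw [hS] at h3 hSF ⊢
      obtain ⟨hab, hbc, hac⟩ := triple_ne h3
      rw [sum_powersetCard_two _ h3, hf _ _ hab, hf _ _ hbc, hf _ _ hac.symm]
      exact hφ a b c hSF
    rw [hker] at hfker
    obtain ⟨g, hg⟩ := hfker
    obtain ⟨ψ, rfl⟩ := exists_restrict_eq _ g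
    refine ⟨ψ, fun a b c habc => ?_⟩
    have hab := (triple_ne (hF.card_eq _ habc)).1
    have := congrFun hg ⟨{a, b}, hedge habc⟩
    rw [Matrix.mulVecLin_apply,
      incidence_mulVec (edgeFinset F) (vertexFinset F) (fun e a => a ∈ e) ψ] at this
    rw [← hf a b hab, ← this, ← Finset.sum_pair hab]
    refine Finset.sum_congr ?_ fun _ _ => rfl
    ext z
    simp only [Finset.mem_filter]
    refine ⟨fun h => h.2, fun hz => ⟨mem_vertexFinset.2 ⟨_, habc, ?_⟩, hz⟩⟩
    simp only [Finset.mem_insert, Finset.mem_singleton] at hz ⊢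
    tauto

theorem IsCircuit.isEvenCircuit (h : IsCircuit 2 F.val) : IsEvenCircuit F := by
  obtain ⟨hne, ⟨hcard, hbd⟩, hmin⟩ := h
  have heven : ∀ U : Finset (Finset α), boundary 2 U.val = ∅ ↔
      ∀ e : Finset α, e.card = 2 → Even (U.filter (e ⊆ ·)).card := by
    intro U
    simp only [boundary, Set.eq_empty_iff_forall_notMem, Set.mem_ofPred_eq, not_and,
      Nat.not_odd_iff_even]
    rfl
  refine ⟨hcard, Finset.nonempty_of_ne_empty fun he => hne (by rw [he]; rfl), (heven F).1 hbd,
    fun U hU hUne hUe => ?_⟩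
  by_contra hUF
  refine hmin U.val (lt_of_le_of_ne (Finset.val_le_iff.2 hU) fun he => hUF (Finset.val_inj.1 he))
    (fun he => hUne.ne_empty (Finset.val_eq_zero.1 he)) ⟨fun S hS => hcard S (hU hS), (heven U).2 hUe⟩

theorem ncard_vertices : (vertices F.val).ncard = (vertexFinset F).card := by
  rw [← Set.ncard_coe_finset]
  congr 1
  ext a
  simp [vertices, mem_vertexFinset]

theorem ncard_edgeSet : (graph F.val).edgeSet.ncard = (edgeFinset F).card := by
  have hinj : Function.Injective fun e : Sym2 (vertices F.val) => (e.map Subtype.val).toFinset := by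
    intro e e' h
    refine Sym2.map.injective Subtype.val_injective (Sym2.ext fun a => ?_)
    rw [← Sym2.mem_toFinset, ← Sym2.mem_toFinset]
    exact Finset.ext_iff.1 h a
  rw [← Set.ncard_image_of_injective _ hinj, ← Set.ncard_coe_finset]
  congr 1
  ext e
  simp only [Set.mem_image, SetLike.mem_coe, mem_edgeFinset]
  constructor
  · rintro ⟨e, he, rfl⟩
    induction e using Sym2.ind with
    | _ a b =>
    obtain ⟨hab, S, hS, ha, hb⟩ := he
    rw [Sym2.map_mk, Sym2.toFinset_mk_eq]
    exact ⟨Finset.card_pair fun h => hab (Subtype.ext h), S, hS, by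
      simp [Finset.insert_subset_iff, ha, hb]⟩
  · rintro ⟨he, S, hS, heS⟩
    obtain ⟨a, b, hab, rfl⟩ := Finset.card_eq_two.1 he
    have ha : a ∈ S := heS (by simp)
    have hb : b ∈ S := heS (by simp)
    refine ⟨s(⟨a, S, hS, ha⟩, ⟨b, S, hS, hb⟩), ⟨fun h => hab (congrArg Subtype.val h), S, hS, ha,
      hb⟩, ?_⟩
    rw [Sym2.map_mk, Sym2.toFinset_mk_eq]

end SimplicialMulticomplex

/-! ### Simplicial circuits as families of faces -/

namespace SimplicialMulticomplex

open EuclideanPlane PlaneEmbedding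

variable {α : Type*} [DecidableEq α]

/-- The vertices of a triangle can be placed at the corners of a triangle in the plane. -/
theorem exists_straight_triangle {M : Multiset (Finset α)} {a b c : α} (hab : a ≠ b) (hbc : b ≠ c)
    (hac : a ≠ c) (hvert : ∀ v : vertices M, (v : α) = a ∨ (v : α) = b ∨ (v : α) = c) :
    ∃ p : α → EuclideanPlane, orient (p a) (p b) (p c) ≠ 0 ∧
      Function.Injective (fun v : vertices M => p v) ∧
      ∀ u v u' v' : vertices M, (graph M).Adj u v → (graph M).Adj u' v' →
        ∀ q ∈ openSegment ℝ (p u) (p v), q ∈ segment ℝ (p u') (p v') → s(u, v) = s(u', v') := by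
  set p : α → EuclideanPlane := fun z => if z = a then !₂[0, 0] else if z = b then !₂[1, 0] else
    !₂[0, 1] with hp
  have pa : p a = !₂[0, 0] := if_pos rfl
  have pb : p b = !₂[1, 0] := by simp [hp, hab.symm]
  have pc : p c = !₂[0, 1] := by simp [hp, hac.symm, hbc.symm]
  clear_value p
  have h0 : orient (p a) (p b) (p c) ≠ 0 := by
    rw [pa, pb, pc]
    simp [orient]
  have hinj : Function.Injective fun v : vertices M => p v := by
    intro u v huv
    have e0 := congrArg (fun q : EuclideanPlane => q 0) huv
    have e1 := congrArg (fun q : EuclideanPlane => q 1) huv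
    apply Subtype.ext
    rcases hvert u with hu | hu | hu <;> rcases hvert v with hv | hv | hv <;>
    simp [hu, hv, pa, pb, pc] at e0 e1 ⊢
  have hcoord : ∀ {u v : α} {q}, q ∈ segment ℝ (p u) (p v) → ∃ s t : ℝ, 0 ≤ s ∧ 0 ≤ t ∧
      s + t = 1 ∧ q 0 = s * p u 0 + t * p v 0 ∧ q 1 = s * p u 1 + t * p v 1 := by
    rintro u v _ ⟨s, t, hs, ht, hst, rfl⟩
    exact ⟨s, t, hs, ht, hst, by simp, by simp⟩
  have hcoord' : ∀ {u v : α} {q}, q ∈ openSegment ℝ (p u) (p v) → ∃ s t : ℝ, 0 < s ∧ 0 < t ∧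
      s + t = 1 ∧ q 0 = s * p u 0 + t * p v 0 ∧ q 1 = s * p u 1 + t * p v 1 := by
    rintro u v _ ⟨s, t, hs, ht, hst, rfl⟩
    exact ⟨s, t, hs, ht, hst, by simp, by simp⟩
  refine ⟨p, h0, hinj, ?_⟩
  · intro u v u' v' huv huv' q hq hq'
    have hne : (u : α) ≠ v := fun h => huv.1 (Subtype.ext h)
    have hne' : (u' : α) ≠ v' := fun h => huv'.1 (Subtype.ext h)
    obtain ⟨s, t, hs, ht, hst, e0, e1⟩ := hcoord' hq
    obtain ⟨s', t', hs', ht', hst', e0', e1'⟩ := hcoord hq'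
    rw [Sym2.eq_iff]
    simp only [Subtype.ext_iff]
    rcases hvert u with hu | hu | hu <;> rcases hvert v with hv | hv | hv <;>
    first
    | exact absurd (hu.trans hv.symm) hne
    | rcases hvert u' with hu' | hu' | hu' <;> rcases hvert v' with hv' | hv' | hv' <;>
      first
      | exact absurd (hu'.trans hv'.symm) hne'
      | exact Or.inl ⟨hu.trans hu'.symm, hv.trans hv'.symm⟩
      | exact Or.inr ⟨hu.trans hv'.symm, hv.trans hu'.symm⟩
      | exfalso
        simp [hu, hv, pa, pb, pc] at e0 e1
        simp [hu', hv', pa, pb, pc] at e0' e1'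
        linarith

theorem exists_embedding_triangle {M : Multiset (Finset α)} {a b c : α}
    (hS : ({a, b, c} : Finset α).card = 3) (hmem : ∀ S, S ∈ M ↔ S = {a, b, c}) :
    ∃ (D : PlaneEmbedding (graph M)) (A B C : EuclideanPlane), orient A B C ≠ 0 ∧
      D.arcsWithin {v | (v : α) ∈ ({a, b, c} : Finset α)} = sides A B C ∧
      D.drawing = sides A B C := by
  obtain ⟨hab, hbc, hac⟩ := triple_ne hS
  have hcard : ∀ S' ∈ M, S'.card = 3 := fun S' h => by rw [(hmem S').1 h, hS]
  have hvert : ∀ v : vertices M, (v : α) = a ∨ (v : α) = b ∨ (v : α) = c := by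
    rintro ⟨v, S', hS', hv⟩
    rw [hmem] at hS'
    simpa [hS'] using hv
  obtain ⟨p, h0, hinj, he⟩ := exists_straight_triangle hab hbc hac hvert
  have hv : ∀ u v w : vertices M, (graph M).Adj u v → p w ∉ openSegment ℝ (p u) (p v) := by
    intro u v w huv hw
    obtain ⟨x, hx⟩ := exists_adj hcard w
    have h := he u v w x huv hx _ hw (left_mem_segment ℝ _ _)
    have hne : p u ≠ p v := fun h => huv.1 (hinj h)
    rcases Sym2.eq_iff.1 h with ⟨rfl, rfl⟩ | ⟨rfl, rfl⟩
    · exact hne (left_mem_openSegment_iff.1 hw)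
    · exact hne (right_mem_openSegment_iff.1 hw)
  have habc : ({a, b, c} : Finset α) ∈ M := (hmem _).2 rfl
  obtain ⟨a', rfl⟩ : ∃ a' : vertices M, (a' : α) = a := ⟨⟨a, _, habc, by simp⟩, rfl⟩
  obtain ⟨b', rfl⟩ : ∃ b' : vertices M, (b' : α) = b := ⟨⟨b, _, habc, by simp⟩, rfl⟩
  obtain ⟨c', rfl⟩ : ∃ c' : vertices M, (c' : α) = c := ⟨⟨c, _, habc, by simp⟩, rfl⟩
  have harcs := arcsWithin_eq_sides (P := fun v => p v) (hP := hinj) (hv := hv) (he := he) habc hS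
  refine ⟨_, p a', p b', p c', h0, harcs, ?_⟩
  · rw [← harcs]
    ext q
    rw [mem_drawing_straight (exists_adj hcard), mem_arcsWithin_straight]
    have hall : ∀ v : vertices M, v ∈ {v : vertices M | (v : α) ∈
        ({(a' : α), (b' : α), (c' : α)} : Finset α)} := fun v => by simpa using hvert v
    exact ⟨fun ⟨u, v, h⟩ => ⟨u, hall u, v, hall v, h⟩, fun ⟨u, _, v, _, h⟩ => ⟨u, v, h⟩⟩

/-- The inside and the outside of one triangle have the same frontier, so any bijection from the two
copies to the two faces works. -/
theorem exists_isFaceFamily_of_card_eq_two {M : Multiset (Finset α)} {a b c : α}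
    (hS : ({a, b, c} : Finset α).card = 3) (hmem : ∀ S, S ∈ M ↔ S = {a, b, c})
    (hM : M.card = 2) : ∃ D : PlaneEmbedding (graph M), IsFaceFamily M D := by
  obtain ⟨D, A, B, C, h0, harcs, hdraw⟩ := exists_embedding_triangle hS hmem
  have hdis : Disjoint (openTri A B C) (closedTri A B C)ᶜ :=
    Set.disjoint_compl_right_iff_subset.2 (openTri_subset_closedTri _ _ _)
  obtain ⟨φ, hφ⟩ := D.exists_equiv_faces (ι := Bool)
    (fun i => bif i then openTri A B C else (closedTri A B C)ᶜ)
    (by rintro (_ | _); exacts [compl_closedTri_nonempty h0, openTri_nonempty h0])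
    (by rintro (_ | _); exacts [(isClosed_closedTri _ _ _).isOpen_compl, isOpen_openTri _ _ _])
    (by rintro (_ | _); exacts [isPreconnected_compl_closedTri h0, isPreconnected_openTri _ _ _])
    (by
      rintro (_ | _) (_ | _) hne
      exacts [absurd rfl hne, hdis.symm, hdis, absurd rfl hne])
    (by
      rw [hdraw, ← closedTri_diff_openTri h0, ← Set.union_eq_iUnion, Set.compl_sdiff])
  have hcard : Fintype.card M.ToType = Fintype.card Bool := by
    rw [Multiset.card_coe, hM, Fintype.card_bool]
  have hfr : ∀ i, frontier (φ i : Set EuclideanPlane) = sides A B C := by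
    intro i
    rw [hφ]
    cases i
    exacts [frontier_compl_closedTri h0, frontier_openTri h0]
  refine ⟨D, (Fintype.equivOfCardEq hcard).trans φ, fun i => (hfr _).trans ?_⟩
  have hi : i.1 = {a, b, c} := (hmem _).1 Multiset.coe_mem
  rw [← harcs, hi]

/-- Two copies of one triple already form a cycle, so minimality leaves room for nothing else. -/
theorem IsCircuit.eq_pair {T : Multiset (Finset α)} (hT : IsCircuit 2 T) {S : Finset α}
    (hS : 2 ≤ T.count S) : T = {S, S} := by
  have hle : ({S, S} : Multiset (Finset α)) ≤ T := by
    have := Multiset.le_count_iff_replicate_le.1 hS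
    simpa [Multiset.replicate_succ] using this
  have hcard : S.card = 3 := hT.2.1.1 S (Multiset.one_le_count_iff_mem.1 (by omega))
  by_contra hne
  refine hT.2.2 {S, S} (lt_of_le_of_ne hle (Ne.symm hne)) (by simp) ⟨fun S' hS' => ?_, ?_⟩
  · have : S' = S := by simpa using hS'
    rw [this, hcard]
  · rw [boundary, Set.eq_empty_iff_forall_notMem]
    rintro e ⟨-, he⟩
    by_cases heS : e ⊆ S
    · have : (Multiset.filter (fun S => e ⊆ S) {S, S}).card = 2 := by
        simp [Multiset.insert_eq_cons, Multiset.filter_singleton, heS]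
      rw [this] at he
      exact absurd he (by decide)
    · have : (Multiset.filter (fun S => e ⊆ S) {S, S}).card = 0 := by
        simp [Multiset.insert_eq_cons, Multiset.filter_singleton, heS]
      rw [this] at he
      exact absurd he (by decide)

theorem IsCircuit.exists_isFaceFamily {T : Multiset (Finset α)} (hT : IsCircuit 2 T)
    (hE : ((graph T).edgeSet.ncard : ℤ) = 3 * ((vertices T).ncard : ℤ) - 6) :
    ∃ D : PlaneEmbedding (graph T), IsFaceFamily T D := by
  by_cases hnd : T.Nodup
  · lift T to Finset (Finset α) using hnd
    rw [ncard_edgeSet, ncard_vertices] at hE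
    have hF := hT.isEvenCircuit
    have hsph := hF.isSphere (by omega)
    obtain ⟨o, ho⟩ := hF.nonempty
    obtain ⟨p, hp⟩ := hsph.exists_realizes ho
    exact ⟨_, hp.isFaceFamily hsph ho⟩
  · rw [Multiset.nodup_iff_count_le_one] at hnd
    push Not at hnd
    obtain ⟨S, hS⟩ := hnd
    have hcard : S.card = 3 := hT.2.1.1 S (Multiset.one_le_count_iff_mem.1 (by omega))
    have hpair := hT.eq_pair hS
    obtain ⟨a, b, c, rfl⟩ := exists_triple hcard
    exact exists_isFaceFamily_of_card_eq_two hcard (by simp [hpair]) (by rw [hpair]; rfl)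

end SimplicialMulticomplex

theorem mainTheorem12 {α : Type*} [DecidableEq α] (T : Multiset (Finset α))
    (hT : SimplicialMulticomplex.IsCircuit 2 T)
    (hE : ((SimplicialMulticomplex.graph T).edgeSet.ncard : ℤ) =
      3 * ((SimplicialMulticomplex.vertices T).ncard : ℤ) - 6) :
    IsPlaneTriangulation (SimplicialMulticomplex.graph T) ∧
      ∃ D : PlaneEmbedding (SimplicialMulticomplex.graph T), IsFaceFamily T D := by
  have h := hT.exists_isFaceFamily hE
  exact ⟨h.elim fun _ hD =>
    SimplicialMulticomplex.IsFaceFamily.isPlaneTriangulation hT.2.1.1 hD, h⟩
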